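/- **Signature.** Let $\Sigma$ be the following signature of a dependent type theory with dependent products and booleans with large (i.e. dependent, type-motive) elimination: $\mathsf{tp}:\mathcal U$; $\ \mathsf{tm}:\mathsf{tp}\to\mathcal U$; $\ \mathsf{bool}:\mathsf{tp}$; $\ \mathsf{true},\mathsf{false}:\mathsf{tm}(\mathsf{bool})$; $\mathsf{if}:(C:\mathsf{tm}(\mathsf{bool})\to\mathsf{tp})\to(b:\mathsf{tm}(\mathsf{bool}))\to\mathsf{tm}(C\,\mathsf{true})\to\mathsf{tm}(C\,\mathsf{false})\to\mathsf{tm}(C\,b)$ with $\mathsf{if}\,C\,\mathsf{true}\,t\,f=t$ and $\mathsf{if}\,C\,\mathsf{false}\,t\,f=f$; $\mathsf{pi}:(A:\mathsf{tp})\to(\mathsf{tm}(A)\to\mathsf{tp})\to\mathsf{tp}$; $\mathsf{lam}:((x:\mathsf{tm}(A))\to\mathsf{tm}(B(x)))\to\mathsf{tm}(\mathsf{pi}\,A\,B)$; $\mathsf{app}:\mathsf{tm}(\mathsf{pi}\,A\,B)\to(x:\mathsf{tm}(A))\to\mathsf{tm}(B(x))$, with $\mathsf{app}(\mathsf{lam}\,f)\,a=f\,a$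 and $\mathsf{lam}(\mathsf{app}\,e)=e$. **Gluing topos.** Let $\mathcal C$ be a small category with a terminal object $1$. Let $\mathcal G$ be the Artin gluing of $\mathrm{Psh}(\mathcal C)$ along global sections $X\mapsto X(1)$: its objects are triples $(S,X,f:S\to X(1))$ with $S$ a set and $X$ a presheaf on $\mathcal C$; equivalently, $\mathcal G$ is the category of presheaves on $\mathcal C$ with a new terminal object adjoined. In the internal language of $\mathcal G$ let $\mathsf{syn}$ be the proposition $(\varnothing,1,!)$; working under $\mathsf{syn}$ amounts to working in $\mathrm{Psh}(\mathcal C)$ (forget $S$ and $f$). Write $\{A\mid\mathsf{syn}\hookrightarrow a_0\}$ for the extension type of those $a:A$ with $a=a_0$ under $\mathsf{syn}$; $\bullet$ for the closed modality ($\bullet(S,X,f)=(S,1,!)$); and $(x:A)\ltimes B(x)$ for the strict glue type of an open-modal type $A=(X(1),X,\mathrm{id})$ and a closed-modal family $B$, interpreted as $(\coprod_{a\in X(1)}B(a),X,\pi_1)$, which equals $A$ under $\mathsf{syn}$. Its elements are written $[\mathsf{syn}\hookrightarrow a\mid b]$, and $\pi_\bullet$ is the second projection. **Theorem (Canonicity).**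 (1) *Gluing model.* For every such $\mathcal C$ and every model $(\mathsf{tp},\mathsf{tm},\mathsf{bool},\dots)$ of $\Sigma$ in the internal language of $\mathrm{Psh}(\mathcal C)$ (the syntax), there is a model $(\mathsf{TP},\mathsf{TM},\mathsf{BOOL},\mathsf{TRUE},\mathsf{FALSE},\mathsf{IF},\mathsf{PI},\mathsf{LAM},\mathsf{APP})$ of $\Sigma$, satisfying all its $\beta$- and $\eta$-equations, in the internal language of $\mathcal G$, such that each constant lies in the extension type over its syntactic counterpart ($\mathsf{TP}:\{\mathcal U\mid\mathsf{syn}\hookrightarrow\mathsf{tp}\}$, $\mathsf{TM}:\{\mathsf{TP}\to\mathcal U\mid\mathsf{syn}\hookrightarrow\mathsf{tm}\}$, $\mathsf{BOOL}:\{\mathsf{TP}\mid\mathsf{syn}\hookrightarrow\mathsf{bool}\}$, and so on), and such that - $\mathsf{TP}=(A:\mathsf{tp})\ltimes\{\mathcal U\mid\mathsf{syn}\hookrightarrow\mathsf{tm}(A)\}$ (up to the canonical bijection) and $\mathsf{TM}(A)=\pi_\bullet A$; - $\mathsf{BOOL}=[\mathsf{syn}\hookrightarrow\mathsf{bool}\mid(b:\mathsf{tm}(\mathsf{bool}))\ltimes\bullet(b=\mathsf{true}+b=\mathsf{false})]$,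 $\mathsf{TRUE}=[\mathsf{syn}\hookrightarrow\mathsf{true}\mid\mathsf{inl}]$, $\mathsf{FALSE}=[\mathsf{syn}\hookrightarrow\mathsf{false}\mid\mathsf{inr}]$, and $\mathsf{IF}$ is defined by cases on $\pi_\bullet b$; - $\mathsf{PI}\,A\,B=[\mathsf{syn}\hookrightarrow\mathsf{pi}\,A\,B\mid(e:\mathsf{tm}(\mathsf{pi}\,A\,B))\ltimes\{(a:\mathsf{TM}(A))\to\mathsf{TM}(B(a))\mid\mathsf{syn}\hookrightarrow\mathsf{app}\,e\}]$, $\mathsf{LAM}\,f=[\mathsf{syn}\hookrightarrow\mathsf{lam}\,f\mid f]$, and $\mathsf{APP}\,e\,a=(\pi_\bullet e)\,a$. (2) *Canonicity.* Let $\mathcal T$ be the free locally cartesian closed category generated by $\Sigma$, presented as the closed types and terms, modulo judgmental equality, of extensional type theory (unit, $\Pi$, $\Sigma$ and extensional equality types) with the constants and equations of the signature. For every closed term $b:\mathsf{tm}(\mathsf{bool})$, that is, every morphism $b:1_{\mathcal T}\to\mathsf{tm}(\mathsf{bool})$, either $b=\mathsf{true}$ or $b=\mathsf{false}$ (judgmentally,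 in the empty context). -/

import Mathlib

open CategoryTheory Opposite

universe v

namespace STC

/-! ### Models of the signature in a presheaf topos -/

/-- The two judgment forms of the object type theory, interpreted in the internal language of the
presheaf topos on `D`: a (large) type `tp : U` and a family of (small) types `tm : tp → U`. -/
structure Judgments (D : Type v) [SmallCategory D] where
  tp : Dᵒᵖ ⥤ Type (v + 1)
  tm : tp.Elements ⥤ Type v

namespace Judgments

variable {D : Type v} [SmallCategory D] (J : Judgments D)

/-- Elements of `tp` at stage `w`. -/
abbrev Ty (w : D) : Type (v + 1) := J.tp.obj (op w)

/-- Elements of `tm A` at stage `w`. -/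
def Tm {w : D} (A : J.Ty w) : Type v := J.tm.obj (J.tp.elementsMk (op w) A)

/-- Restriction of an element of `tp` along `σ`. -/
def tyRes {w w' : D} (σ : w' ⟶ w) (A : J.Ty w) : J.Ty w' := J.tp.map σ.op A

theorem tyRes_id {w : D} (A : J.Ty w) : J.tyRes (𝟙 w) A = A := by
  simp [tyRes]

theorem tyRes_comp {w w' w'' : D} (σ : w'' ⟶ w') (ρ : w' ⟶ w) (A : J.Ty w) :
    J.tyRes (σ ≫ ρ) A = J.tyRes σ (J.tyRes ρ A) := by
  simp [tyRes]

theorem tyRes_trans {w w' w'' : D} {σ : w'' ⟶ w'} {ρ : w' ⟶ w} {A : J.Ty w} {A' : J.Ty w'}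
    {A'' : J.Ty w''} (h : J.tyRes ρ A = A') (h' : J.tyRes σ A' = A'') :
    J.tyRes (σ ≫ ρ) A = A'' := by
  rw [tyRes_comp, h, h']

/-- Restriction of an element of `tm A` along `σ`. The type of the result is any `A'` that equals the
restriction of `A`. -/
def res {w w' : D} (σ : w' ⟶ w) {A : J.Ty w} {A' : J.Ty w'} (h : J.tyRes σ A = A')
    (x : J.Tm A) : J.Tm A' :=
  J.tm.map (CategoryOfElements.homMk (J.tp.elementsMk (op w) A) (J.tp.elementsMk (op w') A') σ.op h) x

theorem res_id {w : D} {A : J.Ty w} (x : J.Tm A) : J.res (𝟙 w) (J.tyRes_id A) x = x :=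
  Functor.map_id_apply J.tm _ x

theorem res_res {w w' w'' : D} (σ : w'' ⟶ w') (ρ : w' ⟶ w) {A : J.Ty w} {A' : J.Ty w'}
    {A'' : J.Ty w''} (h : J.tyRes ρ A = A') (h' : J.tyRes σ A' = A'') (x : J.Tm A) :
    J.res σ h' (J.res ρ h x) = J.res (σ ≫ ρ) (J.tyRes_trans h h') x :=
  (Functor.map_comp_apply J.tm _ _ x).symm

/-- The internal function space `tm A → tp` at stage `w`: natural families indexed by all later
stages. (The index `A'` is a name for the restriction of `A` to the later stage.) -/
@[ext]
structure TyFam {w : D} (A : J.Ty w) where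
  toFun : ∀ {w' : D} (ρ : w' ⟶ w) {A' : J.Ty w'}, J.tyRes ρ A = A' → J.Tm A' → J.Ty w'
  natural : ∀ {w' w'' : D} (ρ : w' ⟶ w) (σ : w'' ⟶ w') {A' : J.Ty w'} {A'' : J.Ty w''}
    (h : J.tyRes ρ A = A') (h' : J.tyRes σ A' = A'') (x : J.Tm A'),
    J.tyRes σ (toFun ρ h x) = toFun (σ ≫ ρ) (J.tyRes_trans h h') (J.res σ h' x)

/-- The internal dependent function space `(x : tm A) → tm (B x)` at stage `w`. -/
@[ext]
structure TmFam {w : D} {A : J.Ty w} (B : J.TyFam A) where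
  toFun : ∀ {w' : D} (ρ : w' ⟶ w) (x : J.Tm (J.tyRes ρ A)), J.Tm (B.toFun ρ rfl x)
  natural : ∀ {w' w'' : D} (ρ : w' ⟶ w) (σ : w'' ⟶ w') (x : J.Tm (J.tyRes ρ A)),
    J.res σ (B.natural ρ σ rfl (J.tyRes_comp σ ρ A).symm x) (toFun ρ x) =
      toFun (σ ≫ ρ) (J.res σ (J.tyRes_comp σ ρ A).symm x)

variable {J}

/-- Application of an internal function `B : tm A → tp` to `x : tm A`. -/
def TyFam.at {w : D} {A : J.Ty w} (B : J.TyFam A) (x : J.Tm A) : J.Ty w :=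
  B.toFun (𝟙 w) (J.tyRes_id A) x

/-- Restriction of an internal function along `σ`. -/
def TyFam.res {w w' : D} {A : J.Ty w} {A' : J.Ty w'} (B : J.TyFam A) (σ : w' ⟶ w)
    (h : J.tyRes σ A = A') : J.TyFam A' where
  toFun ρ _ h' x := B.toFun (ρ ≫ σ) (J.tyRes_trans h h') x
  natural ρ τ _ _ h' h'' x := by
    simpa using B.natural (ρ ≫ σ) τ (J.tyRes_trans h h') h'' x

/-- Application, at a later stage, of an internal dependent function; as in `TyFam`, the restriction of
`A` to that stage may go under any name `A'`. -/
def TmFam.ev {w w' : D} {A : J.Ty w} {B : J.TyFam A} (f : J.TmFam B) (ρ : w' ⟶ w)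
    {A' : J.Ty w'} (h : J.tyRes ρ A = A') (x : J.Tm A') : J.Tm (B.toFun ρ h x) :=
  match A', h, x with
  | _, rfl, x => f.toFun ρ x

theorem TmFam.ev_natural {w w' w'' : D} {A : J.Ty w} {B : J.TyFam A} (f : J.TmFam B)
    {ρ : w' ⟶ w} {σ : w'' ⟶ w'} {τ : w'' ⟶ w} (e : σ ≫ ρ = τ) {A' : J.Ty w'} {A'' : J.Ty w''}
    (h : J.tyRes ρ A = A') (h' : J.tyRes σ A' = A'') (h'' : J.tyRes τ A = A'') (x : J.Tm A')
    (hB : J.tyRes σ (B.toFun ρ h x) = B.toFun τ h'' (J.res σ h' x)) :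
    J.res σ hB (f.ev ρ h x) = f.ev τ h'' (J.res σ h' x) := by
  subst e
  subst h
  subst h''
  exact f.natural ρ σ x

/-- Restriction of an internal dependent function along `σ`. -/
def TmFam.res {w w' : D} {A : J.Ty w} {A' : J.Ty w'} {B : J.TyFam A} (f : J.TmFam B)
    (σ : w' ⟶ w) (h : J.tyRes σ A = A') : J.TmFam (B.res σ h) where
  toFun ρ x := f.ev (ρ ≫ σ) (J.tyRes_trans h rfl) x
  natural ρ τ x := f.ev_natural (by simp) _ _ _ x _

theorem TyFam.at_res {w w' : D} {A : J.Ty w} {A' : J.Ty w'} (B : J.TyFam A) (σ : w' ⟶ w)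
    (h : J.tyRes σ A = A') (x : J.Tm A) :
    J.tyRes σ (B.at x) = (B.res σ h).at (J.res σ h x) := by
  have := B.natural (𝟙 w) σ (J.tyRes_id A) h x
  simpa [TyFam.at, TyFam.res] using this

theorem TyFam.at_res' {w w' : D} {A : J.Ty w} {A' : J.Ty w'} (B : J.TyFam A) (σ : w' ⟶ w)
    (h : J.tyRes σ A = A') {x : J.Tm A} {x' : J.Tm A'} (hx : J.res σ h x = x') :
    J.tyRes σ (B.at x) = (B.res σ h).at x' :=
  hx ▸ B.at_res σ h x

end Judgments

/-- A model, in the internal language of the presheaf topos on `D`, of the signature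
* `tp : U`, `tm : tp → U`, `bool : tp`, `tru fls : tm bool`;
* `ite : (C : tm bool → tp) → (b : tm bool) → tm (C tru) → tm (C fls) → tm (C b)`, with
  `ite C tru t f = t` and `ite C fls t f = f`;
* `pi : (A : tp) → (tm A → tp) → tp`;
* `lam : ((x : tm A) → tm (B x)) → tm (pi A B)`;
* `app : tm (pi A B) → (x : tm A) → tm (B x)`, with `app (lam f) = f` and `lam (app e) = e`.
A constant of the internal language is given by its value at each stage; the fields `*_res` say
that these values are compatible with restriction. -/
structure Model (D : Type v) [SmallCategory D] where
  J : Judgments D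
  bool : ∀ w : D, J.Ty w
  bool_res : ∀ {w w' : D} (σ : w' ⟶ w), J.tyRes σ (bool w) = bool w'
  tru : ∀ w : D, J.Tm (bool w)
  tru_res : ∀ {w w' : D} (σ : w' ⟶ w), J.res σ (bool_res σ) (tru w) = tru w'
  fls : ∀ w : D, J.Tm (bool w)
  fls_res : ∀ {w w' : D} (σ : w' ⟶ w), J.res σ (bool_res σ) (fls w) = fls w'
  ite : ∀ {w : D} (C : J.TyFam (bool w)) (b : J.Tm (bool w)),
    J.Tm (C.at (tru w)) → J.Tm (C.at (fls w)) → J.Tm (C.at b)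
  ite_res : ∀ {w w' : D} (σ : w' ⟶ w) (C : J.TyFam (bool w))
    (b : J.Tm (bool w)) (t : J.Tm (C.at (tru w)))
    (f : J.Tm (C.at (fls w))),
    J.res σ (C.at_res σ (bool_res σ) b) (ite C b t f) =
      ite (C.res σ (bool_res σ)) (J.res σ (bool_res σ) b)
        (J.res σ (C.at_res' σ (bool_res σ) (tru_res σ)) t)
        (J.res σ (C.at_res' σ (bool_res σ) (fls_res σ)) f)
  ite_tru : ∀ {w : D} (C : J.TyFam (bool w)) (t : J.Tm (C.at (tru w)))
    (f : J.Tm (C.at (fls w))), ite C (tru w) t f = t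
  ite_fls : ∀ {w : D} (C : J.TyFam (bool w)) (t : J.Tm (C.at (tru w)))
    (f : J.Tm (C.at (fls w))), ite C (fls w) t f = f
  pi : ∀ {w : D} (A : J.Ty w), J.TyFam A → J.Ty w
  pi_res : ∀ {w w' : D} (σ : w' ⟶ w) (A : J.Ty w) (B : J.TyFam A),
    J.tyRes σ (pi A B) = pi (J.tyRes σ A) (B.res σ rfl)
  lam : ∀ {w : D} {A : J.Ty w} {B : J.TyFam A},
    J.TmFam B → J.Tm (pi A B)
  lam_res : ∀ {w w' : D} (σ : w' ⟶ w) {A : J.Ty w} {B : J.TyFam A}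
    (f : J.TmFam B),
    J.res σ (pi_res σ A B) (lam f) = lam (f.res σ rfl)
  app : ∀ {w : D} {A : J.Ty w} {B : J.TyFam A},
    J.Tm (pi A B) → J.TmFam B
  app_res : ∀ {w w' : D} (σ : w' ⟶ w) {A : J.Ty w} {B : J.TyFam A}
    (e : J.Tm (pi A B)),
    app (J.res σ (pi_res σ A B) e) = (app e).res σ rfl
  app_lam : ∀ {w : D} {A : J.Ty w} {B : J.TyFam A}
    (f : J.TmFam B), app (lam f) = f
  lam_app : ∀ {w : D} {A : J.Ty w} {B : J.TyFam A}
    (e : J.Tm (pi A B)), lam (app e) = e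


/-! ### The gluing topos and its syntactic part

For a category `C` with a terminal object `t`, a presheaf on `WithTerminal C` (`C` with a new
terminal object `star`) is a presheaf `X` on `C`, a set `S`, and a map `S → X t`: it is an object of
the Artin gluing along the global sections functor. The phase `syn` is the subterminal
presheaf that is inhabited exactly at the stages coming from `C`; the slice over it is the topos
of presheaves on `C`, so that to work under `syn` is to restrict along `C → WithTerminal C`. -/

namespace Judgments

variable {C : Type v} [SmallCategory C] (J : Judgments (WithTerminal C))

/-- The restriction of `tp` and `tm` to the syntactic phase. -/
def syn : Judgments C where
  tp := WithTerminal.incl.op ⋙ J.tp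
  tm :=
    { obj := fun p => J.tm.obj ⟨op (WithTerminal.of p.1.unop), p.2⟩
      map := fun {p q} f => J.tm.map (CategoryOfElements.homMk
        (J.tp.elementsMk (op (WithTerminal.of p.1.unop)) p.2)
        (J.tp.elementsMk (op (WithTerminal.of q.1.unop)) q.2) (WithTerminal.incl.op.map f.1) f.2)
      map_id := fun _ => J.tm.map_id _
      map_comp := fun {p q r} f g => J.tm.map_comp
        (CategoryOfElements.homMk (J.tp.elementsMk (op (WithTerminal.of p.1.unop)) p.2)
          (J.tp.elementsMk (op (WithTerminal.of q.1.unop)) q.2) (WithTerminal.incl.op.map f.1) f.2)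
        (CategoryOfElements.homMk (J.tp.elementsMk (op (WithTerminal.of q.1.unop)) q.2)
          (J.tp.elementsMk (op (WithTerminal.of r.1.unop)) r.2) (WithTerminal.incl.op.map g.1) g.2) }

variable {J}

/-- Under `syn`, internal functions in the gluing topos and in the syntactic topos agree, as no
object of `C` receives a map from `star`: from the latter to the former. -/
def TyFam.extend {c : C} {A : J.syn.Ty c} (B : J.syn.TyFam A) :
    J.TyFam (w := WithTerminal.of c) A where
  toFun {w'} := match w' with
    | .of _ => fun ρ _ h x => B.toFun (WithTerminal.down ρ) h x
    | .star => fun ρ _ _ _ => (WithTerminal.false_of_from_star ρ).elim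
  natural {w' w''} := match w', w'' with
    | .of _, .of _ => fun ρ σ _ _ h h' x =>
        B.natural (WithTerminal.down ρ) (WithTerminal.down σ) h h' x
    | .star, _ => fun ρ => (WithTerminal.false_of_from_star ρ).elim
    | .of _, .star => fun _ σ => (WithTerminal.false_of_from_star σ).elim

/-- The analogue of `TyFam.extend` for dependent functions. -/
def TmFam.extend {c : C} {A : J.syn.Ty c} {B : J.syn.TyFam A} (f : J.syn.TmFam B) :
    J.TmFam B.extend where
  toFun {w'} := match w' with
    | .of _ => fun ρ x => f.toFun (WithTerminal.down ρ) x
    | .star => fun ρ _ => (WithTerminal.false_of_from_star ρ).elim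
  natural {w' w''} := match w', w'' with
    | .of _, .of _ => fun ρ σ x => f.natural (WithTerminal.down ρ) (WithTerminal.down σ) x
    | .star, _ => fun ρ => (WithTerminal.false_of_from_star ρ).elim
    | .of _, .star => fun _ σ => (WithTerminal.false_of_from_star σ).elim

/-- Under `syn`, internal functions in the gluing topos restrict to ones in the syntactic topos. -/
def TyFam.shrink {c : C} {A : J.Ty (WithTerminal.of c)} (B : J.TyFam A) :
    J.syn.TyFam (w := c) A where
  toFun ρ _ h x := B.toFun (WithTerminal.incl.map ρ) h x
  natural ρ σ _ _ h h' x := B.natural (WithTerminal.incl.map ρ) (WithTerminal.incl.map σ) h h' x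

/-- The analogue of `TyFam.shrink` for dependent functions. -/
def TmFam.shrink {c : C} {A : J.Ty (WithTerminal.of c)} {B : J.TyFam A} (f : J.TmFam B) :
    J.syn.TmFam (w := c) B.shrink where
  toFun ρ x := f.toFun (WithTerminal.incl.map ρ) x
  natural ρ σ x := f.natural (WithTerminal.incl.map ρ) (WithTerminal.incl.map σ) x

theorem TmFam.ev_extend {c c' : C} {A : J.syn.Ty c} {A' : J.syn.Ty c'} {B : J.syn.TyFam A}
    (f : J.syn.TmFam B) (ρ : c' ⟶ c) (h : J.syn.tyRes ρ A = A') (x : J.syn.Tm A') :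
    f.extend.ev (WithTerminal.incl.map ρ) h x = f.ev ρ h x := by
  subst h
  rfl

theorem TmFam.ev_shrink {c c' : C} {A : J.syn.Ty c} {A' : J.syn.Ty c'} {B : J.TyFam A}
    (f : J.TmFam B) (ρ : c' ⟶ c) (h : J.syn.tyRes ρ A = A') (x : J.syn.Tm A') :
    f.shrink.ev ρ h x = f.ev (WithTerminal.incl.map ρ) h x := by
  subst h
  rfl

theorem TmFam.shrink_res {c c' : C} {A : J.syn.Ty c} {A' : J.syn.Ty c'} {B : J.TyFam A}
    (f : J.TmFam B) (σ : c' ⟶ c) (h : J.syn.tyRes σ A = A') :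
    (f.res (WithTerminal.incl.map σ) h).shrink = f.shrink.res σ h := by
  ext c'' ρ x
  exact (f.ev_shrink (ρ ≫ σ) _ x).symm

theorem TmFam.shrink_heq {c : C} {A : J.Ty (WithTerminal.of c)} {B B' : J.TyFam A}
    (hB : B = B') {f : J.TmFam B} {f' : J.TmFam B'} (hf : HEq f f') :
    HEq f.shrink f'.shrink := by
  subst hB
  obtain rfl := eq_of_heq hf
  rfl

theorem TyFam.shrink_extend {c : C} {A : J.syn.Ty c} (B : J.syn.TyFam A) :
    B.extend.shrink = B := rfl

theorem TyFam.extend_shrink {c : C} {A : J.Ty (WithTerminal.of c)} (B : J.TyFam A) :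
    TyFam.extend (c := c) (A := A) B.shrink = B := by
  ext w' ρ A' h x
  cases w' with
  | of c' => rfl
  | star => exact (WithTerminal.false_of_from_star ρ).elim

theorem TyFam.extend_res {c c' : C} {A : J.syn.Ty c} {A' : J.syn.Ty c'} (B : J.syn.TyFam A)
    (σ : c' ⟶ c) (h : J.syn.tyRes σ A = A') :
    (B.res σ h).extend = B.extend.res (WithTerminal.incl.map σ) h := by
  ext w' ρ A'' h' x
  cases w' with
  | of c' => rfl
  | star => exact (WithTerminal.false_of_from_star ρ).elim

theorem TmFam.heq {D : Type v} [SmallCategory D] {J : Judgments D} {w : D} {A : J.Ty w}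
    {B B' : J.TyFam A} (hB : B = B') (f : J.TmFam B) (f' : J.TmFam B')
    (hf : ∀ {w' : D} (ρ : w' ⟶ w) (x : J.Tm (J.tyRes ρ A)),
      HEq (f.toFun ρ x) (f'.toFun ρ x)) : HEq f f' := by
  subst hB
  refine heq_of_eq ?_
  ext w' ρ x
  exact eq_of_heq (hf ρ x)

theorem TmFam.extend_res {c c' : C} {A : J.syn.Ty c} {A' : J.syn.Ty c'} {B : J.syn.TyFam A}
    (f : J.syn.TmFam B) (σ : c' ⟶ c) (h : J.syn.tyRes σ A = A') :
    HEq (f.extend.res (WithTerminal.incl.map σ) h) (f.res σ h).extend := by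
  refine TmFam.heq (TyFam.extend_res B σ h).symm _ _ fun {w'} ρ x => ?_
  cases w' with
  | of c' => exact heq_of_eq (f.ev_extend (WithTerminal.down ρ ≫ σ) _ x)
  | star => exact (WithTerminal.false_of_from_star ρ).elim

theorem TmFam.extend_shrink {c : C} {A : J.syn.Ty c} {B : J.syn.TyFam A}
    (f : J.TmFam B.extend) : TmFam.extend (c := c) (A := A) (B := B) f.shrink = f := by
  ext w' ρ x
  cases w' with
  | of c' => rfl
  | star => exact (WithTerminal.false_of_from_star ρ).elim

end Judgments

namespace Model

theorem lam_res' {D : Type v} [SmallCategory D] (N : Model D) {w w' : D} (σ : w' ⟶ w)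
    {A : N.J.Ty w} {B : N.J.TyFam A} (f : N.J.TmFam B) {B' : N.J.TyFam (N.J.tyRes σ A)}
    (hB : B.res σ rfl = B') {f' : N.J.TmFam B'} (hf : HEq (f.res σ rfl) f')
    (h : N.J.tyRes σ (N.pi A B) = N.pi (N.J.tyRes σ A) B') :
    N.J.res σ h (N.lam f) = N.lam f' := by
  subst hB
  obtain rfl := eq_of_heq hf
  exact N.lam_res σ f

theorem app_res' {D : Type v} [SmallCategory D] (N : Model D) {w w' : D} (σ : w' ⟶ w)
    {A : N.J.Ty w} {B : N.J.TyFam A} (e : N.J.Tm (N.pi A B)) {B' : N.J.TyFam (N.J.tyRes σ A)}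
    (hB : B.res σ rfl = B') (h : N.J.tyRes σ (N.pi A B) = N.pi (N.J.tyRes σ A) B') :
    HEq (N.app (N.J.res σ h e)) ((N.app e).res σ rfl) := by
  subst hB
  exact heq_of_eq (N.app_res σ e)

theorem ite_res' {D : Type v} [SmallCategory D] (N : Model D) {w w' : D} (σ : w' ⟶ w)
    (C : N.J.TyFam (N.bool w)) (b : N.J.Tm (N.bool w)) (t : N.J.Tm (C.at (N.tru w)))
    (f : N.J.Tm (C.at (N.fls w))) {C' : N.J.TyFam (N.bool w')}
    (hC : C.res σ (N.bool_res σ) = C')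
    (h₀ : N.J.tyRes σ (C.at b) = C'.at (N.J.res σ (N.bool_res σ) b))
    (h₁ : N.J.tyRes σ (C.at (N.tru w)) = C'.at (N.tru w'))
    (h₂ : N.J.tyRes σ (C.at (N.fls w)) = C'.at (N.fls w')) :
    N.J.res σ h₀ (N.ite C b t f) =
      N.ite C' (N.J.res σ (N.bool_res σ) b) (N.J.res σ h₁ t) (N.J.res σ h₂ f) := by
  subst hC
  exact N.ite_res σ C b t f

variable {C : Type v} [SmallCategory C] (N : Model (WithTerminal C))

open Judgments

/-- The restriction to the syntactic phase of a model in the gluing topos. For a model `M` of the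
signature in presheaves on `C` (the syntax), `N.syn = M` says that each constant of `N`, beginning
with `tp` and `tm`, lies in the extension type of elements that equal the corresponding constant of
`M` under `syn`. -/
def syn : Model C where
  J := N.J.syn
  bool c := N.bool (.of c)
  bool_res σ := N.bool_res (WithTerminal.incl.map σ)
  tru c := N.tru (.of c)
  tru_res σ := N.tru_res (WithTerminal.incl.map σ)
  fls c := N.fls (.of c)
  fls_res σ := N.fls_res (WithTerminal.incl.map σ)
  ite C b t f := N.ite C.extend b t f
  ite_res {c c'} σ C b t f := N.ite_res' (WithTerminal.incl.map σ) C.extend b t f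
    (TyFam.extend_res C σ (N.bool_res (WithTerminal.incl.map σ))).symm _ _ _
  ite_tru C t f := N.ite_tru C.extend t f
  ite_fls C t f := N.ite_fls C.extend t f
  pi A B := N.pi A B.extend
  pi_res σ A B := by
    rw [TyFam.extend_res]
    exact N.pi_res (WithTerminal.incl.map σ) A B.extend
  lam f := N.lam f.extend
  lam_res σ _ B f := N.lam_res' (WithTerminal.incl.map σ) f.extend
    (TyFam.extend_res B σ rfl).symm (TmFam.extend_res f σ rfl) _
  app e := (N.app e).shrink
  app_res σ _ B e := by
    have hB := TyFam.extend_res B σ rfl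
    have h := (N.pi_res (WithTerminal.incl.map σ) _ B.extend).trans (congrArg (N.pi _) hB.symm)
    refine Eq.trans ?_ (TmFam.shrink_res (N.app e) σ rfl)
    exact eq_of_heq (TmFam.shrink_heq (f := N.app (N.J.res (WithTerminal.incl.map σ) h e))
      (f' := (N.app e).res (WithTerminal.incl.map σ) rfl) hB
      (N.app_res' (WithTerminal.incl.map σ) e hB.symm h))
  app_lam f := congrArg TmFam.shrink (N.app_lam f.extend)
  lam_app e := (congrArg N.lam (TmFam.extend_shrink (N.app e))).trans (N.lam_app e)

variable (t : C)

/-- Restriction from `star` to `t`, that is, the projection from a glued object to the global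
sections of its syntactic part. -/
def glob : WithTerminal.of t ⟶ (WithTerminal.star : WithTerminal C) :=
  WithTerminal.starTerminal.from _

/-- The syntactic component of a glued type. -/
abbrev synTy (A : N.J.Ty .star) : N.J.Ty (.of t) := N.J.tyRes (glob t) A

/-- The syntactic component of a glued term. -/
abbrev synTm {A : N.J.Ty .star} (x : N.J.Tm A) : N.J.Tm (N.synTy t A) := N.J.res (glob t) rfl x

end Model

/-- A (small) type of the gluing topos that is equal, under `syn`, to a fixed presheaf with set of
global sections `Γ`. Such an element of the extension type of the universe is a set `carrier` and a
map to `Γ`. -/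
structure Glued (Γ : Type v) where
  carrier : Type v
  proj : carrier → Γ

/-- The strict glue type of an open-modal type, whose set of global sections is `Γ`, and a family
`B` of closed-modal types. Closed-modal types are trivial under `syn`, so that `B` amounts to a
family of sets indexed by `Γ`. The closed modality does not change the set at the stage `star`. -/
def glue {Γ : Type v} (B : Γ → Type v) : Glued Γ where
  carrier := Σ a, B a
  proj := Sigma.fst

namespace Model

variable {C : Type v} [SmallCategory C] (N : Model (WithTerminal C)) (t : C)

open Judgments

/-- The collection `tm A` of terms of a glued type `A`, as a type of the gluing topos that restricts
to the syntactic terms of the syntactic component of `A`. -/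
def sem (A : N.J.Ty .star) : Glued (N.J.Tm (N.synTy t A)) where
  carrier := N.J.Tm A
  proj := N.synTm t

/-- `glue (b : tm bool) (closed (b = tru + b = fls))`, where `bool`, `tru`, `fls` are the syntactic
constants (here obtained as the syntactic components of those of `N`). -/
def boolGlue : Glued (N.J.Tm (N.synTy t (N.bool .star))) :=
  glue fun b =>
    ULift.{v} (PLift (b = N.synTm t (N.tru .star))) ⊕ ULift.{v} (PLift (b = N.synTm t (N.fls .star)))

/-- The syntactic application `app e` of a term `e` of the syntactic component of `pi A B`. -/
def synApp {A : N.J.Ty .star} {B : N.J.TyFam A} (e : N.J.Tm (N.synTy t (N.pi A B))) :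
    N.J.TmFam (B.res (glob t) rfl) :=
  N.app (N.J.res (𝟙 _) ((N.J.tyRes_id _).trans (N.pi_res (glob t) A B)) e)

theorem synApp_synTm {A : N.J.Ty .star} {B : N.J.TyFam A} (e : N.J.Tm (N.pi A B)) :
    N.synApp t (N.synTm t e) = (N.app e).res (glob t) rfl := by
  rw [← N.app_res]
  unfold synApp synTm
  rw [Judgments.res_res]
  congr 2

/-- `glue (e : tm (pi A B)) (ext ((a : TM A) → TM (B a)) (app e))`: a syntactic term `e` together
with an internal dependent function of glued terms that equals `app e` under `syn`. -/
def piGlue (A : N.J.Ty .star) (B : N.J.TyFam A) : Glued (N.J.Tm (N.synTy t (N.pi A B))) :=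
  glue fun e => {g : N.J.TmFam B // g.res (glob t) rfl = N.synApp t e}

/-- The defining equations of the canonicity gluing model, on the semantic components (the values
at the stage `star`); the syntactic components are fixed by an equation `N.syn = M`. The value of
`ite` is fixed by the computation rules of `Model`: by `bool_eq`, an element of `TM BOOL` is glued
from a syntactic boolean and either a proof that it equals `tru` or a proof that it equals `fls`. -/
structure IsCanonicityModel : Prop where
  /-- `TP = glue (A : tp) (ext U (tm A))`, and `TM` is the closed projection. -/
  tp_eq : Function.Bijective fun A : N.J.Ty .star =>
    (⟨N.synTy t A, N.sem t A⟩ : Σ A₀ : N.J.Ty (.of t), Glued (N.J.Tm A₀))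
  /-- `BOOL = [syn ↪ bool | glue (b : tm bool) (closed (b = tru + b = fls))]`. -/
  bool_eq : N.sem t (N.bool .star) = N.boolGlue t
  /-- `TRUE = [syn ↪ tru | inl]`. -/
  tru_eq : HEq (N.tru .star)
    (⟨N.synTm t (N.tru .star), .inl ⟨⟨rfl⟩⟩⟩ : (N.boolGlue t).carrier)
  /-- `FALSE = [syn ↪ fls | inr]`. -/
  fls_eq : HEq (N.fls .star)
    (⟨N.synTm t (N.fls .star), .inr ⟨⟨rfl⟩⟩⟩ : (N.boolGlue t).carrier)
  /-- `PI A B = [syn ↪ pi A B | glue (e : tm (pi A B)) (ext ((a : TM A) → TM (B a)) (app e))]`. -/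
  pi_eq : ∀ (A : N.J.Ty .star) (B : N.J.TyFam A), N.sem t (N.pi A B) = N.piGlue t A B
  /-- `LAM f = [syn ↪ lam f | f]`. -/
  lam_eq : ∀ {A : N.J.Ty .star} {B : N.J.TyFam A} (f : N.J.TmFam B), HEq (N.lam f)
    (⟨N.synTm t (N.lam f), f, by rw [synApp_synTm, N.app_lam]⟩ : (N.piGlue t A B).carrier)
  /-- `APP e` is the closed projection of `e`. -/
  app_eq : ∀ {A : N.J.Ty .star} {B : N.J.TyFam A} (e : N.J.Tm (N.pi A B))
    (p : (N.piGlue t A B).carrier), HEq e p → N.app e = p.2.1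

end Model

end STC

/-! ### The syntax: the logical framework over the signature

The free locally cartesian closed category generated by the signature, presented as the
classifying category of extensional type theory (unit, dependent product, dependent sum and
extensional equality types) with the constants and equations of the signature. Closed terms modulo
judgmental equality are the morphisms out of its terminal object. -/

namespace LF

/-- The typed constants of the signature. -/
inductive Con
  | bool | tru | fls | ite | pi | lam | app

/-- Raw types and terms, with de Bruijn indices. In `pi A B`, `sigma A B`, `lam A a` and
`pair B a b` the second, second, second and first argument respectively lie under a binder. -/
inductive Exp
  | var (n : ℕ)
  | unit
  | star
  | pi (A B : Exp)
  | lam (A a : Exp)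
  | app (f a : Exp)
  | sigma (A B : Exp)
  | pair (B a b : Exp)
  | fst (p : Exp)
  | snd (p : Exp)
  | eq (A a b : Exp)
  | refl (a : Exp)
  | tp
  | tm (A : Exp)
  | con (c : Con)

namespace Exp

/-- Extension of a renaming under a binder. -/
def upr (ξ : ℕ → ℕ) : ℕ → ℕ
  | 0 => 0
  | n + 1 => ξ n + 1

/-- Renaming of variables. -/
def rename : (ℕ → ℕ) → Exp → Exp
  | ξ, var n => var (ξ n)
  | _, unit => unit
  | _, star => star
  | ξ, pi A B => pi (A.rename ξ) (B.rename (upr ξ))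
  | ξ, lam A a => lam (A.rename ξ) (a.rename (upr ξ))
  | ξ, app f a => app (f.rename ξ) (a.rename ξ)
  | ξ, sigma A B => sigma (A.rename ξ) (B.rename (upr ξ))
  | ξ, pair B a b => pair (B.rename (upr ξ)) (a.rename ξ) (b.rename ξ)
  | ξ, fst p => fst (p.rename ξ)
  | ξ, snd p => snd (p.rename ξ)
  | ξ, eq A a b => eq (A.rename ξ) (a.rename ξ) (b.rename ξ)
  | ξ, refl a => refl (a.rename ξ)
  | _, tp => tp
  | ξ, tm A => tm (A.rename ξ)
  | _, con c => con c

/-- Weakening by one variable. -/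
def wk (a : Exp) : Exp := a.rename Nat.succ

/-- Extension of a substitution under a binder. -/
def up (σ : ℕ → Exp) : ℕ → Exp
  | 0 => var 0
  | n + 1 => (σ n).wk

/-- Simultaneous capture-avoiding substitution. -/
def subst : (ℕ → Exp) → Exp → Exp
  | σ, var n => σ n
  | _, unit => unit
  | _, star => star
  | σ, pi A B => pi (A.subst σ) (B.subst (up σ))
  | σ, lam A a => lam (A.subst σ) (a.subst (up σ))
  | σ, app f a => app (f.subst σ) (a.subst σ)
  | σ, sigma A B => sigma (A.subst σ) (B.subst (up σ))
  | σ, pair B a b => pair (B.subst (up σ)) (a.subst σ) (b.subst σ)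
  | σ, fst p => fst (p.subst σ)
  | σ, snd p => snd (p.subst σ)
  | σ, eq A a b => eq (A.subst σ) (a.subst σ) (b.subst σ)
  | σ, refl a => refl (a.subst σ)
  | _, tp => tp
  | σ, tm A => tm (A.subst σ)
  | _, con c => con c

/-- The substitution of `a` for the variable `0`. -/
def single (a : Exp) : ℕ → Exp
  | 0 => a
  | n + 1 => var n

/-- `B.inst a` is `B` with `a` for the variable `0`. -/
def inst (B a : Exp) : Exp := B.subst (single a)

/-- `bool`, as an expression. -/
abbrev bool : Exp := con .bool

/-- `tru`, as an expression. -/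
abbrev tru : Exp := con .tru

/-- `fls`, as an expression. -/
abbrev fls : Exp := con .fls

/-- The elimination `ite C b t f`. -/
abbrev ite (C b t f : Exp) : Exp := app (app (app (app (con .ite) C) b) t) f

/-- The dependent product type of the object theory. -/
abbrev Pi (A B : Exp) : Exp := app (app (con .pi) A) B

/-- The abstraction of the object theory. -/
abbrev Lam (A B f : Exp) : Exp := app (app (app (con .lam) A) B) f

/-- The application of the object theory, as a function of its last argument. -/
abbrev App (A B e : Exp) : Exp := app (app (app (con .app) A) B) e

end Exp

open Exp

/-- The types of the constants. -/
def Con.type : Con → Exp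
  | .bool => tp
  | .tru => tm Exp.bool
  | .fls => tm Exp.bool
  -- `(C : tm bool → tp) → (b : tm bool) → tm (C tru) → tm (C fls) → tm (C b)`
  | .ite =>
    .pi (.pi (tm Exp.bool) tp) <|
    .pi (tm Exp.bool) <|
    .pi (tm (.app (var 1) Exp.tru)) <|
    .pi (tm (.app (var 2) Exp.fls)) <|
    tm (.app (var 3) (var 2))
  -- `(A : tp) → (tm A → tp) → tp`
  | .pi => .pi tp <| .pi (.pi (tm (var 0)) tp) tp
  -- `(A : tp) → (B : tm A → tp) → ((x : tm A) → tm (B x)) → tm (Pi A B)`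
  | .lam =>
    .pi tp <|
    .pi (.pi (tm (var 0)) tp) <|
    .pi (.pi (tm (var 1)) (tm (.app (var 1) (var 0)))) <|
    tm (Pi (var 2) (var 1))
  -- `(A : tp) → (B : tm A → tp) → tm (Pi A B) → (x : tm A) → tm (B x)`
  | .app =>
    .pi tp <|
    .pi (.pi (tm (var 0)) tp) <|
    .pi (tm (Pi (var 1) (var 0))) <|
    .pi (tm (var 2)) <|
    tm (.app (var 2) (var 0))

/-- `HasVar Γ n A`: the variable `n` has type `A` in the context `Γ` (most recent type first). -/
inductive HasVar : List Exp → ℕ → Exp → Prop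
  | zero (Γ : List Exp) (A : Exp) : HasVar (A :: Γ) 0 A.wk
  | succ {Γ : List Exp} {n : ℕ} {A : Exp} (B : Exp) :
      HasVar Γ n A → HasVar (B :: Γ) (n + 1) A.wk

/-- The forms of judgment: well-formed context, type, equal types, term, equal terms. -/
inductive Jdg
  | ctx
  | isTy (A : Exp)
  | eqTy (A B : Exp)
  | hasTy (a A : Exp)
  | eqTm (a b A : Exp)

open Jdg

/-- Derivability of a judgment in a context. -/
inductive Derivable : List Exp → Jdg → Prop
  -- contexts
  | nil : Derivable [] ctx
  | cons {Γ A} : Derivable Γ ctx → Derivable Γ (isTy A) → Derivable (A :: Γ) ctx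
  -- type formation
  | unit_ty {Γ} : Derivable Γ ctx → Derivable Γ (isTy unit)
  | pi_ty {Γ A B} : Derivable Γ (isTy A) → Derivable (A :: Γ) (isTy B) →
      Derivable Γ (isTy (.pi A B))
  | sigma_ty {Γ A B} : Derivable Γ (isTy A) → Derivable (A :: Γ) (isTy B) →
      Derivable Γ (isTy (sigma A B))
  | eq_ty {Γ A a b} : Derivable Γ (isTy A) → Derivable Γ (hasTy a A) → Derivable Γ (hasTy b A) →
      Derivable Γ (isTy (eq A a b))
  | tp_ty {Γ} : Derivable Γ ctx → Derivable Γ (isTy tp)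
  | tm_ty {Γ A} : Derivable Γ (hasTy A tp) → Derivable Γ (isTy (tm A))
  -- equality of types
  | ty_refl {Γ A} : Derivable Γ (isTy A) → Derivable Γ (eqTy A A)
  | ty_symm {Γ A B} : Derivable Γ (eqTy A B) → Derivable Γ (eqTy B A)
  | ty_trans {Γ A B C} : Derivable Γ (eqTy A B) → Derivable Γ (eqTy B C) → Derivable Γ (eqTy A C)
  | pi_congr {Γ A A' B B'} : Derivable Γ (eqTy A A') → Derivable (A :: Γ) (eqTy B B') →
      Derivable Γ (eqTy (.pi A B) (.pi A' B'))
  | sigma_congr {Γ A A' B B'} : Derivable Γ (eqTy A A') → Derivable (A :: Γ) (eqTy B B') →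
      Derivable Γ (eqTy (sigma A B) (sigma A' B'))
  | eq_congr {Γ A A' a a' b b'} : Derivable Γ (eqTy A A') → Derivable Γ (eqTm a a' A) →
      Derivable Γ (eqTm b b' A) → Derivable Γ (eqTy (eq A a b) (eq A' a' b'))
  | tm_congr {Γ A A'} : Derivable Γ (eqTm A A' tp) → Derivable Γ (eqTy (tm A) (tm A'))
  -- terms
  | var {Γ n A} : Derivable Γ ctx → HasVar Γ n A → Derivable Γ (hasTy (var n) A)
  | conv {Γ a A B} : Derivable Γ (hasTy a A) → Derivable Γ (eqTy A B) → Derivable Γ (hasTy a B)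
  | star {Γ} : Derivable Γ ctx → Derivable Γ (hasTy star unit)
  | lam {Γ A B a} : Derivable Γ (isTy A) → Derivable (A :: Γ) (hasTy a B) →
      Derivable Γ (hasTy (.lam A a) (.pi A B))
  | app {Γ A B f a} : Derivable Γ (hasTy f (.pi A B)) → Derivable Γ (hasTy a A) →
      Derivable Γ (hasTy (.app f a) (B.inst a))
  | pair {Γ A B a b} : Derivable (A :: Γ) (isTy B) → Derivable Γ (hasTy a A) →
      Derivable Γ (hasTy b (B.inst a)) → Derivable Γ (hasTy (pair B a b) (sigma A B))
  | fst {Γ A B p} : Derivable Γ (hasTy p (sigma A B)) → Derivable Γ (hasTy (fst p) A)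
  | snd {Γ A B p} : Derivable Γ (hasTy p (sigma A B)) →
      Derivable Γ (hasTy (snd p) (B.inst (fst p)))
  | refl {Γ A a} : Derivable Γ (hasTy a A) → Derivable Γ (hasTy (refl a) (eq A a a))
  | con {Γ} (c : Con) : Derivable Γ ctx → Derivable Γ (hasTy (con c) c.type)
  -- equality of terms
  | tm_refl {Γ a A} : Derivable Γ (hasTy a A) → Derivable Γ (eqTm a a A)
  | tm_symm {Γ a b A} : Derivable Γ (eqTm a b A) → Derivable Γ (eqTm b a A)
  | tm_trans {Γ a b c A} : Derivable Γ (eqTm a b A) → Derivable Γ (eqTm b c A) →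
      Derivable Γ (eqTm a c A)
  | eq_conv {Γ a b A B} : Derivable Γ (eqTm a b A) → Derivable Γ (eqTy A B) →
      Derivable Γ (eqTm a b B)
  | lam_congr {Γ A A' B a a'} : Derivable Γ (eqTy A A') → Derivable (A :: Γ) (eqTm a a' B) →
      Derivable Γ (eqTm (.lam A a) (.lam A' a') (.pi A B))
  | app_congr {Γ A B f f' a a'} : Derivable Γ (eqTm f f' (.pi A B)) → Derivable Γ (eqTm a a' A) →
      Derivable Γ (eqTm (.app f a) (.app f' a') (B.inst a))
  | pair_congr {Γ A B B' a a' b b'} : Derivable (A :: Γ) (eqTy B B') →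
      Derivable Γ (eqTm a a' A) → Derivable Γ (eqTm b b' (B.inst a)) →
      Derivable Γ (eqTm (pair B a b) (pair B' a' b') (sigma A B))
  | fst_congr {Γ A B p p'} : Derivable Γ (eqTm p p' (sigma A B)) →
      Derivable Γ (eqTm (fst p) (fst p') A)
  | snd_congr {Γ A B p p'} : Derivable Γ (eqTm p p' (sigma A B)) →
      Derivable Γ (eqTm (snd p) (snd p') (B.inst (fst p)))
  | unit_eta {Γ a} : Derivable Γ (hasTy a unit) → Derivable Γ (eqTm a Exp.star unit)
  | pi_beta {Γ A B a b} : Derivable (A :: Γ) (hasTy b B) → Derivable Γ (hasTy a A) →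
      Derivable Γ (eqTm (.app (.lam A b) a) (b.inst a) (B.inst a))
  | pi_eta {Γ A B f} : Derivable Γ (hasTy f (.pi A B)) →
      Derivable Γ (eqTm f (.lam A (.app f.wk (.var 0))) (.pi A B))
  | fst_beta {Γ A B a b} : Derivable (A :: Γ) (isTy B) → Derivable Γ (hasTy a A) →
      Derivable Γ (hasTy b (B.inst a)) → Derivable Γ (eqTm (fst (pair B a b)) a A)
  | snd_beta {Γ A B a b} : Derivable (A :: Γ) (isTy B) → Derivable Γ (hasTy a A) →
      Derivable Γ (hasTy b (B.inst a)) → Derivable Γ (eqTm (snd (pair B a b)) b (B.inst a))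
  | sigma_eta {Γ A B p} : Derivable Γ (hasTy p (sigma A B)) →
      Derivable Γ (eqTm p (pair B (fst p) (snd p)) (sigma A B))
  | reflection {Γ A a b p} : Derivable Γ (hasTy p (eq A a b)) → Derivable Γ (eqTm a b A)
  | eq_eta {Γ A a b p} : Derivable Γ (hasTy p (eq A a b)) →
      Derivable Γ (eqTm p (refl a) (eq A a b))
  -- equations of the signature
  | ite_tru {Γ C t f} : Derivable Γ (hasTy C (.pi (tm Exp.bool) tp)) →
      Derivable Γ (hasTy t (tm (.app C tru))) → Derivable Γ (hasTy f (tm (.app C fls))) →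
      Derivable Γ (eqTm (ite C tru t f) t (tm (.app C tru)))
  | ite_fls {Γ C t f} : Derivable Γ (hasTy C (.pi (tm Exp.bool) tp)) →
      Derivable Γ (hasTy t (tm (.app C tru))) → Derivable Γ (hasTy f (tm (.app C fls))) →
      Derivable Γ (eqTm (ite C fls t f) f (tm (.app C fls)))
  | app_lam {Γ A B f a} : Derivable Γ (hasTy A tp) → Derivable Γ (hasTy B (.pi (tm A) tp)) →
      Derivable Γ (hasTy f (.pi (tm A) (tm (.app B.wk (.var 0))))) →
      Derivable Γ (hasTy a (tm A)) →
      Derivable Γ (eqTm (.app (App A B (Lam A B f)) a) (.app f a) (tm (.app B a)))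
  | lam_app {Γ A B e} : Derivable Γ (hasTy A tp) → Derivable Γ (hasTy B (.pi (tm A) tp)) →
      Derivable Γ (hasTy e (tm (Pi A B))) →
      Derivable Γ (eqTm (Lam A B (App A B e)) e (tm (Pi A B)))

end LF

/-! Both halves rest on one device: every type carries extra data over its closed terms, and over
`bool` that data is a proof of being `tru` or of being `fls`. They are proved independently of each
other.

For the gluing model, the stages `of c` reuse the constants of `M` unchanged, so everything happens
at the one new stage `star`. A type there is a global section of `tp` together with a set over its
terms at `t`. Storing the whole compatible family, not just its value at `t`, makes restriction to
`of c` a projection, and `gluing_syn` then holds by definition; terminality of `t` recovers the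
family from that value, which gives the required description of `TP`. A boolean at `star` carries a
tag, and `ite` branches on it. A term of a product at `star` carries a function of glued terms lying
over its syntactic application: β is immediate, and η holds because this function determines the
syntactic term (`gluedApp_star_injective`). Naturality rests on two facts about `star`: it receives
exactly one map from each object, and it has none into any `of c`.

Canonicity of the syntax is a logical relation with values in ZF sets, in effect an elementary
unfolding of the same gluing. A type denotes a set of pairs of a closed expression and a value. A
value of `tp` is a set of closed terms stable under judgmental equality, a predicate on the terms of
that type; a term of `tm a` has the trivial value, since the claim is a mere disjunction and
predicates suffice. Values are computed by plain recursion on raw expressions (`Exp.interp`), and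
typing and stability are imposed afterwards by `cl`. An equality type is inhabited only if the two
values agree, which is exactly what reflection needs. The fundamental lemma `Deriv.sem` places every
closed boolean in the predicate `boolCode`.

That lemma needs presuppositions which the rules of `Derivable` omit. It is therefore proved for
`Deriv`, whose rules include them; the two systems are shown equivalent by way of substitution
(`LiftClosed.subst`), functionality (`Deriv.substEq`) and presupposition (`Deriv.presup`). -/

namespace STC

/-! ### The glued judgment forms -/

namespace Judgments

/-- Global sections of `tp`, as compatible families of types. -/
structure TySection {C : Type v} [SmallCategory C] (J : Judgments C) where
  at' : ∀ c : C, J.Ty c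
  natural : ∀ {c c' : C} (σ : c' ⟶ c), J.tyRes σ (at' c) = at' c'

theorem res_congr {D : Type v} [SmallCategory D] (J : Judgments D) {w w' : D} {σ σ' : w' ⟶ w}
    (e : σ = σ') {A : J.Ty w} {A' : J.Ty w'} (h : J.tyRes σ A = A') (h' : J.tyRes σ' A = A')
    (x : J.Tm A) : J.res σ h x = J.res σ' h' x := by
  subst e
  rfl

variable {C : Type v} [SmallCategory C] (J : Judgments C) {t : C}

theorem res_eq_self {c : C} {σ : c ⟶ c} (e : σ = 𝟙 c) {A : J.Ty c} (h : J.tyRes σ A = A)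
    (x : J.Tm A) : J.res σ h x = x := by
  subst e
  exact J.res_id x

variable (t) in
/-- Glued types at the stage `star`: a global section of `tp`, with a set over the terms of its
value at `t`. -/
structure GlueTy where
  sec : J.TySection
  sem : Glued (J.Tm (sec.at' t))

variable (t) in
/-- The values of the glued `tp`. -/
def GlueTpObj : WithTerminal C → Type (v + 1)
  | .of c => J.Ty c
  | .star => J.GlueTy t

variable (t) in
/-- The restriction maps of the glued `tp`. -/
def glueTpMap : ∀ {w w' : WithTerminal C}, (w' ⟶ w) → (J.GlueTpObj t w ⟶ J.GlueTpObj t w')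
  | .of _, .of _, σ => J.tp.map (WithTerminal.down σ).op
  | .star, .of c, _ => TypeCat.ofHom fun A : J.GlueTy t => A.sec.at' c
  | .star, .star, _ => 𝟙 _
  | .of _, .star, σ => (WithTerminal.false_of_from_star σ).elim

variable (t) in
/-- The glued `tp`. -/
def glueTp : (WithTerminal C)ᵒᵖ ⥤ Type (v + 1) where
  obj w := J.GlueTpObj t w.unop
  map σ := J.glueTpMap t σ.unop
  map_id w := by
    obtain ⟨c | _⟩ := w
    · exact J.tp.map_id (op c)
    · rfl
  map_comp {w w' w''} σ ρ := by
    obtain ⟨σ⟩ := σ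
    obtain ⟨ρ⟩ := ρ
    obtain ⟨c | _⟩ := w <;> obtain ⟨c' | _⟩ := w' <;> obtain ⟨c'' | _⟩ := w''
    · exact J.tp.map_comp (WithTerminal.down σ).op (WithTerminal.down ρ).op
    · exact (WithTerminal.false_of_from_star ρ).elim
    · exact (WithTerminal.false_of_from_star σ).elim
    · exact (WithTerminal.false_of_from_star σ).elim
    · ext A
      exact (A.sec.natural (WithTerminal.down ρ)).symm
    · exact (WithTerminal.false_of_from_star ρ).elim
    · rfl
    · rfl

variable (ht : Limits.IsTerminal t)

variable (t) in
/-- The values of the glued `tm`. -/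
def GlueTmObj : (w : WithTerminal C) → J.GlueTpObj t w → Type v
  | .of _, A => J.Tm A
  | .star, A => A.sem.carrier

/-- The restriction maps of the glued `tm`. -/
def glueTmMap : ∀ {w w' : WithTerminal C} {A : J.GlueTpObj t w} {A' : J.GlueTpObj t w'}
    (σ : w' ⟶ w), J.glueTpMap t σ A = A' → (J.GlueTmObj t w A ⟶ J.GlueTmObj t w' A')
  | .of c, .of c', A, A', σ, h => J.tm.map (CategoryOfElements.homMk (J.tp.elementsMk (op c) A)
      (J.tp.elementsMk (op c') A') (WithTerminal.down σ).op h)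
  | .star, .of c, A, _, _, h => TypeCat.ofHom fun x : A.sem.carrier =>
      J.res (ht.from c) ((A.sec.natural _).trans h) (A.sem.proj x)
  | .star, .star, A, _, _, h => TypeCat.ofHom fun x : A.sem.carrier =>
      cast (congrArg (fun A : J.GlueTy t => A.sem.carrier) h) x
  | .of _, .star, _, _, σ, _ => (WithTerminal.false_of_from_star σ).elim

/-- The glued judgments. -/
def glued : Judgments (WithTerminal C) where
  tp := J.glueTp t
  tm :=
    { obj := fun p => J.GlueTmObj t p.1.unop p.2
      map := fun f => J.glueTmMap ht f.1.unop f.2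
      map_id := fun p => by
        obtain ⟨⟨c | _⟩, A⟩ := p
        · exact J.tm.map_id _
        · rfl
      map_comp := fun {p q r} f g => by
        obtain ⟨⟨w⟩, A⟩ := p
        obtain ⟨⟨w'⟩, A'⟩ := q
        obtain ⟨⟨w''⟩, A''⟩ := r
        obtain ⟨⟨σ⟩, hσ⟩ := f
        obtain ⟨⟨ρ⟩, hρ⟩ := g
        change w' ⟶ w at σ
        change w'' ⟶ w' at ρ
        cases w <;> cases w' <;> cases w''
        · exact J.tm.map_comp
            (CategoryOfElements.homMk (J.tp.elementsMk _ A) (J.tp.elementsMk _ A')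
              (WithTerminal.down σ).op hσ)
            (CategoryOfElements.homMk (J.tp.elementsMk _ A') (J.tp.elementsMk _ A'')
              (WithTerminal.down ρ).op hρ)
        · exact (WithTerminal.false_of_from_star ρ).elim
        · exact (WithTerminal.false_of_from_star σ).elim
        · exact (WithTerminal.false_of_from_star σ).elim
        · ext x
          -- Restriction from `star` first projects to stage `t`; the direct and the composite
          -- restriction then use two maps into `t`, which agree.
          refine (J.res_congr (ht.hom_ext _ _) _ _ _).trans (J.res_res (WithTerminal.down ρ)
            (ht.from _) ((A.sec.natural _).trans hσ) hρ (A.sem.proj x)).symm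
        · exact (WithTerminal.false_of_from_star ρ).elim
        · cases hσ
          rfl
        · cases hσ
          cases hρ
          rfl }

end Judgments
end STC

/-! ### Internal functions over glued types and their syntactic parts -/

namespace STC

namespace Judgments

theorem TyFam.toFun_congr {D : Type v} [SmallCategory D] {J : Judgments D} {w w' : D} {A : J.Ty w}
    (B : J.TyFam A) {ρ ρ' : w' ⟶ w} (e : ρ = ρ') {A' : J.Ty w'} (h : J.tyRes ρ A = A')
    (h' : J.tyRes ρ' A = A') (x : J.Tm A') : B.toFun ρ h x = B.toFun ρ' h' x := by
  subst e
  rfl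

theorem TmFam.ev_congr {D : Type v} [SmallCategory D] {J : Judgments D} {w w' : D} {A : J.Ty w}
    {B : J.TyFam A} (f : J.TmFam B) {ρ ρ' : w' ⟶ w} (e : ρ = ρ') {A' : J.Ty w'}
    (h : J.tyRes ρ A = A') (h' : J.tyRes ρ' A = A') (x : J.Tm A') :
    HEq (f.ev ρ h x) (f.ev ρ' h' x) := by
  subst e
  rfl

theorem res_heq {D : Type v} [SmallCategory D] (J : Judgments D) {w w' : D} (σ : w' ⟶ w)
    {A : J.Ty w} {A' A'' : J.Ty w'} (h : J.tyRes σ A = A') (h' : J.tyRes σ A = A'')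
    (x : J.Tm A) : HEq (J.res σ h x) (J.res σ h' x) := by
  subst h
  subst h'
  rfl

theorem TmFam.res_ev {D : Type v} [SmallCategory D] {J : Judgments D} {w w' w'' : D} {A : J.Ty w}
    {A' : J.Ty w'} {A'' : J.Ty w''} {B : J.TyFam A} (f : J.TmFam B) (σ : w' ⟶ w)
    (h : J.tyRes σ A = A') (ρ : w'' ⟶ w') (h' : J.tyRes ρ A' = A'') (x : J.Tm A'') :
    (f.res σ h).ev ρ h' x = f.ev (ρ ≫ σ) (J.tyRes_trans h h') x := by
  subst h'
  rfl

variable {C : Type v} [SmallCategory C] {J : Judgments C} {t : C} {ht : Limits.IsTerminal t}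

/-- The syntactic part of an internal family of glued types over a syntactic type. -/
def TyFam.toSyn {c : C} {A : J.Ty c} (B : (J.glued ht).TyFam (w := .of c) A) : J.TyFam A :=
  TyFam.shrink (J := J.glued ht) (c := c) B

/-- The syntactic part of an internal dependent function over a syntactic type. -/
def TmFam.toSyn {c : C} {A : J.Ty c} {B : (J.glued ht).TyFam (w := .of c) A}
    (f : (J.glued ht).TmFam B) : J.TmFam B.toSyn :=
  TmFam.shrink (J := J.glued ht) (c := c) f

/-- Over a syntactic type, a dependent function is determined by its syntactic part. -/
def TmFam.ofSyn {c : C} {A : J.Ty c} {B : (J.glued ht).TyFam (w := .of c) A}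
    (f : J.TmFam B.toSyn) : (J.glued ht).TmFam B where
  toFun {w'} := match w' with
    | .of _ => fun ρ x => f.toFun (WithTerminal.down ρ) x
    | .star => fun ρ _ => (WithTerminal.false_of_from_star ρ).elim
  natural {w' w''} := match w', w'' with
    | .of _, .of _ => fun ρ σ x => f.natural (WithTerminal.down ρ) (WithTerminal.down σ) x
    | .star, _ => fun ρ => (WithTerminal.false_of_from_star ρ).elim
    | .of _, .star => fun _ σ => (WithTerminal.false_of_from_star σ).elim

theorem TmFam.ofSyn_toSyn {c : C} {A : J.Ty c} {B : (J.glued ht).TyFam (w := .of c) A}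
    (f : (J.glued ht).TmFam B) : TmFam.ofSyn f.toSyn = f := by
  ext w' ρ x
  cases w' with
  | of c' => rfl
  | star => exact (WithTerminal.false_of_from_star ρ).elim

theorem TmFam.toSyn_injective {c : C} {A : J.Ty c} {B : (J.glued ht).TyFam (w := .of c) A}
    {f g : (J.glued ht).TmFam B} (h : f.toSyn = g.toSyn) : f = g := by
  rw [← f.ofSyn_toSyn, h, ofSyn_toSyn]

theorem TmFam.toSyn_res {c c' : C} {A : J.Ty c} {A' : J.Ty c'}
    {B : (J.glued ht).TyFam (w := .of c) A} (f : (J.glued ht).TmFam B)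
    (σ : (WithTerminal.of c' : WithTerminal C) ⟶ .of c)
    (h : J.tyRes (WithTerminal.down σ) A = A') :
    (f.res σ h).toSyn = f.toSyn.res (WithTerminal.down σ) h :=
  TmFam.shrink_res (J := J.glued ht) (c := c) f (WithTerminal.down σ) h

variable {A : (J.glued ht).Ty .star}

/-- The syntactic part, at the stage `c`, of an internal family of types over a glued type. -/
def TyFam.synAt (B : (J.glued ht).TyFam A) (c : C) : J.TyFam (GlueTy.sec A |>.at' c) :=
  (B.res (w' := .of c) (WithTerminal.starTerminal.from _) rfl).toSyn

/-- The syntactic part, at the stage `c`, of an internal dependent function over a glued type. -/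
def TmFam.synAt {B : (J.glued ht).TyFam A} (f : (J.glued ht).TmFam B) (c : C) :
    J.TmFam (B.synAt c) :=
  (f.res (w' := .of c) (WithTerminal.starTerminal.from _) rfl).toSyn

/-- All maps to `star` from a given stage coincide. Hence the syntactic parts at the various stages
form a compatible family, as needed for the section underlying a glued product. -/
theorem TyFam.synAt_res (B : (J.glued ht).TyFam A) {c c' : C} (σ : c' ⟶ c) :
    (B.synAt c).res σ ((GlueTy.sec A).natural σ) = B.synAt c' := by
  ext c'' ρ A'' h x
  exact B.toFun_congr (w' := WithTerminal.of c'') (WithTerminal.starTerminal.hom_ext _ _) _ _ x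

theorem TmFam.synAt_res {B : (J.glued ht).TyFam A} (f : (J.glued ht).TmFam B) {c c' : C}
    (σ : c' ⟶ c) : HEq ((f.synAt c).res σ ((GlueTy.sec A).natural σ)) (f.synAt c') := by
  refine TmFam.heq (B.synAt_res σ) _ _ fun {c''} ρ x => ?_
  refine (heq_of_eq ((TmFam.ev_shrink (J := J.glued ht) (c := c) _ (ρ ≫ σ) _ x).trans
    (TmFam.res_ev (J := J.glued ht) f (w' := WithTerminal.of c) (w'' := WithTerminal.of c'')
      _ _ _ _ x))).trans ?_
  exact f.ev_congr (w' := WithTerminal.of c'')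
    (ρ' := WithTerminal.incl.map ρ ≫ WithTerminal.starTerminal.from _)
    (WithTerminal.starTerminal.hom_ext _ _) _ _ x

/-- The only endomorphism of `star` is the identity, but the restricted family is indexed by
composites, so the equation is not definitional and has to be transported along later. -/
theorem TyFam.res_star (B : (J.glued ht).TyFam A)
    (σ : (WithTerminal.star : WithTerminal C) ⟶ .star) :
    B.res (A' := A) σ rfl = B := by
  ext w' ρ A'' h x
  exact B.toFun_congr (WithTerminal.starTerminal.hom_ext _ _) _ _ x

theorem TmFam.res_star {B : (J.glued ht).TyFam A} (f : (J.glued ht).TmFam B)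
    (σ : (WithTerminal.star : WithTerminal C) ⟶ .star) : HEq (f.res (A' := A) σ rfl) f := by
  refine TmFam.heq (B.res_star σ) _ _ fun {w'} ρ x => ?_
  exact f.ev_congr (ρ := ρ ≫ σ) (ρ' := ρ) (WithTerminal.starTerminal.hom_ext _ _) _ rfl x

end Judgments
end STC

/-! ### The glued booleans -/

namespace STC

open Judgments

namespace Model

section Congruence

variable {D : Type v} [SmallCategory D] (M : Model D)

/-- The restricted domain may go under any name `A'`: in a glued product it is a member of a
compatible family and only provably equal to a restriction. -/
theorem pi_res_eq {w w' : D} (σ : w' ⟶ w) {A : M.J.Ty w} {A' : M.J.Ty w'} (h : M.J.tyRes σ A = A')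
    (B : M.J.TyFam A) {B' : M.J.TyFam A'} (hB : B.res σ h = B') :
    M.J.tyRes σ (M.pi A B) = M.pi A' B' := by
  subst h
  subst hB
  exact M.pi_res σ A B

theorem app_res_heq {w w' : D} (σ : w' ⟶ w) {A : M.J.Ty w} {A' : M.J.Ty w'}
    (h : M.J.tyRes σ A = A') {B : M.J.TyFam A} {B' : M.J.TyFam A'} (hB : B.res σ h = B')
    (e : M.J.Tm (M.pi A B)) (he : M.J.tyRes σ (M.pi A B) = M.pi A' B') :
    HEq (M.app (M.J.res σ he e)) ((M.app e).res σ h) := by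
  subst h
  subst hB
  exact heq_of_eq (M.app_res σ e)

end Congruence

variable {C : Type v} [SmallCategory C] (M : Model C) {t : C} (ht : Limits.IsTerminal t)

/-- The set over the syntactic booleans at `t` with a single point over each of `tru` and `fls`. -/
def gluedBoolSem : Glued (M.J.Tm (M.bool t)) :=
  glue fun b =>
    ULift.{v} (PLift (b = M.J.res (ht.from t) (M.bool_res _) (M.tru t))) ⊕
      ULift.{v} (PLift (b = M.J.res (ht.from t) (M.bool_res _) (M.fls t)))

/-- The glued booleans. -/
def gluedBool : ∀ w : WithTerminal C, (M.J.glued ht).Ty w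
  | .of c => M.bool c
  | .star => (⟨⟨M.bool, M.bool_res⟩, M.gluedBoolSem ht⟩ : M.J.GlueTy t)

theorem gluedBool_res : ∀ {w w' : WithTerminal C} (σ : w' ⟶ w),
    (M.J.glued ht).tyRes σ (M.gluedBool ht w) = M.gluedBool ht w'
  | .of _, .of _, σ => M.bool_res (WithTerminal.down σ)
  | .star, .of _, _ => rfl
  | .star, .star, _ => rfl
  | .of _, .star, σ => (WithTerminal.false_of_from_star σ).elim

/-- The glued `tru`. -/
def gluedTru : ∀ w : WithTerminal C, (M.J.glued ht).Tm (M.gluedBool ht w)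
  | .of c => M.tru c
  | .star => (⟨M.tru t, .inl ⟨⟨(M.tru_res _).symm⟩⟩⟩ : (M.gluedBoolSem ht).carrier)

/-- The glued `fls`. -/
def gluedFls : ∀ w : WithTerminal C, (M.J.glued ht).Tm (M.gluedBool ht w)
  | .of c => M.fls c
  | .star => (⟨M.fls t, .inr ⟨⟨(M.fls_res _).symm⟩⟩⟩ : (M.gluedBoolSem ht).carrier)

theorem gluedTru_res : ∀ {w w' : WithTerminal C} (σ : w' ⟶ w),
    (M.J.glued ht).res σ (M.gluedBool_res ht σ) (M.gluedTru ht w) = M.gluedTru ht w'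
  | .of _, .of _, σ => M.tru_res (WithTerminal.down σ)
  | .star, .of _, _ => M.tru_res _
  | .star, .star, _ => rfl
  | .of _, .star, σ => (WithTerminal.false_of_from_star σ).elim

theorem gluedFls_res : ∀ {w w' : WithTerminal C} (σ : w' ⟶ w),
    (M.J.glued ht).res σ (M.gluedBool_res ht σ) (M.gluedFls ht w) = M.gluedFls ht w'
  | .of _, .of _, σ => M.fls_res (WithTerminal.down σ)
  | .star, .of _, _ => M.fls_res _
  | .star, .star, _ => rfl
  | .of _, .star, σ => (WithTerminal.false_of_from_star σ).elim

/-- The attached proof identifies `b₀` with `tru`, and proofs are unique, so only one point has the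
tag `inl`. -/
theorem eq_gluedTru (b : (M.J.glued ht).Tm (M.gluedBool ht .star)) {b₀ : M.J.Tm (M.bool t)}
    {p : ULift.{v} (PLift (b₀ = M.J.res (ht.from t) (M.bool_res _) (M.tru t)))}
    (h : b = (⟨b₀, .inl p⟩ : (M.gluedBoolSem ht).carrier)) : b = M.gluedTru ht .star := by
  subst h
  obtain ⟨⟨h⟩⟩ := p
  rw [M.tru_res] at h
  subst h
  rfl

theorem eq_gluedFls (b : (M.J.glued ht).Tm (M.gluedBool ht .star)) {b₀ : M.J.Tm (M.bool t)}
    {p : ULift.{v} (PLift (b₀ = M.J.res (ht.from t) (M.bool_res _) (M.fls t)))}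
    (h : b = (⟨b₀, .inr p⟩ : (M.gluedBoolSem ht).carrier)) : b = M.gluedFls ht .star := by
  subst h
  obtain ⟨⟨h⟩⟩ := p
  rw [M.fls_res] at h
  subst h
  rfl

/-- The glued `ite`: at `star`, by cases on the second component of the boolean. -/
def gluedIte : ∀ {w : WithTerminal C} (B : (M.J.glued ht).TyFam (M.gluedBool ht w))
    (b : (M.J.glued ht).Tm (M.gluedBool ht w)), (M.J.glued ht).Tm (B.at (M.gluedTru ht w)) →
    (M.J.glued ht).Tm (B.at (M.gluedFls ht w)) → (M.J.glued ht).Tm (B.at b)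
  | .of _, B, b, x, y => M.ite B.toSyn b x y
  | .star, B, (b₀ : (M.gluedBoolSem ht).carrier), x, y =>
    -- The motive quantifies over `b` with an equation, so that each branch can be transported into
    -- `B.at b`. On the canonical points the transport is along a reflexive equation and vanishes,
    -- so the computation rules hold by `rfl` at `star`.
    Sum.casesOn (motive := fun s => ∀ b : (M.J.glued ht).Tm (M.gluedBool ht .star),
        b = (⟨Sigma.fst b₀, s⟩ : (M.gluedBoolSem ht).carrier) → (M.J.glued ht).Tm (B.at b)) b₀.2
      (fun _ b hb => cast (congrArg (fun b => (M.J.glued ht).Tm (B.at b))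
        (M.eq_gluedTru ht b hb).symm) x)
      (fun _ b hb => cast (congrArg (fun b => (M.J.glued ht).Tm (B.at b))
        (M.eq_gluedFls ht b hb).symm) y) b₀ rfl

theorem gluedIte_tru : ∀ {w : WithTerminal C} (B : (M.J.glued ht).TyFam (M.gluedBool ht w))
    (x : (M.J.glued ht).Tm (B.at (M.gluedTru ht w)))
    (y : (M.J.glued ht).Tm (B.at (M.gluedFls ht w))),
    M.gluedIte ht B (M.gluedTru ht w) x y = x
  | .of _, B, x, y => M.ite_tru B.toSyn x y
  | .star, _, _, _ => rfl

theorem gluedIte_fls : ∀ {w : WithTerminal C} (B : (M.J.glued ht).TyFam (M.gluedBool ht w))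
    (x : (M.J.glued ht).Tm (B.at (M.gluedTru ht w)))
    (y : (M.J.glued ht).Tm (B.at (M.gluedFls ht w))),
    M.gluedIte ht B (M.gluedFls ht w) x y = y
  | .of _, B, x, y => M.ite_fls B.toSyn x y
  | .star, _, _, _ => rfl

theorem gluedBool_cases (b : (M.J.glued ht).Tm (M.gluedBool ht .star)) :
    b = M.gluedTru ht .star ∨ b = M.gluedFls ht .star := by
  obtain ⟨b₀, p | p⟩ := (b : (M.gluedBoolSem ht).carrier)
  · exact .inl (M.eq_gluedTru ht _ rfl)
  · exact .inr (M.eq_gluedFls ht _ rfl)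

/-- From `star`, the boolean is one of the two canonical points, whose restrictions are again
canonical; both sides then compute to the restriction of the same branch. -/
theorem gluedIte_res {w w' : WithTerminal C} (σ : w' ⟶ w)
    (B : (M.J.glued ht).TyFam (M.gluedBool ht w)) (b : (M.J.glued ht).Tm (M.gluedBool ht w))
    (x : (M.J.glued ht).Tm (B.at (M.gluedTru ht w)))
    (y : (M.J.glued ht).Tm (B.at (M.gluedFls ht w))) :
    (M.J.glued ht).res σ (B.at_res σ (M.gluedBool_res ht σ) b) (M.gluedIte ht B b x y) =
      M.gluedIte ht (B.res σ (M.gluedBool_res ht σ))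
        ((M.J.glued ht).res σ (M.gluedBool_res ht σ) b)
        ((M.J.glued ht).res σ (B.at_res' σ (M.gluedBool_res ht σ) (M.gluedTru_res ht σ)) x)
        ((M.J.glued ht).res σ (B.at_res' σ (M.gluedBool_res ht σ) (M.gluedFls_res ht σ)) y) := by
  cases w with
  | of c =>
    cases w' with
    | of c' => exact M.ite_res (WithTerminal.down σ) B.toSyn b x y
    | star => exact (WithTerminal.false_of_from_star σ).elim
  | star =>
    -- The type of the right-hand side depends on the restricted boolean, which therefore cannot be
    -- rewritten in place. It is replaced by a free `b'`, at the price of heterogeneous equality.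
    have key : ∀ (b' : (M.J.glued ht).Tm (M.gluedBool ht w')),
        (b' = M.gluedTru ht w' → HEq (M.gluedIte ht (B.res σ (M.gluedBool_res ht σ)) b'
          ((M.J.glued ht).res σ (B.at_res' σ (M.gluedBool_res ht σ) (M.gluedTru_res ht σ)) x)
          ((M.J.glued ht).res σ (B.at_res' σ (M.gluedBool_res ht σ) (M.gluedFls_res ht σ)) y))
          ((M.J.glued ht).res σ (B.at_res' σ (M.gluedBool_res ht σ) (M.gluedTru_res ht σ)) x)) ∧
        (b' = M.gluedFls ht w' → HEq (M.gluedIte ht (B.res σ (M.gluedBool_res ht σ)) b'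
          ((M.J.glued ht).res σ (B.at_res' σ (M.gluedBool_res ht σ) (M.gluedTru_res ht σ)) x)
          ((M.J.glued ht).res σ (B.at_res' σ (M.gluedBool_res ht σ) (M.gluedFls_res ht σ)) y))
          ((M.J.glued ht).res σ (B.at_res' σ (M.gluedBool_res ht σ) (M.gluedFls_res ht σ)) y)) := by
      refine fun b' => ⟨?_, ?_⟩ <;> rintro rfl
      · exact heq_of_eq (M.gluedIte_tru ht _ _ _)
      · exact heq_of_eq (M.gluedIte_fls ht _ _ _)
    obtain rfl | rfl := M.gluedBool_cases ht b
    · rw [gluedIte_tru]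
      exact eq_of_heq (((M.J.glued ht).res_heq σ _ _ x).trans
        ((key _).1 (M.gluedTru_res ht σ)).symm)
    · rw [gluedIte_fls]
      exact eq_of_heq (((M.J.glued ht).res_heq σ _ _ y).trans
        ((key _).2 (M.gluedFls_res ht σ)).symm)

end Model
end STC

/-! ### Glued dependent products and the gluing model -/

namespace STC

open Judgments

namespace Model

variable {C : Type v} [SmallCategory C] (M : Model C) {t : C} (ht : Limits.IsTerminal t)

/-- The syntactic parts of the glued dependent product. -/
def gluedPiSection (A : (M.J.glued ht).Ty .star) (B : (M.J.glued ht).TyFam A) : M.J.TySection where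
  at' c := M.pi (GlueTy.sec A |>.at' c) (B.synAt c)
  natural σ := M.pi_res_eq σ ((GlueTy.sec A).natural σ) _ (B.synAt_res σ)

/-- A syntactic term of the dependent product, with a dependent function over its application. -/
def gluedPiSem (A : (M.J.glued ht).Ty .star) (B : (M.J.glued ht).TyFam A) :
    Glued (M.J.Tm ((M.gluedPiSection ht A B).at' t)) :=
  glue fun e => {g : (M.J.glued ht).TmFam B // g.res (glob t) rfl =
    TmFam.ofSyn (M.app (M.J.res (𝟙 t) (M.J.tyRes_id _) e))}

/-- The glued dependent product. -/
def gluedPi : ∀ {w : WithTerminal C} (A : (M.J.glued ht).Ty w) (_ : (M.J.glued ht).TyFam A),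
    (M.J.glued ht).Ty w
  | .of c, A, B => M.pi (w := c) A B.toSyn
  | .star, A, B => (⟨M.gluedPiSection ht A B, M.gluedPiSem ht A B⟩ : M.J.GlueTy t)

theorem gluedPi_res : ∀ {w w' : WithTerminal C} (σ : w' ⟶ w) (A : (M.J.glued ht).Ty w)
    (B : (M.J.glued ht).TyFam A), (M.J.glued ht).tyRes σ (M.gluedPi ht A B) =
      M.gluedPi ht ((M.J.glued ht).tyRes σ A) (B.res σ rfl)
  | .of _, .of _, σ, A, B => M.pi_res (WithTerminal.down σ) A B.toSyn
  | .star, .of _, _, _, _ => rfl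
  | .star, .star, σ, A, B => congrArg (M.gluedPi ht (w := .star) A) (B.res_star σ).symm
  | .of _, .star, σ, _, _ => (WithTerminal.false_of_from_star σ).elim

/-- The gluing condition for an abstraction is the syntactic β-equation at stage `t`. -/
theorem gluedLam_aux {A : (M.J.glued ht).Ty .star} {B : (M.J.glued ht).TyFam A}
    (f : (M.J.glued ht).TmFam B) : f.res (glob t) rfl =
      TmFam.ofSyn (M.app (M.J.res (𝟙 t) (M.J.tyRes_id _) (M.lam (f.synAt t)))) := by
  refine (TmFam.ofSyn_toSyn (c := t) (f.res (glob t) rfl)).symm.trans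
    (congrArg (TmFam.ofSyn (c := t) (B := B.res (glob t) rfl)) ?_)
  exact ((congrArg M.app (M.J.res_id _)).trans (M.app_lam (f.synAt t))).symm

/-- The glued `lam`. -/
def gluedLam : ∀ {w : WithTerminal C} {A : (M.J.glued ht).Ty w} {B : (M.J.glued ht).TyFam A},
    (M.J.glued ht).TmFam B → (M.J.glued ht).Tm (M.gluedPi ht A B)
  | .of _, _, _, f => M.lam f.toSyn
  | .star, A, B, f => (⟨M.lam (f.synAt t), f, M.gluedLam_aux ht f⟩ : (M.gluedPiSem ht A B).carrier)

/-- The glued `app`. -/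
def gluedApp : ∀ {w : WithTerminal C} {A : (M.J.glued ht).Ty w} {B : (M.J.glued ht).TyFam A},
    (M.J.glued ht).Tm (M.gluedPi ht A B) → (M.J.glued ht).TmFam B
  | .of _, _, _, e => TmFam.ofSyn (M.app e)
  | .star, _, _, e =>
    Subtype.val (Sigma.snd (e : (M.gluedPiSem ht _ _).carrier))

theorem gluedApp_lam : ∀ {w : WithTerminal C} {A : (M.J.glued ht).Ty w}
    {B : (M.J.glued ht).TyFam A} (f : (M.J.glued ht).TmFam B),
    M.gluedApp ht (M.gluedLam ht f) = f
  | .of _, _, _, f => (congrArg TmFam.ofSyn (M.app_lam f.toSyn)).trans f.ofSyn_toSyn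
  | .star, _, _, _ => rfl

/-- The function component lies over the syntactic application, and by the syntactic η-equation a
term is determined by its application. -/
theorem gluedApp_star_injective {A : (M.J.glued ht).Ty .star} {B : (M.J.glued ht).TyFam A}
    {e e' : (M.gluedPiSem ht A B).carrier} (h : e.2.1 = e'.2.1) : e = e' := by
  obtain ⟨e, g, hg⟩ := e
  obtain ⟨e', g', hg'⟩ := e'
  obtain rfl : g = g' := h
  have he : M.app (M.J.res (𝟙 t) (M.J.tyRes_id _) e) = M.app (M.J.res (𝟙 t) (M.J.tyRes_id _) e') :=
    congrArg (TmFam.toSyn (c := t)) (hg.symm.trans hg')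
  obtain rfl : e = e' :=
    (((congrArg M.app (M.J.res_id e)).symm.trans he).trans (congrArg M.app (M.J.res_id e'))) |>
      congrArg M.lam |> fun h => (M.lam_app e).symm.trans (h.trans (M.lam_app e'))
  rfl

theorem gluedLam_app : ∀ {w : WithTerminal C} {A : (M.J.glued ht).Ty w}
    {B : (M.J.glued ht).TyFam A} (e : (M.J.glued ht).Tm (M.gluedPi ht A B)),
    M.gluedLam ht (M.gluedApp ht e) = e
  | .of _, _, _, e => M.lam_app e
  | .star, _, _, _ => M.gluedApp_star_injective ht rfl

theorem gluedApp_res {w w' : WithTerminal C} (σ : w' ⟶ w) {A : (M.J.glued ht).Ty w}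
    {B : (M.J.glued ht).TyFam A} (e : (M.J.glued ht).Tm (M.gluedPi ht A B)) :
    M.gluedApp ht ((M.J.glued ht).res σ (M.gluedPi_res ht σ A B) e) =
      (M.gluedApp ht e).res σ rfl := by
  cases w with
  | of c =>
    cases w' with
    | of c' => exact TmFam.toSyn_injective (c := c') ((M.app_res (WithTerminal.down σ) e).trans
        (TmFam.toSyn_res (c := c) (c' := c') (TmFam.ofSyn (M.app e)) σ rfl).symm)
    | star => exact (WithTerminal.false_of_from_star σ).elim
  | star =>
    cases w' with
    | of c' =>
      obtain rfl : σ = WithTerminal.starTerminal.from _ := WithTerminal.starTerminal.hom_ext _ _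
      -- The gluing condition stored in `e`, read in the syntactic topos. Restricted along the map
      -- from `c'` to `t`, it yields the equation at `c'`.
      have h : M.app (Sigma.fst (e : (M.gluedPiSem ht A B).carrier)) =
          (M.gluedApp ht e).synAt t :=
        (congrArg M.app (M.J.res_id _)).symm.trans
          (congrArg (TmFam.toSyn (c := t))
            (Sigma.snd (e : (M.gluedPiSem ht A B).carrier)).2).symm
      refine TmFam.toSyn_injective (c := c') (eq_of_heq ?_)
      refine (M.app_res_heq (ht.from c') ((GlueTy.sec A).natural _) (B.synAt_res _) _ _).trans ?_
      refine HEq.trans ?_ ((M.gluedApp ht e).synAt_res (ht.from c'))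
      exact heq_of_eq (congrArg (fun f => TmFam.res f (ht.from c') ((GlueTy.sec A).natural _)) h)
    | star =>
      -- Restriction along an endomorphism of `star` changes `B` only up to a provable equation, so
      -- the restricted family is made a variable before being eliminated.
      have key : ∀ (B' : (M.J.glued ht).TyFam A) (hB : B' = B)
          (h : (M.J.glued ht).tyRes σ (M.gluedPi ht A B) = M.gluedPi ht A B'),
          HEq (M.gluedApp ht ((M.J.glued ht).res σ h e)) (M.gluedApp ht e) := by
        rintro _ rfl _
        rfl
      exact eq_of_heq ((key _ (B.res_star σ) _).trans (TmFam.res_star _ σ).symm)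

/-- Formal from naturality of application, since `gluedLam` and `gluedApp` are mutually inverse. -/
theorem gluedLam_res {w w' : WithTerminal C} (σ : w' ⟶ w) {A : (M.J.glued ht).Ty w}
    {B : (M.J.glued ht).TyFam A} (f : (M.J.glued ht).TmFam B) :
    (M.J.glued ht).res σ (M.gluedPi_res ht σ A B) (M.gluedLam ht f) =
      M.gluedLam ht (f.res σ rfl) := by
  rw [← M.gluedLam_app ht ((M.J.glued ht).res σ (M.gluedPi_res ht σ A B) (M.gluedLam ht f)),
    gluedApp_res, gluedApp_lam]

/-- The canonicity gluing model. -/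
def gluing : Model (WithTerminal C) where
  J := M.J.glued ht
  bool := M.gluedBool ht
  bool_res := M.gluedBool_res ht
  tru := M.gluedTru ht
  tru_res := M.gluedTru_res ht
  fls := M.gluedFls ht
  fls_res := M.gluedFls_res ht
  ite := M.gluedIte ht
  ite_res := M.gluedIte_res ht
  ite_tru := M.gluedIte_tru ht
  ite_fls := M.gluedIte_fls ht
  pi := M.gluedPi ht
  pi_res := M.gluedPi_res ht
  lam := M.gluedLam ht
  lam_res := M.gluedLam_res ht
  app := M.gluedApp ht
  app_res := M.gluedApp_res ht
  app_lam := M.gluedApp_lam ht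
  lam_app := M.gluedLam_app ht

theorem gluing_syn : (M.gluing ht).syn = M := rfl

/-- Restriction along `glob t` is the projection followed by restriction along an endomorphism of
the terminal object `t`, which is the identity. -/
theorem gluing_synTm {A : (M.J.glued ht).Ty .star} (x : (M.J.glued ht).Tm A) :
    (M.gluing ht).synTm t x = (GlueTy.sem A).proj x :=
  M.J.res_eq_self (ht.hom_ext _ _) _ _

/-- The seemingly idle restrictions along maps from `t` to `t` in `gluedBoolSem` and `gluedPiSem`
make those sets agree definitionally with `boolGlue` and `piGlue`; this lemma then gives `bool_eq`
and `pi_eq` directly. -/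
theorem gluing_sem (A : (M.J.glued ht).Ty .star) : (M.gluing ht).sem t A = GlueTy.sem A :=
  congrArg (Glued.mk _) (funext fun x => M.gluing_synTm ht x)

theorem _root_.STC.Judgments.exists_tySection (ht : Limits.IsTerminal t) (J : Judgments C)
    (A : J.Ty t) :
    ∃ s : J.TySection, s.at' t = A :=
  ⟨⟨fun c => J.tyRes (ht.from c) A, fun σ => by rw [← tyRes_comp, ht.hom_ext (σ ≫ _)]⟩,
    by
      change J.tyRes (ht.from t) A = A
      rw [ht.hom_ext (ht.from t) (𝟙 t), tyRes_id]⟩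

/-- The tags must be compared separately: if `tru` and `fls` coincide in `M`, two points lie over
the same syntactic boolean. -/
theorem gluedBoolSem_ext {x y : (M.gluedBoolSem ht).carrier} (h : x.1 = y.1)
    (h' : x.2.isLeft = y.2.isLeft) : x = y := by
  obtain ⟨a, p | p⟩ := x <;> obtain ⟨b, q | q⟩ := y <;> obtain rfl : a = b := h
  · exact congrArg (fun p => (⟨a, .inl p⟩ : (M.gluedBoolSem ht).carrier)) (Subsingleton.elim p q)
  · cases h'
  · cases h'
  · exact congrArg (fun p => (⟨a, .inr p⟩ : (M.gluedBoolSem ht).carrier)) (Subsingleton.elim p q)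

theorem gluing_isCanonicityModel : (M.gluing ht).IsCanonicityModel t where
  tp_eq := by
    have h : (fun A : (M.gluing ht).J.Ty .star =>
        (⟨(M.gluing ht).synTy t A, (M.gluing ht).sem t A⟩ :
          Σ A₀ : (M.gluing ht).J.Ty (.of t), Glued ((M.gluing ht).J.Tm A₀))) =
        fun A : M.J.GlueTy t => (⟨A.sec.at' t, A.sem⟩ : Σ A₀ : M.J.Ty t, Glued (M.J.Tm A₀)) :=
      funext fun A => congrArg (Sigma.mk _) (M.gluing_sem ht A)
    rw [h]
    constructor
    · rintro ⟨⟨A, hA⟩, S⟩ ⟨⟨A', hA'⟩, S'⟩ e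
      obtain ⟨e₁, e₂⟩ := Sigma.mk.inj e
      -- A compatible family is determined by its value at `t`, because every `c` maps to `t`.
      obtain rfl : A = A' := funext fun c =>
        (hA (ht.from c)).symm.trans ((congrArg _ e₁).trans (hA' (ht.from c)))
      obtain rfl := eq_of_heq e₂
      rfl
    · rintro ⟨A, S⟩
      obtain ⟨s, rfl⟩ := exists_tySection ht M.J A
      exact ⟨⟨s, S⟩, rfl⟩
  bool_eq := M.gluing_sem ht _
  tru_eq := heq_of_eq (M.gluedBoolSem_ext ht (M.gluing_synTm ht (M.gluedTru ht .star)).symm rfl)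
  fls_eq := heq_of_eq (M.gluedBoolSem_ext ht (M.gluing_synTm ht (M.gluedFls ht .star)).symm rfl)
  pi_eq A B := M.gluing_sem ht _
  lam_eq f := heq_of_eq (M.gluedApp_star_injective ht rfl)
  app_eq {A B} e p h := by
    obtain rfl := eq_of_heq h
    rfl

end Model
end STC

namespace LF

open Exp Jdg

/-! ### Calculus of substitutions -/

/-- The sequence `s`, preceded by `a`. -/
def scons {α : Type*} (a : α) (s : ℕ → α) : ℕ → α
  | 0 => a
  | n + 1 => s n

namespace Exp

theorem single_eq (a : Exp) : single a = scons a var := by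
  funext n
  cases n <;> rfl

theorem upr_comp (ξ ζ : ℕ → ℕ) : upr ζ ∘ upr ξ = upr (ζ ∘ ξ) := by
  funext n
  cases n <;> rfl

theorem rename_rename (a : Exp) (ξ ζ : ℕ → ℕ) : (a.rename ξ).rename ζ = a.rename (ζ ∘ ξ) := by
  induction a generalizing ξ ζ <;> simp_all [rename, upr_comp]

theorem up_comp_upr (σ : ℕ → Exp) (ξ : ℕ → ℕ) : up σ ∘ upr ξ = up (σ ∘ ξ) := by
  funext n
  cases n <;> rfl

theorem rename_subst (a : Exp) (ξ : ℕ → ℕ) (σ : ℕ → Exp) :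
    (a.rename ξ).subst σ = a.subst (σ ∘ ξ) := by
  induction a generalizing ξ σ <;> simp_all [rename, subst, up_comp_upr]

theorem wk_rename_upr (a : Exp) (ξ : ℕ → ℕ) : a.wk.rename (upr ξ) = (a.rename ξ).wk := by
  simp only [wk, rename_rename]
  rfl

theorem up_rename (σ : ℕ → Exp) (ξ : ℕ → ℕ) :
    (fun n => (up σ n).rename (upr ξ)) = up fun n => (σ n).rename ξ := by
  funext n
  cases n with
  | zero => rfl
  | succ n => exact wk_rename_upr _ _

theorem subst_rename (a : Exp) (σ : ℕ → Exp) (ξ : ℕ → ℕ) :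
    (a.subst σ).rename ξ = a.subst fun n => (σ n).rename ξ := by
  induction a generalizing ξ σ <;> simp_all [rename, subst, up_rename]

theorem wk_subst (a : Exp) (σ : ℕ → Exp) : a.wk.subst σ = a.subst fun n => σ (n + 1) :=
  rename_subst _ _ _

theorem wk_subst_up (a : Exp) (σ : ℕ → Exp) : a.wk.subst (up σ) = (a.subst σ).wk := by
  rw [wk_subst, wk, subst_rename]
  rfl

theorem wk_subst_scons (a b : Exp) (σ : ℕ → Exp) : a.wk.subst (scons b σ) = a.subst σ :=
  wk_subst _ _

theorem up_subst (σ τ : ℕ → Exp) :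
    (fun n => (up σ n).subst (up τ)) = up fun n => (σ n).subst τ := by
  funext n
  cases n with
  | zero => rfl
  | succ n => exact wk_subst_up _ _

theorem subst_subst (a : Exp) (σ τ : ℕ → Exp) :
    (a.subst σ).subst τ = a.subst fun n => (σ n).subst τ := by
  induction a generalizing σ τ <;> simp_all [subst, up_subst]

theorem up_var : up var = var := by
  funext n
  cases n <;> rfl

theorem subst_var (a : Exp) : a.subst var = a := by
  induction a <;> simp_all [subst, up_var]

theorem rename_eq_subst (a : Exp) (ξ : ℕ → ℕ) : a.rename ξ = a.subst (var ∘ ξ) := by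
  rw [← rename_subst, subst_var]

theorem inst_eq (B a : Exp) : B.inst a = B.subst (scons a var) := by
  rw [inst, single_eq]

theorem subst_scons_subst (B a : Exp) (σ τ : ℕ → Exp) :
    (B.subst (scons a σ)).subst τ = B.subst (scons (a.subst τ) fun n => (σ n).subst τ) := by
  rw [subst_subst]
  congr 1
  funext n
  cases n <;> rfl

theorem inst_subst (B a : Exp) (σ : ℕ → Exp) :
    (B.inst a).subst σ = B.subst (scons (a.subst σ) σ) := by
  rw [inst_eq, subst_scons_subst]
  rfl

theorem subst_up_scons (B a : Exp) (σ τ : ℕ → Exp) :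
    (B.subst (up σ)).subst (scons a τ) = B.subst (scons a fun n => (σ n).subst τ) := by
  rw [subst_subst]
  congr 1
  funext n
  cases n with
  | zero => rfl
  | succ n => exact wk_subst_scons _ _ _

theorem subst_up_inst (B a : Exp) (σ : ℕ → Exp) :
    (B.subst (up σ)).inst a = B.subst (scons a σ) := by
  rw [inst_eq, subst_up_scons]
  simp only [subst_var]

theorem inst_subst_up (B a : Exp) (σ : ℕ → Exp) :
    (B.inst a).subst σ = (B.subst (up σ)).inst (a.subst σ) := by
  rw [inst_subst, subst_up_inst]

theorem wk_inst (a b : Exp) : a.wk.inst b = a := by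
  rw [inst_eq, wk_subst_scons, subst_var]

/-- Used to type η-expansions: applying a weakened function to the fresh variable gives back its
codomain. -/
theorem rename_upr_succ_inst_var (B : Exp) : (B.rename (upr Nat.succ)).inst (var 0) = B := by
  rw [inst_eq, rename_subst]
  convert subst_var B using 2
  funext n
  cases n <;> rfl

end Exp

theorem Con.type_subst (c : Con) (σ : ℕ → Exp) : c.type.subst σ = c.type := by
  cases c <;> rfl

/-- Substitution in a judgment. -/
def Jdg.subst (σ : ℕ → Exp) : Jdg → Jdg
  | ctx => ctx
  | isTy A => isTy (A.subst σ)
  | eqTy A B => eqTy (A.subst σ) (B.subst σ)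
  | hasTy a A => hasTy (a.subst σ) (A.subst σ)
  | eqTm a b A => eqTm (a.subst σ) (b.subst σ) (A.subst σ)

/-! ### Derivations with redundant premises -/

/-- Derivability with some presuppositions of the rules as additional premises. By
`Derivable.deriv` and `Deriv.derivable` it is equivalent to `Derivable`. -/
inductive Deriv : List Exp → Jdg → Prop
  -- contexts
  | nil : Deriv [] ctx
  | cons {Γ A} : Deriv Γ ctx → Deriv Γ (isTy A) → Deriv (A :: Γ) ctx
  -- type formation
  | unit_ty {Γ} : Deriv Γ ctx → Deriv Γ (isTy unit)
  | pi_ty {Γ A B} : Deriv Γ (isTy A) → Deriv (A :: Γ) (isTy B) → Deriv Γ (isTy (.pi A B))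
  | sigma_ty {Γ A B} : Deriv Γ (isTy A) → Deriv (A :: Γ) (isTy B) → Deriv Γ (isTy (sigma A B))
  | eq_ty {Γ A a b} : Deriv Γ (isTy A) → Deriv Γ (hasTy a A) → Deriv Γ (hasTy b A) →
      Deriv Γ (isTy (eq A a b))
  | tp_ty {Γ} : Deriv Γ ctx → Deriv Γ (isTy tp)
  | tm_ty {Γ A} : Deriv Γ (hasTy A tp) → Deriv Γ (isTy (tm A))
  -- equality of types
  | ty_refl {Γ A} : Deriv Γ (isTy A) → Deriv Γ (eqTy A A)
  | ty_symm {Γ A B} : Deriv Γ (eqTy A B) → Deriv Γ (eqTy B A)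
  | ty_trans {Γ A B C} : Deriv Γ (eqTy A B) → Deriv Γ (eqTy B C) → Deriv Γ (eqTy A C)
  | pi_congr {Γ A A' B B'} : Deriv Γ (isTy A) → Deriv Γ (eqTy A A') → Deriv (A :: Γ) (eqTy B B') →
      Deriv Γ (eqTy (.pi A B) (.pi A' B'))
  | sigma_congr {Γ A A' B B'} : Deriv Γ (isTy A) → Deriv Γ (eqTy A A') →
      Deriv (A :: Γ) (eqTy B B') → Deriv Γ (eqTy (sigma A B) (sigma A' B'))
  | eq_congr {Γ A A' a a' b b'} : Deriv Γ (eqTy A A') → Deriv Γ (eqTm a a' A) →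
      Deriv Γ (eqTm b b' A) → Deriv Γ (eqTy (eq A a b) (eq A' a' b'))
  | tm_congr {Γ A A'} : Deriv Γ (eqTm A A' tp) → Deriv Γ (eqTy (tm A) (tm A'))
  -- terms
  | var {Γ n A} : Deriv Γ ctx → HasVar Γ n A → Deriv Γ (hasTy (var n) A)
  | conv {Γ a A B} : Deriv Γ (hasTy a A) → Deriv Γ (eqTy A B) → Deriv Γ (hasTy a B)
  | star {Γ} : Deriv Γ ctx → Deriv Γ (hasTy star unit)
  | lam {Γ A B a} : Deriv Γ (isTy A) → Deriv (A :: Γ) (hasTy a B) →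
      Deriv Γ (hasTy (.lam A a) (.pi A B))
  | app {Γ A B f a} : Deriv Γ (hasTy f (.pi A B)) → Deriv Γ (hasTy a A) →
      Deriv Γ (hasTy (.app f a) (B.inst a))
  | pair {Γ A B a b} : Deriv Γ (isTy A) → Deriv (A :: Γ) (isTy B) → Deriv Γ (hasTy a A) →
      Deriv Γ (hasTy b (B.inst a)) → Deriv Γ (hasTy (pair B a b) (sigma A B))
  | fst {Γ A B p} : Deriv Γ (hasTy p (sigma A B)) → Deriv Γ (hasTy (fst p) A)
  | snd {Γ A B p} : Deriv Γ (hasTy p (sigma A B)) → Deriv Γ (hasTy (snd p) (B.inst (fst p)))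
  | refl {Γ A a} : Deriv Γ (isTy A) → Deriv Γ (hasTy a A) → Deriv Γ (hasTy (refl a) (eq A a a))
  | con {Γ} (c : Con) : Deriv Γ ctx → Deriv Γ (hasTy (con c) c.type)
  -- equality of terms
  | tm_refl {Γ a A} : Deriv Γ (hasTy a A) → Deriv Γ (eqTm a a A)
  | tm_symm {Γ a b A} : Deriv Γ (eqTm a b A) → Deriv Γ (eqTm b a A)
  | tm_trans {Γ a b c A} : Deriv Γ (eqTm a b A) → Deriv Γ (eqTm b c A) → Deriv Γ (eqTm a c A)
  | eq_conv {Γ a b A B} : Deriv Γ (eqTm a b A) → Deriv Γ (eqTy A B) → Deriv Γ (eqTm a b B)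
  | lam_congr {Γ A A' B a a'} : Deriv Γ (isTy A) → Deriv Γ (eqTy A A') →
      Deriv (A :: Γ) (eqTm a a' B) → Deriv Γ (eqTm (.lam A a) (.lam A' a') (.pi A B))
  | app_congr {Γ A B f f' a a'} : Deriv Γ (eqTm f f' (.pi A B)) → Deriv Γ (eqTm a a' A) →
      Deriv Γ (eqTm (.app f a) (.app f' a') (B.inst a))
  | pair_congr {Γ A B B' a a' b b'} : Deriv Γ (isTy A) → Deriv (A :: Γ) (eqTy B B') →
      Deriv Γ (eqTm a a' A) → Deriv Γ (eqTm b b' (B.inst a)) →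
      Deriv Γ (eqTm (pair B a b) (pair B' a' b') (sigma A B))
  | fst_congr {Γ A B p p'} : Deriv Γ (eqTm p p' (sigma A B)) → Deriv Γ (eqTm (fst p) (fst p') A)
  | snd_congr {Γ A B p p'} : Deriv Γ (eqTm p p' (sigma A B)) →
      Deriv Γ (eqTm (snd p) (snd p') (B.inst (fst p)))
  | unit_eta {Γ a} : Deriv Γ (hasTy a unit) → Deriv Γ (eqTm a Exp.star unit)
  | pi_beta {Γ A B a b} : Deriv Γ (isTy A) → Deriv (A :: Γ) (hasTy b B) → Deriv Γ (hasTy a A) →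
      Deriv Γ (eqTm (.app (.lam A b) a) (b.inst a) (B.inst a))
  | pi_eta {Γ A B f} : Deriv Γ (hasTy f (.pi A B)) →
      Deriv Γ (eqTm f (.lam A (.app f.wk (.var 0))) (.pi A B))
  | fst_beta {Γ A B a b} : Deriv Γ (isTy A) → Deriv (A :: Γ) (isTy B) → Deriv Γ (hasTy a A) →
      Deriv Γ (hasTy b (B.inst a)) → Deriv Γ (eqTm (fst (pair B a b)) a A)
  | snd_beta {Γ A B a b} : Deriv Γ (isTy A) → Deriv (A :: Γ) (isTy B) → Deriv Γ (hasTy a A) →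
      Deriv Γ (hasTy b (B.inst a)) → Deriv Γ (eqTm (snd (pair B a b)) b (B.inst a))
  | sigma_eta {Γ A B p} : Deriv Γ (hasTy p (sigma A B)) →
      Deriv Γ (eqTm p (pair B (fst p) (snd p)) (sigma A B))
  | reflection {Γ A a b p} : Deriv Γ (hasTy a A) → Deriv Γ (hasTy b A) →
      Deriv Γ (hasTy p (eq A a b)) → Deriv Γ (eqTm a b A)
  | eq_eta {Γ A a b p} : Deriv Γ (hasTy p (eq A a b)) → Deriv Γ (eqTm p (refl a) (eq A a b))
  -- equations of the signature
  | ite_tru {Γ C t f} : Deriv Γ (hasTy C (.pi (tm Exp.bool) tp)) →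
      Deriv Γ (hasTy t (tm (.app C tru))) → Deriv Γ (hasTy f (tm (.app C fls))) →
      Deriv Γ (eqTm (ite C tru t f) t (tm (.app C tru)))
  | ite_fls {Γ C t f} : Deriv Γ (hasTy C (.pi (tm Exp.bool) tp)) →
      Deriv Γ (hasTy t (tm (.app C tru))) → Deriv Γ (hasTy f (tm (.app C fls))) →
      Deriv Γ (eqTm (ite C fls t f) f (tm (.app C fls)))
  | app_lam {Γ A B f a} : Deriv Γ (hasTy A tp) → Deriv Γ (hasTy B (.pi (tm A) tp)) →
      Deriv Γ (hasTy f (.pi (tm A) (tm (.app B.wk (.var 0))))) → Deriv Γ (hasTy a (tm A)) →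
      Deriv Γ (eqTm (.app (App A B (Lam A B f)) a) (.app f a) (tm (.app B a)))
  | lam_app {Γ A B e} : Deriv Γ (hasTy A tp) → Deriv Γ (hasTy B (.pi (tm A) tp)) →
      Deriv Γ (hasTy e (tm (Pi A B))) → Deriv Γ (eqTm (Lam A B (App A B e)) e (tm (Pi A B)))

theorem Deriv.derivable {Γ J} (h : Deriv Γ J) : Derivable Γ J := by
  induction h with
  | nil => exact .nil
  | cons _ _ h1 h2 => exact .cons h1 h2
  | unit_ty _ h1 => exact .unit_ty h1
  | pi_ty _ _ h1 h2 => exact .pi_ty h1 h2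
  | sigma_ty _ _ h1 h2 => exact .sigma_ty h1 h2
  | eq_ty _ _ _ h1 h2 h3 => exact .eq_ty h1 h2 h3
  | tp_ty _ h1 => exact .tp_ty h1
  | tm_ty _ h1 => exact .tm_ty h1
  | ty_refl _ h1 => exact .ty_refl h1
  | ty_symm _ h1 => exact .ty_symm h1
  | ty_trans _ _ h1 h2 => exact .ty_trans h1 h2
  | pi_congr _ _ _ _ h1 h2 => exact .pi_congr h1 h2
  | sigma_congr _ _ _ _ h1 h2 => exact .sigma_congr h1 h2
  | eq_congr _ _ _ h1 h2 h3 => exact .eq_congr h1 h2 h3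
  | tm_congr _ h1 => exact .tm_congr h1
  | var _ hv ih => exact .var ih hv
  | conv _ _ h1 h2 => exact .conv h1 h2
  | star _ h1 => exact .star h1
  | lam _ _ h1 h2 => exact .lam h1 h2
  | app _ _ h1 h2 => exact .app h1 h2
  | pair _ _ _ _ _ h1 h2 h3 => exact .pair h1 h2 h3
  | fst _ h1 => exact .fst h1
  | snd _ h1 => exact .snd h1
  | refl _ _ _ h1 => exact .refl h1
  | con c _ ih => exact .con c ih
  | tm_refl _ h1 => exact .tm_refl h1
  | tm_symm _ h1 => exact .tm_symm h1
  | tm_trans _ _ h1 h2 => exact .tm_trans h1 h2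
  | eq_conv _ _ h1 h2 => exact .eq_conv h1 h2
  | lam_congr _ _ _ _ h1 h2 => exact .lam_congr h1 h2
  | app_congr _ _ h1 h2 => exact .app_congr h1 h2
  | pair_congr _ _ _ _ _ h1 h2 h3 => exact .pair_congr h1 h2 h3
  | fst_congr _ h1 => exact .fst_congr h1
  | snd_congr _ h1 => exact .snd_congr h1
  | unit_eta _ h1 => exact .unit_eta h1
  | pi_beta _ _ _ _ h1 h2 => exact .pi_beta h1 h2
  | pi_eta _ h1 => exact .pi_eta h1
  | fst_beta _ _ _ _ _ h1 h2 h3 => exact .fst_beta h1 h2 h3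
  | snd_beta _ _ _ _ _ h1 h2 h3 => exact .snd_beta h1 h2 h3
  | sigma_eta _ h1 => exact .sigma_eta h1
  | reflection _ _ _ _ _ h1 => exact .reflection h1
  | eq_eta _ h1 => exact .eq_eta h1
  | ite_tru _ _ _ h1 h2 h3 => exact .ite_tru h1 h2 h3
  | ite_fls _ _ _ h1 h2 h3 => exact .ite_fls h1 h2 h3
  | app_lam _ _ _ _ h1 h2 h3 h4 => exact .app_lam h1 h2 h3 h4
  | lam_app _ _ _ h1 h2 h3 => exact .lam_app h1 h2 h3

end LF

/-! ### Substitution and functionality for derivations -/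

namespace LF

open Exp Jdg

namespace Deriv

theorem ctx_of {Γ J} (h : Deriv Γ J) : Deriv Γ ctx := by
  induction h with
  | cons h h' => exact .cons h h'
  | nil => exact .nil
  | _ => assumption

theorem isTy_of_cons {Γ A J} (h : Deriv (A :: Γ) J) : Deriv Γ (isTy A) := by
  cases h.ctx_of with
  | cons _ h => exact h

/-- Type formation is syntax-directed: no conversion rule concludes `isTy`, so inversion is a single
case. -/
theorem pi_inv {Γ A B} (h : Deriv Γ (isTy (.pi A B))) :
    Deriv Γ (isTy A) ∧ Deriv (A :: Γ) (isTy B) := by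
  cases h with
  | pi_ty h h' => exact ⟨h, h'⟩

theorem sigma_inv {Γ A B} (h : Deriv Γ (isTy (sigma A B))) :
    Deriv Γ (isTy A) ∧ Deriv (A :: Γ) (isTy B) := by
  cases h with
  | sigma_ty h h' => exact ⟨h, h'⟩

theorem eq_inv {Γ A a b} (h : Deriv Γ (isTy (eq A a b))) :
    Deriv Γ (isTy A) ∧ Deriv Γ (hasTy a A) ∧ Deriv Γ (hasTy b A) := by
  cases h with
  | eq_ty h h' h'' => exact ⟨h, h', h''⟩

end Deriv

/-- A class of substitutions that consists of well-typed ones and is closed under extension by a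
variable. -/
structure LiftClosed (P : List Exp → (ℕ → Exp) → List Exp → Prop) : Prop where
  hasTy : ∀ {Δ σ Γ n A}, P Δ σ Γ → Deriv Δ ctx → HasVar Γ n A →
    Deriv Δ (hasTy (σ n) (A.subst σ))
  lift : ∀ {Δ σ Γ A}, P Δ σ Γ → Deriv Δ (isTy (A.subst σ)) → P (A.subst σ :: Δ) (up σ) (A :: Γ)

/-- Nothing else about the class enters the induction, so one proof serves first for renamings and
then for all typed substitutions. At a binder, the explicit premise `isTy A` makes the extended
target context well formed. -/
theorem LiftClosed.subst {P} (hP : LiftClosed P) {Γ J} (h : Deriv Γ J) :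
    ∀ {Δ σ}, Deriv Δ ctx → P Δ σ Γ → Deriv Δ (J.subst σ) := by
  have up {Δ σ Γ A} (hσ : P Δ σ Γ) (hA : Deriv Δ (isTy (A.subst σ))) :
      Deriv (A.subst σ :: Δ) ctx ∧ P (A.subst σ :: Δ) (up σ) (A :: Γ) :=
    ⟨.cons hA.ctx_of hA, hP.lift hσ hA⟩
  induction h with intro Δ σ hΔ hσ
  | nil => exact hΔ
  | cons _ _ _ _ => exact hΔ
  | unit_ty _ _ => exact .unit_ty hΔ
  | pi_ty _ _ iA iB =>
    have hA := iA hΔ hσ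
    have h := up hσ hA
    exact .pi_ty hA (iB h.1 h.2)
  | sigma_ty _ _ iA iB =>
    have hA := iA hΔ hσ
    have h := up hσ hA
    exact .sigma_ty hA (iB h.1 h.2)
  | eq_ty _ _ _ iA ia ib => exact .eq_ty (iA hΔ hσ) (ia hΔ hσ) (ib hΔ hσ)
  | tp_ty _ _ => exact .tp_ty hΔ
  | tm_ty _ iA => exact .tm_ty (iA hΔ hσ)
  | ty_refl _ i => exact .ty_refl (i hΔ hσ)
  | ty_symm _ i => exact .ty_symm (i hΔ hσ)
  | ty_trans _ _ i i' => exact .ty_trans (i hΔ hσ) (i' hΔ hσ)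
  | pi_congr _ _ _ iA iA' iB =>
    have hA := iA hΔ hσ
    have h := up hσ hA
    exact .pi_congr hA (iA' hΔ hσ) (iB h.1 h.2)
  | sigma_congr _ _ _ iA iA' iB =>
    have hA := iA hΔ hσ
    have h := up hσ hA
    exact .sigma_congr hA (iA' hΔ hσ) (iB h.1 h.2)
  | eq_congr _ _ _ iA ia ib => exact .eq_congr (iA hΔ hσ) (ia hΔ hσ) (ib hΔ hσ)
  | tm_congr _ iA => exact .tm_congr (iA hΔ hσ)
  | var _ hn _ => exact hP.hasTy hσ hΔ hn
  | conv _ _ ia iA => exact .conv (ia hΔ hσ) (iA hΔ hσ)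
  | star _ _ => exact .star hΔ
  | lam _ _ iA ib =>
    have hA := iA hΔ hσ
    have h := up hσ hA
    exact .lam hA (ib h.1 h.2)
  | app _ _ iff ia =>
    simp only [Jdg.subst, inst_subst_up]
    exact .app (iff hΔ hσ) (ia hΔ hσ)
  | pair _ _ _ _ iA iB ia ib =>
    have hA := iA hΔ hσ
    have h := up hσ hA
    simp only [Jdg.subst, inst_subst_up] at ib
    exact .pair hA (iB h.1 h.2) (ia hΔ hσ) (ib hΔ hσ)
  | fst _ i => exact .fst (i hΔ hσ)
  | snd _ i =>
    simp only [Jdg.subst, inst_subst_up]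
    exact .snd (i hΔ hσ)
  | refl _ _ iA i => exact .refl (iA hΔ hσ) (i hΔ hσ)
  | con c _ _ =>
    simp only [Jdg.subst, Con.type_subst]
    exact .con c hΔ
  | tm_refl _ i => exact .tm_refl (i hΔ hσ)
  | tm_symm _ i => exact .tm_symm (i hΔ hσ)
  | tm_trans _ _ i i' => exact .tm_trans (i hΔ hσ) (i' hΔ hσ)
  | eq_conv _ _ ia iA => exact .eq_conv (ia hΔ hσ) (iA hΔ hσ)
  | lam_congr _ _ _ iA iA' ib =>
    have hA := iA hΔ hσ
    have h := up hσ hA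
    exact .lam_congr hA (iA' hΔ hσ) (ib h.1 h.2)
  | app_congr _ _ iff ia =>
    simp only [Jdg.subst, inst_subst_up]
    exact .app_congr (iff hΔ hσ) (ia hΔ hσ)
  | pair_congr _ _ _ _ iA iB ia ib =>
    have hA := iA hΔ hσ
    have h := up hσ hA
    simp only [Jdg.subst, inst_subst_up] at ib
    exact .pair_congr hA (iB h.1 h.2) (ia hΔ hσ) (ib hΔ hσ)
  | fst_congr _ i => exact .fst_congr (i hΔ hσ)
  | snd_congr _ i =>
    simp only [Jdg.subst, inst_subst_up]
    exact .snd_congr (i hΔ hσ)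
  | unit_eta _ i => exact .unit_eta (i hΔ hσ)
  | pi_beta _ _ _ iA ib ia =>
    have hA := iA hΔ hσ
    have h := up hσ hA
    simp only [Jdg.subst, inst_subst_up]
    exact .pi_beta hA (ib h.1 h.2) (ia hΔ hσ)
  | pi_eta _ i =>
    simp only [Jdg.subst, Exp.subst, wk_subst_up]
    exact .pi_eta (i hΔ hσ)
  | fst_beta _ _ _ _ iA iB ia ib =>
    have hA := iA hΔ hσ
    have h := up hσ hA
    simp only [Jdg.subst, inst_subst_up] at ib
    exact .fst_beta hA (iB h.1 h.2) (ia hΔ hσ) (ib hΔ hσ)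
  | snd_beta _ _ _ _ iA iB ia ib =>
    have hA := iA hΔ hσ
    have h := up hσ hA
    simp only [Jdg.subst, inst_subst_up] at ib ⊢
    exact .snd_beta hA (iB h.1 h.2) (ia hΔ hσ) (ib hΔ hσ)
  | sigma_eta _ i => exact .sigma_eta (i hΔ hσ)
  | reflection _ _ _ ia ib ip => exact .reflection (ia hΔ hσ) (ib hΔ hσ) (ip hΔ hσ)
  | eq_eta _ i => exact .eq_eta (i hΔ hσ)
  | ite_tru _ _ _ iC it iff => exact .ite_tru (iC hΔ hσ) (it hΔ hσ) (iff hΔ hσ)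
  | ite_fls _ _ _ iC it iff => exact .ite_fls (iC hΔ hσ) (it hΔ hσ) (iff hΔ hσ)
  | app_lam _ _ _ _ iA iB iff ia =>
    simp only [Jdg.subst, Exp.subst, wk_subst_up] at iff
    exact .app_lam (iA hΔ hσ) (iB hΔ hσ) (iff hΔ hσ) (ia hΔ hσ)
  | lam_app _ _ _ iA iB ie => exact .lam_app (iA hΔ hσ) (iB hΔ hσ) (ie hΔ hσ)

/-- This case comes before that of general substitutions, because carrying a substitution under a
binder weakens its terms. -/
theorem liftClosed_rename : LiftClosed fun Δ σ Γ =>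
    ∃ ξ : ℕ → ℕ, σ = var ∘ ξ ∧ ∀ n A, HasVar Γ n A → HasVar Δ (ξ n) (A.rename ξ) where
  hasTy := by
    rintro Δ _ Γ n A ⟨ξ, rfl, hξ⟩ hΔ hn
    rw [← rename_eq_subst]
    exact .var hΔ (hξ n A hn)
  lift := by
    rintro Δ _ Γ A ⟨ξ, rfl, hξ⟩ _
    refine ⟨upr ξ, by funext n; cases n <;> rfl, ?_⟩
    rintro _ _ (_ | ⟨_, h⟩)
    · rw [wk_rename_upr, ← rename_eq_subst]
      exact .zero _ _
    · rw [wk_rename_upr, ← rename_eq_subst]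
      exact .succ _ (hξ _ _ h)

theorem Deriv.weaken {Γ J B} (h : Deriv Γ J) (hB : Deriv Γ (isTy B)) :
    Deriv (B :: Γ) (J.subst fun n => Exp.var (n + 1)) := by
  refine liftClosed_rename.subst h (.cons h.ctx_of hB) ⟨Nat.succ, rfl, fun n A hn => .succ _ hn⟩

theorem Deriv.isTy_weaken {Γ A B} (h : Deriv Γ (isTy A)) (hB : Deriv Γ (isTy B)) :
    Deriv (B :: Γ) (isTy A.wk) := by
  rw [wk, rename_eq_subst]
  exact h.weaken hB

theorem Deriv.eqTy_weaken {Γ A A' B} (h : Deriv Γ (eqTy A A')) (hB : Deriv Γ (isTy B)) :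
    Deriv (B :: Γ) (eqTy A.wk A'.wk) := by
  rw [wk, rename_eq_subst, wk, rename_eq_subst]
  exact h.weaken hB

theorem Deriv.hasTy_weaken {Γ a A B} (h : Deriv Γ (hasTy a A)) (hB : Deriv Γ (isTy B)) :
    Deriv (B :: Γ) (hasTy a.wk A.wk) := by
  rw [wk, rename_eq_subst, wk, rename_eq_subst]
  exact h.weaken hB

theorem Deriv.eqTm_weaken {Γ a b A B} (h : Deriv Γ (eqTm a b A)) (hB : Deriv Γ (isTy B)) :
    Deriv (B :: Γ) (eqTm a.wk b.wk A.wk) := by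
  rw [wk, rename_eq_subst, wk, rename_eq_subst, wk, rename_eq_subst]
  exact h.weaken hB

/-- `σ` is a well-typed substitution from `Δ` to `Γ`. -/
def Sub (Δ : List Exp) (σ : ℕ → Exp) (Γ : List Exp) : Prop :=
  ∀ n A, HasVar Γ n A → Deriv Δ (hasTy (σ n) (A.subst σ))

theorem Sub.scons {Δ σ Γ a A} (hσ : Sub Δ σ Γ) (ha : Deriv Δ (hasTy a (A.subst σ))) :
    Sub Δ (scons a σ) (A :: Γ) := by
  rintro _ _ (_ | ⟨_, h⟩)
  · rw [wk_subst_scons]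
    exact ha
  · rw [wk_subst_scons]
    exact hσ _ _ h

/-- The freedom to bind at an equal type `A'` is what context conversion needs, and also the second
of two equal substitutions in `SubEq.up`. -/
theorem Sub.up_of_eqTy {Δ σ Γ A A'} (hσ : Sub Δ σ Γ) (hA : Deriv Δ (isTy A'))
    (h : Deriv Δ (eqTy A' (A.subst σ))) : Sub (A' :: Δ) (up σ) (A :: Γ) := by
  rintro _ _ (_ | ⟨_, hn⟩)
  · rw [wk_subst_up]
    exact .conv (.var (.cons hA.ctx_of hA) (.zero _ _)) (h.eqTy_weaken hA)
  · rw [wk_subst_up]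
    exact (hσ _ _ hn).hasTy_weaken hA

theorem Sub.up {Δ σ Γ A} (hσ : Sub Δ σ Γ) (hA : Deriv Δ (isTy (A.subst σ))) :
    Sub (A.subst σ :: Δ) (up σ) (A :: Γ) :=
  hσ.up_of_eqTy hA (.ty_refl hA)

theorem liftClosed_sub : LiftClosed Sub where
  hasTy hσ _ hn := hσ _ _ hn
  lift hσ hA := hσ.up hA

theorem Deriv.subst {Γ J Δ σ} (h : Deriv Γ J) (hΔ : Deriv Δ ctx) (hσ : Sub Δ σ Γ) :
    Deriv Δ (J.subst σ) :=
  liftClosed_sub.subst h hΔ hσ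

theorem Sub.id {Γ} (h : Deriv Γ ctx) : Sub Γ var Γ := fun n A hn => by
  rw [subst_var]
  exact .var h hn

theorem Jdg.subst_var (J : Jdg) : J.subst var = J := by
  cases J <;> simp [Jdg.subst, Exp.subst_var]

theorem Deriv.convCtx {Γ A A' J} (h : Deriv (A :: Γ) J) (hA : Deriv Γ (isTy A'))
    (e : Deriv Γ (eqTy A' A)) : Deriv (A' :: Γ) J := by
  have := h.subst (.cons hA.ctx_of hA) ((Sub.id hA.ctx_of).up_of_eqTy hA
    (by rwa [Exp.subst_var]))
  rwa [up_var, Jdg.subst_var] at this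

theorem Deriv.isTy_inst {Γ A B a} (hB : Deriv (A :: Γ) (isTy B)) (ha : Deriv Γ (hasTy a A)) :
    Deriv Γ (isTy (B.inst a)) := by
  rw [inst_eq]
  exact hB.subst ha.ctx_of ((Sub.id ha.ctx_of).scons (by rwa [Exp.subst_var]))

theorem Deriv.hasTy_inst {Γ A B a b} (hb : Deriv (A :: Γ) (hasTy b B))
    (ha : Deriv Γ (hasTy a A)) : Deriv Γ (hasTy (b.inst a) (B.inst a)) := by
  rw [inst_eq, inst_eq]
  exact hb.subst ha.ctx_of ((Sub.id ha.ctx_of).scons (by rwa [Exp.subst_var]))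

/-- `σ` and `σ'` are equal well-typed substitutions from `Δ` to `Γ`. -/
structure SubEq (Δ : List Exp) (σ σ' : ℕ → Exp) (Γ : List Exp) : Prop where
  left : Sub Δ σ Γ
  right : Sub Δ σ' Γ
  eq : ∀ n A, HasVar Γ n A → Deriv Δ (eqTm (σ n) (σ' n) (A.subst σ))

theorem SubEq.up {Δ σ σ' Γ A} (h : SubEq Δ σ σ' Γ) (hA : Deriv Δ (isTy (A.subst σ)))
    (e : Deriv Δ (eqTy (A.subst σ) (A.subst σ'))) :
    SubEq (A.subst σ :: Δ) (up σ) (up σ') (A :: Γ) where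
  left := h.left.up hA
  right := h.right.up_of_eqTy hA e
  eq := by
    rintro _ _ (_ | ⟨_, hn⟩)
    · rw [wk_subst_up]
      exact .tm_refl (.var (.cons hA.ctx_of hA) (.zero _ _))
    · rw [wk_subst_up]
      exact (h.eq _ _ hn).eqTm_weaken hA

theorem SubEq.scons {Δ σ σ' Γ a a' A} (h : SubEq Δ σ σ' Γ)
    (ha : Deriv Δ (hasTy a (A.subst σ))) (ha' : Deriv Δ (hasTy a' (A.subst σ')))
    (e : Deriv Δ (eqTm a a' (A.subst σ))) : SubEq Δ (scons a σ) (scons a' σ') (A :: Γ) where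
  left := h.left.scons ha
  right := h.right.scons ha'
  eq := by
    rintro _ _ (_ | ⟨_, hn⟩)
    · rw [wk_subst_scons]
      exact e
    · rw [wk_subst_scons]
      exact h.eq _ _ hn

/-- The equation between the results of two substitutions. -/
def Jdg.substEq (Δ : List Exp) (σ σ' : ℕ → Exp) : Jdg → Prop
  | isTy A => Deriv Δ (eqTy (A.subst σ) (A.subst σ'))
  | hasTy a A => Deriv Δ (eqTm (a.subst σ) (a.subst σ') (A.subst σ))
  | _ => True

theorem Deriv.substEq {Γ J} (h : Deriv Γ J) : ∀ {Δ σ σ'}, Deriv Δ ctx → SubEq Δ σ σ' Γ →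
    J.substEq Δ σ σ' := by
  have up {Γ A Δ σ σ'} (hA : Deriv Γ (isTy A)) (hΔ : Deriv Δ ctx) (h : SubEq Δ σ σ' Γ)
      (e : Deriv Δ (eqTy (A.subst σ) (A.subst σ'))) :
      Deriv (A.subst σ :: Δ) ctx ∧ SubEq (A.subst σ :: Δ) (up σ) (up σ') (A :: Γ) :=
    ⟨.cons hΔ (hA.subst hΔ h.left), h.up (hA.subst hΔ h.left) e⟩
  induction h with (intro Δ σ σ' hΔ hσ; try trivial)
  | unit_ty _ _ => exact .ty_refl (.unit_ty hΔ)
  | pi_ty hA _ iA iB =>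
    have e := iA hΔ hσ
    have h := up hA hΔ hσ e
    exact .pi_congr (hA.subst hΔ hσ.left) e (iB h.1 h.2)
  | sigma_ty hA _ iA iB =>
    have e := iA hΔ hσ
    have h := up hA hΔ hσ e
    exact .sigma_congr (hA.subst hΔ hσ.left) e (iB h.1 h.2)
  | eq_ty _ _ _ iA ia ib => exact .eq_congr (iA hΔ hσ) (ia hΔ hσ) (ib hΔ hσ)
  | tp_ty _ _ => exact .ty_refl (.tp_ty hΔ)
  | tm_ty _ iA => exact .tm_congr (iA hΔ hσ)
  | var _ hn _ => exact hσ.eq _ _ hn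
  | conv _ hA ia _ => exact .eq_conv (ia hΔ hσ) (hA.subst hΔ hσ.left)
  | star _ _ => exact .tm_refl (.star hΔ)
  | lam hA _ iA ib =>
    have e := iA hΔ hσ
    have h := up hA hΔ hσ e
    exact .lam_congr (hA.subst hΔ hσ.left) e (ib h.1 h.2)
  | app _ _ iff ia =>
    simp only [Jdg.substEq, inst_subst_up]
    exact .app_congr (iff hΔ hσ) (ia hΔ hσ)
  | pair hA _ _ _ iA iB ia ib =>
    have e := iA hΔ hσ
    have h := up hA hΔ hσ e
    simp only [Jdg.substEq, inst_subst_up] at ib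
    exact .pair_congr (hA.subst hΔ hσ.left) (iB h.1 h.2) (ia hΔ hσ) (ib hΔ hσ)
  | fst _ i => exact .fst_congr (i hΔ hσ)
  | snd _ i =>
    simp only [Jdg.substEq, inst_subst_up]
    exact .snd_congr (i hΔ hσ)
  | refl hA ha iA ia =>
    have e := ia hΔ hσ
    -- There is no congruence rule for `refl`. The reflexivity proof under `σ'` is converted to the
    -- equality type under `σ`, where `eq_eta` identifies it with the one under `σ`.
    exact .tm_symm (.eq_eta (.conv (.refl (hA.subst hΔ hσ.right) (ha.subst hΔ hσ.right))
      (.ty_symm (.eq_congr (iA hΔ hσ) e e))))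
  | con c _ _ =>
    simp only [Jdg.substEq, Con.type_subst]
    exact .tm_refl (.con c hΔ)

end LF

/-! ### Presuppositions, and equivalence of the two systems -/

namespace LF

open Exp Jdg

theorem Exp.wk_subst_single (a b : Exp) : a.wk.subst (single b) = a := wk_inst a b

namespace Deriv

variable {Γ : List Exp} {A B C a b e f t : Exp}

theorem bool_hasTy (h : Deriv Γ ctx) : Deriv Γ (hasTy Exp.bool tp) := .con .bool h

theorem tru_hasTy (h : Deriv Γ ctx) : Deriv Γ (hasTy tru (tm Exp.bool)) := .con .tru h

theorem fls_hasTy (h : Deriv Γ ctx) : Deriv Γ (hasTy fls (tm Exp.bool)) := .con .fls h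

theorem tmBool_isTy (h : Deriv Γ ctx) : Deriv Γ (isTy (tm Exp.bool)) := .tm_ty (bool_hasTy h)

theorem fam_isTy (hA : Deriv Γ (hasTy A tp)) : Deriv Γ (isTy (.pi (tm A) tp)) :=
  .pi_ty (.tm_ty hA) (.tp_ty (.cons hA.ctx_of (.tm_ty hA)))

theorem fam_app (hB : Deriv Γ (hasTy B (.pi (tm A) tp))) (ha : Deriv Γ (hasTy a (tm A))) :
    Deriv Γ (hasTy (.app B a) tp) := .app hB ha

theorem fam_app_isTy (hB : Deriv Γ (hasTy B (.pi (tm A) tp))) (ha : Deriv Γ (hasTy a (tm A))) :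
    Deriv Γ (isTy (tm (.app B a))) := .tm_ty (fam_app hB ha)

theorem fam_app_congr {B' a' : Exp} (hB : Deriv Γ (eqTm B B' (.pi (tm A) tp)))
    (ha : Deriv Γ (eqTm a a' (tm A))) : Deriv Γ (eqTm (.app B a) (.app B' a') tp) :=
  .app_congr hB ha

theorem Pi_hasTy (hA : Deriv Γ (hasTy A tp)) (hB : Deriv Γ (hasTy B (.pi (tm A) tp))) :
    Deriv Γ (hasTy (Pi A B) tp) :=
  .app (A := .pi (tm A) tp) (B := tp) (.app (B := .pi (.pi (tm (Exp.var 0)) tp) tp)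
    (.con .pi hA.ctx_of) hA) hB

theorem Pi_isTy (hA : Deriv Γ (hasTy A tp)) (hB : Deriv Γ (hasTy B (.pi (tm A) tp))) :
    Deriv Γ (isTy (tm (Pi A B))) := .tm_ty (Pi_hasTy hA hB)

theorem fun_isTy (hA : Deriv Γ (hasTy A tp)) (hB : Deriv Γ (hasTy B (.pi (tm A) tp))) :
    Deriv Γ (isTy (.pi (tm A) (tm (.app B.wk (Exp.var 0))))) := by
  have h := Deriv.cons hA.ctx_of (.tm_ty hA)
  exact .pi_ty (.tm_ty hA) (fam_app_isTy (hB.hasTy_weaken (.tm_ty hA)) (.var h (.zero _ _)))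

theorem con_isTy (h : Deriv Γ ctx) (c : Con) : Deriv Γ (isTy c.type) := by
  have hb := tmBool_isTy h
  have h₁ := Deriv.tp_ty h
  have h₁' := Deriv.cons h h₁
  have h₂ := fam_isTy (.var h₁' (.zero _ _))
  have h₂' := Deriv.cons h₁' h₂
  have v₁ : Deriv (.pi (tm (Exp.var 0)) tp :: tp :: Γ) (hasTy (Exp.var 1) tp) :=
    .var h₂' (.succ _ (.zero _ _))
  have v₀ : Deriv (.pi (tm (Exp.var 0)) tp :: tp :: Γ)
      (hasTy (Exp.var 0) (.pi (tm (Exp.var 1)) tp)) :=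
    .var h₂' (.zero _ _)
  cases c with
  | bool => exact h₁
  | tru => exact hb
  | fls => exact hb
  | ite =>
    have k₁ := fam_isTy (bool_hasTy h)
    have k₁' := Deriv.cons h k₁
    have k₂ := tmBool_isTy k₁'
    have k₂' := Deriv.cons k₁' k₂
    have k₃ := fam_app_isTy (A := Exp.bool) (B := Exp.var 1) (.var k₂' (.succ _ (.zero _ _)))
      (tru_hasTy k₂')
    have k₃' := Deriv.cons k₂' k₃
    have k₄ := fam_app_isTy (A := Exp.bool) (B := Exp.var 2)
      (.var k₃' (.succ _ (.succ _ (.zero _ _)))) (fls_hasTy k₃')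
    have k₄' := Deriv.cons k₃' k₄
    have k₅ := fam_app_isTy (A := Exp.bool) (B := Exp.var 3) (a := Exp.var 2)
      (.var k₄' (.succ _ (.succ _ (.succ _ (.zero _ _)))))
      (.var k₄' (.succ _ (.succ _ (.zero _ _))))
    exact .pi_ty k₁ (.pi_ty k₂ (.pi_ty k₃ (.pi_ty k₄ k₅)))
  | pi => exact .pi_ty h₁ (.pi_ty h₂ (.tp_ty h₂'))
  | lam =>
    have h₃ := fun_isTy v₁ v₀
    exact .pi_ty h₁ (.pi_ty h₂ (.pi_ty h₃
      ((Pi_isTy v₁ v₀).isTy_weaken h₃)))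
  | app =>
    have h₃ := Pi_isTy v₁ v₀
    have h₄ := Deriv.isTy_weaken (.tm_ty v₁) h₃
    exact .pi_ty h₁ (.pi_ty h₂ (.pi_ty h₃ (.pi_ty h₄
      (fam_app_isTy (A := Exp.var 3) (B := Exp.var 2) (.var (.cons (.cons h₂' h₃) h₄)
        (.succ _ (.succ _ (.zero _ _)))) (.var (.cons (.cons h₂' h₃) h₄) (.zero _ _))))))

theorem ite_hasTy (hC : Deriv Γ (hasTy C (.pi (tm Exp.bool) tp)))
    (hb : Deriv Γ (hasTy b (tm Exp.bool))) (ht : Deriv Γ (hasTy t (tm (.app C tru))))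
    (hf : Deriv Γ (hasTy f (tm (.app C fls)))) :
    Deriv Γ (hasTy (ite C b t f) (tm (.app C b))) := by
  have h₁ := Deriv.app (.con .ite hC.ctx_of) hC
  have h₂ := Deriv.app h₁ hb
  have h₃ := Deriv.app (A := tm (.app C tru)) (by
    simpa [inst, Exp.subst, up, single, wk_subst_up, wk_subst_single] using h₂) ht
  have h₄ := Deriv.app (A := tm (.app C fls)) (by
    simpa [inst, Exp.subst, up, single, wk_subst_up, wk_subst_single] using h₃) hf
  simpa [inst, Exp.subst, up, single, wk_subst_up, wk_subst_single] using h₄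

theorem Lam_hasTy (hA : Deriv Γ (hasTy A tp)) (hB : Deriv Γ (hasTy B (.pi (tm A) tp)))
    (hf : Deriv Γ (hasTy f (.pi (tm A) (tm (.app B.wk (Exp.var 0)))))) :
    Deriv Γ (hasTy (Lam A B f) (tm (Pi A B))) := by
  have h₁ := Deriv.app (.con .lam hA.ctx_of) hA
  have h₂ := Deriv.app (A := .pi (tm A) tp) h₁ hB
  have h₃ := Deriv.app (A := .pi (tm A) (tm (.app B.wk (Exp.var 0)))) (by
    simpa [inst, Exp.subst, up, single, wk_subst_up, wk_subst_single] using h₂) hf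
  simpa [inst, Exp.subst, up, single, wk_subst_up, wk_subst_single] using h₃

theorem App_hasTy (hA : Deriv Γ (hasTy A tp)) (hB : Deriv Γ (hasTy B (.pi (tm A) tp)))
    (he : Deriv Γ (hasTy e (tm (Pi A B)))) :
    Deriv Γ (hasTy (App A B e) (.pi (tm A) (tm (.app B.wk (Exp.var 0))))) := by
  have h₁ := Deriv.app (.con .app hA.ctx_of) hA
  have h₂ := Deriv.app (A := .pi (tm A) tp) h₁ hB
  have h₃ := Deriv.app (A := tm (Pi A B)) (by
    simpa [inst, Exp.subst, up, single, wk_subst_up, wk_subst_single] using h₂) he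
  simpa [inst, Exp.subst, up, single, wk_subst_up, wk_subst_single] using h₃

theorem fun_app (hf : Deriv Γ (hasTy f (.pi (tm A) (tm (.app B.wk (Exp.var 0))))))
    (ha : Deriv Γ (hasTy a (tm A))) : Deriv Γ (hasTy (.app f a) (tm (.app B a))) := by
  have h := Deriv.app hf ha
  simpa [inst, Exp.subst, single, wk_subst_single] using h

theorem fun_app_congr {f' a' : Exp}
    (hf : Deriv Γ (eqTm f f' (.pi (tm A) (tm (.app B.wk (Exp.var 0))))))
    (ha : Deriv Γ (eqTm a a' (tm A))) :
    Deriv Γ (eqTm (.app f a) (.app f' a') (tm (.app B a))) := by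
  have h := Deriv.app_congr hf ha
  simpa [inst, Exp.subst, single, wk_subst_single] using h

end Deriv

theorem HasVar.isTy {Γ n A} (h : HasVar Γ n A) (hΓ : Deriv Γ ctx) : Deriv Γ (isTy A) := by
  induction h with
  | zero Γ A =>
    cases hΓ with
    | cons _ hA => exact hA.isTy_weaken hA
  | succ B _ ih =>
    cases hΓ with
    | cons hΓ hB => exact (ih hΓ).isTy_weaken hB

/-- The presuppositions of a judgment, apart from that of a well-formed context. -/
def Jdg.Presup (Γ : List Exp) : Jdg → Prop
  | ctx => True
  | isTy _ => True
  | eqTy A B => Deriv Γ (isTy A) ∧ Deriv Γ (isTy B)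
  | hasTy _ A => Deriv Γ (isTy A)
  | eqTm a b A => Deriv Γ (isTy A) ∧ Deriv Γ (hasTy a A) ∧ Deriv Γ (hasTy b A)

theorem Deriv.inst_congr {Γ A B a a'} (hB : Deriv (A :: Γ) (isTy B)) (ha : Deriv Γ (hasTy a A))
    (ha' : Deriv Γ (hasTy a' A)) (e : Deriv Γ (eqTm a a' A)) :
    Deriv Γ (eqTy (B.inst a) (B.inst a')) := by
  rw [inst_eq, inst_eq]
  have h : SubEq Γ Exp.var Exp.var Γ :=
    ⟨Sub.id ha.ctx_of, Sub.id ha.ctx_of, fun n A hn => by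
      rw [Exp.subst_var]
      exact .tm_refl (.var ha.ctx_of hn)⟩
  refine hB.substEq ha.ctx_of (h.scons (a := a) (a' := a') ?_ ?_ ?_) <;> rwa [Exp.subst_var]

/-- In the congruence rules the right-hand side is first typed by its own components; functionality
of the codomain, or conversion of the context, then brings it to the type of the left-hand side. -/
theorem Deriv.presup {Γ J} (h : Deriv Γ J) : J.Presup Γ := by
  induction h with try trivial
  | ty_symm _ i => exact ⟨i.2, i.1⟩
  | ty_trans _ _ i i' => exact ⟨i.1, i'.2⟩
  | pi_congr hA eA _ _ iA iB =>
    exact ⟨.pi_ty iA.1 iB.1, .pi_ty iA.2 (iB.2.convCtx iA.2 (.ty_symm eA))⟩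
  | sigma_congr hA eA _ _ iA iB =>
    exact ⟨.sigma_ty iA.1 iB.1, .sigma_ty iA.2 (iB.2.convCtx iA.2 (.ty_symm eA))⟩
  | eq_congr eA _ _ iA ia ib =>
    exact ⟨.eq_ty iA.1 ia.2.1 ib.2.1, .eq_ty iA.2 (.conv ia.2.2 eA) (.conv ib.2.2 eA)⟩
  | tm_congr _ i => exact ⟨.tm_ty i.2.1, .tm_ty i.2.2⟩
  | var hΓ hn _ => exact hn.isTy hΓ
  | conv _ _ _ i => exact i.2
  | star hΓ _ => exact .unit_ty hΓ
  | lam hA _ _ iB => exact .pi_ty hA iB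
  | app _ ha i _ => exact i.pi_inv.2.isTy_inst ha
  | pair hA hB _ _ => exact .sigma_ty hA hB
  | fst _ i => exact i.sigma_inv.1
  | snd hp i => exact i.sigma_inv.2.isTy_inst (.fst hp)
  | refl hA ha => exact .eq_ty hA ha ha
  | con c hΓ => exact con_isTy hΓ c
  | tm_symm _ i => exact ⟨i.1, i.2.2, i.2.1⟩
  | tm_trans _ _ i i' => exact ⟨i.1, i.2.1, i'.2.2⟩
  | eq_conv _ e i i' => exact ⟨i'.2, .conv i.2.1 e, .conv i.2.2 e⟩
  | lam_congr hA eA _ _ iA ib =>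
    exact ⟨.pi_ty hA ib.1, .lam hA ib.2.1, .conv (.lam iA.2 (ib.2.2.convCtx iA.2 (.ty_symm eA)))
      (.ty_symm (.pi_congr hA eA (.ty_refl ib.1)))⟩
  | app_congr _ ea iff ia =>
    have hB := iff.1.pi_inv.2
    exact ⟨hB.isTy_inst ia.2.1, .app iff.2.1 ia.2.1, .conv (.app iff.2.2 ia.2.2)
      (.ty_symm (hB.inst_congr ia.2.1 ia.2.2 ea))⟩
  | pair_congr hA eB ea eb _ iB ia ib =>
    refine ⟨.sigma_ty hA iB.1, .pair hA iB.1 ia.2.1 ib.2.1, .conv (.pair hA iB.2 ia.2.2 ?_)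
      (.ty_symm (.sigma_congr hA (.ty_refl hA) eB))⟩
    refine .conv ib.2.2 (.ty_trans (iB.1.inst_congr ia.2.1 ia.2.2 ea) ?_)
    rw [inst_eq, inst_eq]
    exact eB.subst hA.ctx_of ((Sub.id hA.ctx_of).scons (by rw [Exp.subst_var]; exact ia.2.2))
  | fst_congr _ i => exact ⟨i.1.sigma_inv.1, .fst i.2.1, .fst i.2.2⟩
  | snd_congr e i =>
    have hB := i.1.sigma_inv.2
    exact ⟨hB.isTy_inst (.fst i.2.1), .snd i.2.1, .conv (.snd i.2.2)
      (.ty_symm (hB.inst_congr (.fst i.2.1) (.fst i.2.2) (.fst_congr e)))⟩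
  | unit_eta ha i => exact ⟨i, ha, .star ha.ctx_of⟩
  | pi_beta hA hb ha _ iB _ => exact ⟨iB.isTy_inst ha, .app (.lam hA hb) ha, hb.hasTy_inst ha⟩
  | @pi_eta Γ A B f hf i =>
    have hA := i.pi_inv.1
    refine ⟨i, hf, .lam hA ?_⟩
    have h := Deriv.app (hf.hasTy_weaken hA) (.var (.cons hA.ctx_of hA) (.zero _ _))
    rwa [rename_upr_succ_inst_var] at h
  | fst_beta hA hB ha hb => exact ⟨hA, .fst (.pair hA hB ha hb), ha⟩
  | snd_beta hA hB ha hb _ _ _ i =>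
    exact ⟨i, .conv (.snd (.pair hA hB ha hb)) (hB.inst_congr (.fst (.pair hA hB ha hb)) ha
      (.fst_beta hA hB ha hb)), hb⟩
  | sigma_eta hp i =>
    exact ⟨i, hp, .pair i.sigma_inv.1 i.sigma_inv.2 (.fst hp) (.snd hp)⟩
  | eq_eta hp i =>
    obtain ⟨hA, ha, hb⟩ := i.eq_inv
    exact ⟨i, hp, .conv (.refl hA ha) (.eq_congr (.ty_refl hA) (.tm_refl ha)
      (.reflection ha hb hp))⟩
  | ite_tru hC ht hf _ i _ => exact ⟨i, ite_hasTy hC (tru_hasTy hC.ctx_of) ht hf, ht⟩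
  | ite_fls hC ht hf _ _ i => exact ⟨i, ite_hasTy hC (fls_hasTy hC.ctx_of) ht hf, hf⟩
  | app_lam hA hB hf ha =>
    have h := fun_app (App_hasTy hA hB (Lam_hasTy hA hB hf)) ha
    exact ⟨h.ctx_of |> fun _ => fam_app_isTy hB ha, h, fun_app hf ha⟩
  | lam_app hA hB he => exact ⟨Pi_isTy hA hB, Lam_hasTy hA hB (App_hasTy hA hB he), he⟩

theorem Deriv.left {Γ a b A} (h : Deriv Γ (eqTm a b A)) : Deriv Γ (hasTy a A) := h.presup.2.1

theorem Deriv.right {Γ a b A} (h : Deriv Γ (eqTm a b A)) : Deriv Γ (hasTy b A) := h.presup.2.2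

/-- The extra premises of each rule are read off from the presuppositions, or the contexts, of
premises already translated. -/
theorem Derivable.deriv {Γ J} (h : Derivable Γ J) : Deriv Γ J := by
  induction h with
  | pi_congr _ _ h₁ h₂ => exact .pi_congr h₁.presup.1 h₁ h₂
  | sigma_congr _ _ h₁ h₂ => exact .sigma_congr h₁.presup.1 h₁ h₂
  | lam_congr _ _ h₁ h₂ => exact .lam_congr h₁.presup.1 h₁ h₂
  | pair _ _ _ h₁ h₂ h₃ => exact .pair h₁.isTy_of_cons h₁ h₂ h₃
  | pair_congr _ _ _ h₁ h₂ h₃ => exact .pair_congr h₁.isTy_of_cons h₁ h₂ h₃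
  | pi_beta _ _ h₁ h₂ => exact .pi_beta h₁.isTy_of_cons h₁ h₂
  | fst_beta _ _ _ h₁ h₂ h₃ => exact .fst_beta h₁.isTy_of_cons h₁ h₂ h₃
  | snd_beta _ _ _ h₁ h₂ h₃ => exact .snd_beta h₁.isTy_of_cons h₁ h₂ h₃
  | reflection _ h => exact .reflection h.presup.eq_inv.2.1 h.presup.eq_inv.2.2 h
  | refl _ h => exact .refl h.presup h
  | nil => exact .nil
  | cons _ _ h1 h2 => exact .cons h1 h2
  | unit_ty _ h1 => exact .unit_ty h1
  | pi_ty _ _ h1 h2 => exact .pi_ty h1 h2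
  | sigma_ty _ _ h1 h2 => exact .sigma_ty h1 h2
  | eq_ty _ _ _ h1 h2 h3 => exact .eq_ty h1 h2 h3
  | tp_ty _ h1 => exact .tp_ty h1
  | tm_ty _ h1 => exact .tm_ty h1
  | ty_refl _ h1 => exact .ty_refl h1
  | ty_symm _ h1 => exact .ty_symm h1
  | ty_trans _ _ h1 h2 => exact .ty_trans h1 h2
  | eq_congr _ _ _ h1 h2 h3 => exact .eq_congr h1 h2 h3
  | tm_congr _ h1 => exact .tm_congr h1
  | var _ hv ih => exact .var ih hv
  | conv _ _ h1 h2 => exact .conv h1 h2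
  | star _ h1 => exact .star h1
  | lam _ _ h1 h2 => exact .lam h1 h2
  | app _ _ h1 h2 => exact .app h1 h2
  | fst _ h1 => exact .fst h1
  | snd _ h1 => exact .snd h1
  | con c _ ih => exact .con c ih
  | tm_refl _ h1 => exact .tm_refl h1
  | tm_symm _ h1 => exact .tm_symm h1
  | tm_trans _ _ h1 h2 => exact .tm_trans h1 h2
  | eq_conv _ _ h1 h2 => exact .eq_conv h1 h2
  | app_congr _ _ h1 h2 => exact .app_congr h1 h2
  | fst_congr _ h1 => exact .fst_congr h1
  | snd_congr _ h1 => exact .snd_congr h1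
  | unit_eta _ h1 => exact .unit_eta h1
  | pi_eta _ h1 => exact .pi_eta h1
  | sigma_eta _ h1 => exact .sigma_eta h1
  | eq_eta _ h1 => exact .eq_eta h1
  | ite_tru _ _ _ h1 h2 h3 => exact .ite_tru h1 h2 h3
  | ite_fls _ _ _ h1 h2 h3 => exact .ite_fls h1 h2 h3
  | app_lam _ _ _ _ h1 h2 h3 h4 => exact .app_lam h1 h2 h3 h4
  | lam_app _ _ _ h1 h2 h3 => exact .lam_app h1 h2 h3

end LF

namespace LF

open Exp Jdg

/-! ### Sets of realized values

A type is interpreted as a set of pairs of (the code of) a closed expression and a value. Functions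
are encoded by `lamS` in such a way that the function with constant value `∅` is `∅`. -/

/-- A well-ordering of `Exp` sends distinct expressions to distinct ordinals. Only injectivity
matters, so no explicit coding of syntax is needed. -/
theorem exists_code : ∃ f : Exp → ZFSet.{0}, Function.Injective f :=
  ⟨fun a => (Ordinal.typein (α := Exp) WellOrderingRel a).toZFSet,
    fun _ _ h => Ordinal.typein_injective _ (Ordinal.toZFSet_injective h)⟩

/-- A set that represents an expression. -/
noncomputable def code : Exp → ZFSet.{0} := exists_code.choose

theorem code_injective : Function.Injective code := exists_code.choose_spec

/-- The set of all codes. -/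
noncomputable def codes : ZFSet.{0} := ZFSet.range code

/-- The pair of an expression and a value. -/
noncomputable def pt (x : Exp) (v : ZFSet.{0}) : ZFSet.{0} := ZFSet.pair (code x) v

theorem pt_inj {x x' v v'} : pt x v = pt x' v' ↔ x = x' ∧ v = v' := by
  rw [pt, pt, ZFSet.pair_inj, code_injective.eq_iff]

theorem mem_sUnion_sUnion_of_pair_mem {a b S : ZFSet.{0}} (h : ZFSet.pair a b ∈ S) :
    b ∈ (ZFSet.sUnion (ZFSet.sUnion S)) := by
  refine ZFSet.mem_sUnion.2 ⟨{a, b}, ZFSet.mem_sUnion.2 ⟨_, h, ?_⟩, ?_⟩ <;> simp [ZFSet.pair]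

/-- The set of the second components of the pairs in `S` (and possibly more). -/
noncomputable def vals (S : ZFSet.{0}) : ZFSet.{0} := ZFSet.sUnion (ZFSet.sUnion S)

theorem mem_vals {x v S} (h : pt x v ∈ S) : v ∈ vals S := mem_sUnion_sUnion_of_pair_mem h

/-- The set of pairs of an expression and an element of `U` with the property `P`. -/
noncomputable def ptSep (U : ZFSet.{0}) (P : Exp → ZFSet.{0} → Prop) : ZFSet.{0} :=
  ZFSet.sep (fun p => ∃ x v, p = pt x v ∧ P x v) (ZFSet.prod codes U)

theorem mem_ptSep {U P x v} : pt x v ∈ ptSep U P ↔ v ∈ U ∧ P x v := by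
  simp only [ptSep, ZFSet.mem_sep, pt_inj]
  constructor
  · rintro ⟨h, x, v, ⟨rfl, rfl⟩, hP⟩
    exact ⟨(ZFSet.pair_mem_prod.1 h).2, hP⟩
  · rintro ⟨h, hP⟩
    exact ⟨ZFSet.pair_mem_prod.2 ⟨ZFSet.mem_range_self _, h⟩, x, v, ⟨rfl, rfl⟩, hP⟩

theorem ptSep_congr {U U' : ZFSet.{0}} {P P' : Exp → ZFSet.{0} → Prop}
    (h : ∀ x v, v ∈ U ∧ P x v ↔ v ∈ U' ∧ P' x v) : ptSep U P = ptSep U' P' := by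
  have key : ∀ {U U' : ZFSet.{0}} {P P' : Exp → ZFSet.{0} → Prop},
      (∀ x v, v ∈ U ∧ P x v → v ∈ U' ∧ P' x v) → ∀ z ∈ ptSep U P, z ∈ ptSep U' P' := by
    intro U U' P P' h z hz
    obtain ⟨x, v, rfl, _⟩ := (ZFSet.mem_sep.1 hz).2
    exact mem_ptSep.2 (h x v (mem_ptSep.1 hz))
  ext z
  exact ⟨key (fun x v => (h x v).1) z, key (fun x v => (h x v).2) z⟩

/-- The part of `S` that consists of terms of type `T`, closed under judgmental equality. -/
noncomputable def cl (T : Exp) (S : ZFSet.{0}) : ZFSet.{0} :=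
  ptSep (vals S) fun x v => Deriv [] (hasTy x T) ∧ ∀ x', Deriv [] (eqTm x x' T) → pt x' v ∈ S

/-- The ambient set `vals S` imposes no condition: by reflexivity `x` itself is among the `x'`, so
`v` is a second component of `S`. -/
theorem mem_cl {T S x v} :
    pt x v ∈ cl T S ↔ Deriv [] (hasTy x T) ∧ ∀ x', Deriv [] (eqTm x x' T) → pt x' v ∈ S := by
  rw [cl, mem_ptSep, and_iff_right_of_imp]
  exact fun h => mem_vals (h.2 x (.tm_refl h.1))

theorem mem_of_mem_cl {T S x v} (h : pt x v ∈ cl T S) : pt x v ∈ S :=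
  (mem_cl.1 h).2 x (.tm_refl (mem_cl.1 h).1)

theorem hasTy_of_mem_cl {T S x v} (h : pt x v ∈ cl T S) : Deriv [] (hasTy x T) := (mem_cl.1 h).1

theorem mem_cl_of_eqTm {T S x x' v} (h : pt x v ∈ cl T S) (e : Deriv [] (eqTm x x' T)) :
    pt x' v ∈ cl T S :=
  mem_cl.2 ⟨e.right, fun x'' e' => (mem_cl.1 h).2 x'' (.tm_trans e e')⟩

theorem cl_congr {T T' S} (e : Deriv [] (eqTy T T')) : cl T S = cl T' S := by
  refine ptSep_congr fun x v => and_congr_right fun _ => and_congr ?_ ?_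
  · exact ⟨fun h => .conv h e, fun h => .conv h (.ty_symm e)⟩
  · exact forall_congr' fun x' =>
      ⟨fun h h' => h (.eq_conv h' (.ty_symm e)), fun h h' => h (.eq_conv h' e)⟩

/-- The value of the function `g` at the argument `x` with value `v`. -/
noncomputable def ap (g : ZFSet.{0}) (x : Exp) (v : ZFSet.{0}) : ZFSet.{0} :=
  ZFSet.sep (fun y => ZFSet.pair (pt x v) y ∈ g) (vals g)

theorem mem_ap {g x v y} : y ∈ ap g x v ↔ ZFSet.pair (pt x v) y ∈ g := by
  rw [ap, ZFSet.mem_sep, and_iff_right_of_imp]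
  exact mem_sUnion_sUnion_of_pair_mem

theorem ap_empty (x v) : ap ∅ x v = ∅ := by
  ext y
  simp [mem_ap]

/-- The function with domain `S` and values `F`. -/
noncomputable def lamS (S : ZFSet.{0}) (F : Exp → ZFSet.{0} → ZFSet.{0}) : ZFSet.{0} :=
  ZFSet.sep (fun z => ∃ x v y, z = ZFSet.pair (pt x v) y ∧ pt x v ∈ S ∧ y ∈ F x v)
    (ZFSet.prod S (ZFSet.iUnion fun q : Exp × vals S => F q.1 q.2))

theorem mem_lamS {S F z} :
    z ∈ lamS S F ↔ ∃ x v y, z = ZFSet.pair (pt x v) y ∧ pt x v ∈ S ∧ y ∈ F x v := by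
  rw [lamS, ZFSet.mem_sep, and_iff_right_of_imp]
  rintro ⟨x, v, y, rfl, h, hy⟩
  exact ZFSet.pair_mem_prod.2 ⟨h, ZFSet.mem_iUnion.2 ⟨(x, ⟨v, mem_vals h⟩), hy⟩⟩

theorem ap_lamS {S F x v} (h : pt x v ∈ S) : ap (lamS S F) x v = F x v := by
  ext y
  rw [mem_ap, mem_lamS]
  constructor
  · rintro ⟨x', v', y', e, _, hy⟩
    obtain ⟨e', rfl⟩ := ZFSet.pair_inj.1 e
    obtain ⟨rfl, rfl⟩ := pt_inj.1 e'
    exact hy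
  · exact fun hy => ⟨x, v, y, rfl, h, hy⟩

theorem lamS_congr {S F F'} (h : ∀ x v, pt x v ∈ S → F x v = F' x v) : lamS S F = lamS S F' := by
  ext z
  simp only [mem_lamS]
  refine exists_congr fun x => exists_congr fun v => exists_congr fun y =>
    and_congr_right fun _ => and_congr_right fun hx => ?_
  rw [h x v hx]

/-- All elements of `g` belong to its values at elements of `S`. -/
def SupportedOn (g S : ZFSet.{0}) : Prop :=
  ∀ z ∈ g, ∃ x v y, z = ZFSet.pair (pt x v) y ∧ pt x v ∈ S

theorem supportedOn_lamS (S F) : SupportedOn (lamS S F) S := fun _ hz =>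
  let ⟨x, v, y, e, h, _⟩ := mem_lamS.1 hz
  ⟨x, v, y, e, h⟩

theorem supportedOn_empty (S) : SupportedOn ∅ S := fun z hz => (ZFSet.notMem_empty z hz).elim

/-- The semantic η-rule. Support is essential, as `ap` on arguments in `S` sees no other elements of
`g`. -/
theorem lamS_ap {g S} (h : SupportedOn g S) : lamS S (ap g) = g := by
  ext z
  rw [mem_lamS]
  constructor
  · rintro ⟨x, v, y, rfl, _, hy⟩
    exact mem_ap.1 hy
  · intro hz
    obtain ⟨x, v, y, rfl, hx⟩ := h z hz
    exact ⟨x, v, y, rfl, hx, mem_ap.2 hz⟩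

/-- The dependent function space: `E` is the equality of arguments that functions have to
respect. -/
noncomputable def piS (S : ZFSet.{0}) (T : Exp → ZFSet.{0} → ZFSet.{0}) (E : Exp → Exp → Prop) :
    ZFSet.{0} :=
  ptSep (ZFSet.powerset (lamS S fun x v => ZFSet.sUnion (vals (T x v)))) fun f g =>
    SupportedOn g S ∧ (∀ x v, pt x v ∈ S → pt (app f x) (ap g x v) ∈ T x v) ∧
      ∀ x x' v, pt x v ∈ S → E x x' → ap g x v = ap g x' v

/-- The powerset only bounds the comprehension: a supported `g` with values in `T` already lies
inside it. -/
theorem mem_piS {S T E f g} : pt f g ∈ piS S T E ↔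
    SupportedOn g S ∧ (∀ x v, pt x v ∈ S → pt (app f x) (ap g x v) ∈ T x v) ∧
      ∀ x x' v, pt x v ∈ S → E x x' → ap g x v = ap g x' v := by
  rw [piS, mem_ptSep, and_iff_right_of_imp]
  rintro ⟨hg, hT, _⟩
  refine ZFSet.mem_powerset.2 fun z hz => ?_
  obtain ⟨x, v, y, rfl, hx⟩ := hg z hz
  exact mem_lamS.2 ⟨x, v, y, rfl, hx, ZFSet.mem_sUnion.2 ⟨_, mem_vals (hT x v hx), mem_ap.2 hz⟩⟩

theorem piS_congr {S T T' E E'} (h : ∀ x v, pt x v ∈ S → T x v = T' x v)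
    (hE : ∀ x x', E x x' ↔ E' x x') : piS S T E = piS S T' E' := by
  refine ptSep_congr fun f g => ?_
  have := @mem_piS S T E f g
  rw [piS, mem_ptSep] at this
  rw [this]
  have := @mem_piS S T' E' f g
  rw [piS, mem_ptSep] at this
  rw [this]
  refine and_congr_right fun _ => and_congr ?_ ?_
  · refine forall_congr' fun x => forall_congr' fun v => forall_congr' fun hx => ?_
    rw [h x v hx]
  · simp only [hE]

/-- The dependent sum. -/
noncomputable def sigmaS (S : ZFSet.{0}) (T : Exp → ZFSet.{0} → ZFSet.{0}) : ZFSet.{0} :=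
  ptSep (ZFSet.prod (vals S) (ZFSet.iUnion fun q : Exp × vals S => vals (T q.1 q.2))) fun p z =>
    ∃ u w, z = ZFSet.pair u w ∧ pt (fst p) u ∈ S ∧ pt (snd p) w ∈ T (fst p) u

theorem mem_sigmaS {S T p z} : pt p z ∈ sigmaS S T ↔
    ∃ u w, z = ZFSet.pair u w ∧ pt (fst p) u ∈ S ∧ pt (snd p) w ∈ T (fst p) u := by
  rw [sigmaS, mem_ptSep, and_iff_right_of_imp]
  rintro ⟨u, w, rfl, hu, hw⟩
  exact ZFSet.pair_mem_prod.2 ⟨mem_vals hu,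
    ZFSet.mem_iUnion.2 ⟨(fst p, ⟨u, mem_vals hu⟩), mem_vals hw⟩⟩

theorem sigmaS_congr {S T T'} (h : ∀ x v, pt x v ∈ S → T x v = T' x v) :
    sigmaS S T = sigmaS S T' := by
  refine ptSep_congr fun p z => ?_
  have := @mem_sigmaS S T p z
  rw [sigmaS, mem_ptSep] at this
  rw [this]
  have := @mem_sigmaS S T' p z
  rw [sigmaS, mem_ptSep] at this
  rw [this]
  refine exists_congr fun u => exists_congr fun w => and_congr_right fun _ =>
    and_congr_right fun hu => ?_
  rw [h _ u hu]

/-- The first component of a pair. -/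
noncomputable def pfst (z : ZFSet.{0}) : ZFSet.{0} :=
  Classical.epsilon fun u => ∃ w, z = ZFSet.pair u w

/-- The second component of a pair. -/
noncomputable def psnd (z : ZFSet.{0}) : ZFSet.{0} :=
  Classical.epsilon fun w => ∃ u, z = ZFSet.pair u w

theorem pfst_pair (u w : ZFSet.{0}) : pfst (ZFSet.pair u w) = u :=
  let ⟨_, h⟩ := Classical.epsilon_spec (p := fun u' => ∃ w', ZFSet.pair u w = ZFSet.pair u' w')
    ⟨u, w, rfl⟩
  (ZFSet.pair_inj.1 h).1.symm

theorem psnd_pair (u w : ZFSet.{0}) : psnd (ZFSet.pair u w) = w :=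
  let ⟨_, h⟩ := Classical.epsilon_spec (p := fun w' => ∃ u', ZFSet.pair u w = ZFSet.pair u' w')
    ⟨w, u, rfl⟩
  (ZFSet.pair_inj.1 h).2.symm

/-- The values of `tp`: sets of terms of the given type, closed under judgmental equality. -/
noncomputable def tpS : ZFSet.{0} :=
  ptSep (ZFSet.powerset codes) fun a P =>
    (∀ x, code x ∈ P → Deriv [] (hasTy x (tm a))) ∧
      ∀ x x', code x ∈ P → Deriv [] (eqTm x x' (tm a)) → code x' ∈ P

/-- The values of `tm`: the terms in the given set, with trivial values. -/
noncomputable def tmS (P : ZFSet.{0}) : ZFSet.{0} := ptSep {∅} fun x _ => code x ∈ P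

theorem mem_tmS {P x v} : pt x v ∈ tmS P ↔ v = ∅ ∧ code x ∈ P := by
  rw [tmS, mem_ptSep, ZFSet.mem_singleton]

/-- Replacing the code `a` by an equal one changes the typings and equations involved only by
conversion, so the stability clause of `cl` is automatic. -/
theorem mem_cl_tpS {a P} : pt a P ∈ cl tp tpS ↔ Deriv [] (hasTy a tp) ∧ P ⊆ codes ∧
    (∀ x, code x ∈ P → Deriv [] (hasTy x (tm a))) ∧
      ∀ x x', code x ∈ P → Deriv [] (eqTm x x' (tm a)) → code x' ∈ P := by
  simp only [mem_cl, tpS, mem_ptSep, ZFSet.mem_powerset]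
  refine and_congr_right fun ha => ⟨fun h => h a (.tm_refl ha), fun h a' e => ⟨h.1, ?_, ?_⟩⟩
  · exact fun x hx => .conv (h.2.1 x hx) (.tm_congr e)
  · exact fun x x' hx e' => h.2.2 x x' hx (.eq_conv e' (.ty_symm (.tm_congr e)))

theorem mem_cl_tmS {a P x v} (h : pt a P ∈ cl tp tpS) :
    pt x v ∈ cl (tm a) (tmS P) ↔ v = ∅ ∧ code x ∈ P := by
  obtain ⟨_, _, h₁, h₂⟩ := mem_cl_tpS.1 h
  rw [mem_cl]
  constructor
  · exact fun h => mem_tmS.1 (h.2 x (.tm_refl h.1))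
  · exact fun h => ⟨h₁ x h.2, fun x' e => mem_tmS.2 ⟨h.1, h₂ x x' h.2 e⟩⟩

/-- The set of terms of the object dependent product. -/
noncomputable def piCode (A : Exp) (P : ZFSet.{0}) (B : Exp) (Q : ZFSet.{0}) : ZFSet.{0} :=
  ZFSet.sep (fun z => ∃ e, z = code e ∧ Deriv [] (hasTy e (tm (Pi A B))) ∧
    ∀ x, code x ∈ P → code (app (App A B e) x) ∈ ap Q x ∅) codes

theorem mem_piCode {A P B Q e} : code e ∈ piCode A P B Q ↔ Deriv [] (hasTy e (tm (Pi A B))) ∧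
    ∀ x, code x ∈ P → code (app (App A B e) x) ∈ ap Q x ∅ := by
  simp only [piCode, ZFSet.mem_sep, code_injective.eq_iff]
  constructor
  · rintro ⟨_, _, rfl, h⟩
    exact h
  · exact fun h => ⟨ZFSet.mem_range_self _, e, rfl, h⟩

/-- The set of booleans. -/
noncomputable def boolCode : ZFSet.{0} :=
  ZFSet.sep (fun z => ∃ x, z = code x ∧ (Deriv [] (eqTm x tru (tm Exp.bool)) ∨
    Deriv [] (eqTm x fls (tm Exp.bool)))) codes

theorem mem_boolCode {x} : code x ∈ boolCode ↔
    Deriv [] (eqTm x tru (tm Exp.bool)) ∨ Deriv [] (eqTm x fls (tm Exp.bool)) := by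
  simp only [boolCode, ZFSet.mem_sep, code_injective.eq_iff]
  constructor
  · rintro ⟨_, _, rfl, h⟩
    exact h
  · exact fun h => ⟨ZFSet.mem_range_self _, x, rfl, h⟩

/-- The values of type families `tm A → tp`. -/
noncomputable def famS (A : Exp) (P : ZFSet.{0}) : ZFSet.{0} :=
  piS (cl (tm A) (tmS P)) (fun _ _ => cl tp tpS) fun x x' => Deriv [] (eqTm x x' (tm A))

/-- The values of the constants. -/
noncomputable def Con.interp : Con → ZFSet.{0}
  | .bool => boolCode
  | .pi => lamS (cl tp tpS) fun A P =>
      lamS (cl (.pi (tm A) tp) (famS A P)) fun B Q => piCode A P B Q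
  | _ => ∅

/-- The value of an expression at a closed substitution `γ` with values `ρ`. -/
noncomputable def Exp.interp : Exp → (ℕ → Exp) → (ℕ → ZFSet.{0}) → ZFSet.{0}
  | var n, _, ρ => ρ n
  | unit, _, _ => ptSep {∅} fun _ _ => True
  | star, _, _ => ∅
  | pi A B, γ, ρ => piS (cl (A.subst γ) (A.interp γ ρ))
      (fun x v => cl (B.subst (scons x γ)) (B.interp (scons x γ) (scons v ρ)))
      fun x x' => Deriv [] (eqTm x x' (A.subst γ))
  | lam A a, γ, ρ => lamS (cl (A.subst γ) (A.interp γ ρ))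
      fun x v => a.interp (scons x γ) (scons v ρ)
  | app f a, γ, ρ => ap (f.interp γ ρ) (a.subst γ) (a.interp γ ρ)
  | sigma A B, γ, ρ => sigmaS (cl (A.subst γ) (A.interp γ ρ))
      fun x v => cl (B.subst (scons x γ)) (B.interp (scons x γ) (scons v ρ))
  | pair _ a b, γ, ρ => ZFSet.pair (a.interp γ ρ) (b.interp γ ρ)
  | fst p, γ, ρ => pfst (p.interp γ ρ)
  | snd p, γ, ρ => psnd (p.interp γ ρ)
  | eq _ a b, γ, ρ => ptSep {∅} fun _ _ => a.interp γ ρ = b.interp γ ρ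
  | refl _, _, _ => ∅
  | tp, _, _ => tpS
  | tm A, γ, ρ => tmS (A.interp γ ρ)
  | con c, _, _ => c.interp

theorem scons_comp_upr {α : Type*} (a : α) (s : ℕ → α) (ξ : ℕ → ℕ) :
    scons a s ∘ upr ξ = scons a (s ∘ ξ) := by
  funext n
  cases n <;> rfl

namespace Exp

theorem interp_rename (a : Exp) (ξ : ℕ → ℕ) (γ : ℕ → Exp) (ρ : ℕ → ZFSet.{0}) :
    (a.rename ξ).interp γ ρ = a.interp (γ ∘ ξ) (ρ ∘ ξ) := by
  induction a generalizing ξ γ ρ <;>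
    simp_all only [rename, interp, rename_subst, scons_comp_upr, Function.comp_apply]

theorem interp_wk (a x : Exp) (γ : ℕ → Exp) (v : ZFSet.{0}) (ρ : ℕ → ZFSet.{0}) :
    a.wk.interp (scons x γ) (scons v ρ) = a.interp γ ρ :=
  interp_rename a Nat.succ _ _

theorem up_subst_scons (σ γ : ℕ → Exp) (x : Exp) :
    (fun n => (up σ n).subst (scons x γ)) = scons x fun n => (σ n).subst γ := by
  funext n
  cases n with
  | zero => rfl
  | succ n => exact wk_subst_scons _ _ _

theorem up_interp_scons (σ γ : ℕ → Exp) (ρ : ℕ → ZFSet.{0}) (x : Exp) (v : ZFSet.{0}) :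
    (fun n => (up σ n).interp (scons x γ) (scons v ρ)) = scons v fun n => (σ n).interp γ ρ := by
  funext n
  cases n with
  | zero => rfl
  | succ n => exact interp_wk _ _ _ _ _

/-- Expressions and values are substituted together, because a function value takes the expression
of its argument as well as the argument's value. -/
theorem interp_subst (a : Exp) (σ γ : ℕ → Exp) (ρ : ℕ → ZFSet.{0}) :
    (a.subst σ).interp γ ρ = a.interp (fun n => (σ n).subst γ) fun n => (σ n).interp γ ρ := by
  induction a generalizing σ γ ρ <;>
    simp_all only [subst, interp, subst_subst, up_subst_scons, up_interp_scons]

theorem interp_inst (B a : Exp) (γ : ℕ → Exp) (ρ : ℕ → ZFSet.{0}) :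
    (B.inst a).interp γ ρ = B.interp (scons (a.subst γ) γ) (scons (a.interp γ ρ) ρ) := by
  rw [inst_eq, interp_subst]
  congr 1 <;> funext n <;> cases n <;> rfl

/-- The realized values of a type. -/
noncomputable def el (A : Exp) (γ : ℕ → Exp) (ρ : ℕ → ZFSet.{0}) : ZFSet.{0} :=
  cl (A.subst γ) (A.interp γ ρ)

theorem el_inst (B a : Exp) (γ : ℕ → Exp) (ρ : ℕ → ZFSet.{0}) :
    (B.inst a).el γ ρ = B.el (scons (a.subst γ) γ) (scons (a.interp γ ρ) ρ) := by
  rw [el, el, interp_inst, inst_subst]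

theorem el_wk (A x : Exp) (γ : ℕ → Exp) (v : ZFSet.{0}) (ρ : ℕ → ZFSet.{0}) :
    A.wk.el (scons x γ) (scons v ρ) = A.el γ ρ := by
  rw [el, el, interp_wk, wk_subst_scons]

end Exp

end LF

namespace LF

open Exp Jdg

/-! ### Semantic validity -/

theorem mem_el_of_eqTm {A γ ρ x x' v} (h : pt x v ∈ el A γ ρ)
    (e : Deriv [] (eqTm x x' (A.subst γ))) : pt x' v ∈ el A γ ρ :=
  mem_cl_of_eqTm h e

theorem hasTy_of_mem_el {A γ ρ x v} (h : pt x v ∈ el A γ ρ) : Deriv [] (hasTy x (A.subst γ)) :=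
  hasTy_of_mem_cl h

theorem mem_el_pi {A B γ ρ f g} (h : pt f g ∈ el (.pi A B) γ ρ) :
    SupportedOn g (el A γ ρ) ∧
      (∀ x v, pt x v ∈ el A γ ρ → pt (.app f x) (ap g x v) ∈ el B (scons x γ) (scons v ρ)) ∧
      ∀ x x' v, pt x v ∈ el A γ ρ → Deriv [] (eqTm x x' (A.subst γ)) → ap g x v = ap g x' v :=
  mem_piS.1 (mem_of_mem_cl h)

theorem mem_el_pi_intro {A B γ ρ f g} (hf : Deriv [] (hasTy f ((Exp.pi A B).subst γ)))
    (hg : SupportedOn g (el A γ ρ))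
    (h : ∀ x v, pt x v ∈ el A γ ρ → pt (.app f x) (ap g x v) ∈ el B (scons x γ) (scons v ρ))
    (h' : ∀ x x' v, pt x v ∈ el A γ ρ → Deriv [] (eqTm x x' (A.subst γ)) →
      ap g x v = ap g x' v) : pt f g ∈ el (.pi A B) γ ρ := by
  refine mem_cl.2 ⟨hf, fun f' e => mem_piS.2 ⟨hg, fun x v hx => ?_, h'⟩⟩
  refine mem_el_of_eqTm (h x v hx) ?_
  rw [← subst_up_inst]
  exact .app_congr e (.tm_refl (hasTy_of_mem_el hx))

/-- The empty set is at once the trivial value and the function constantly equal to it. This lets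
`ite`, `lam` and `app`, whose results are object-level terms, be checked one argument at a time. -/
theorem mem_el_pi_empty {A B γ ρ f} (hf : Deriv [] (hasTy f ((Exp.pi A B).subst γ)))
    (h : ∀ x v, pt x v ∈ el A γ ρ → Deriv [] (hasTy (.app f x) (B.subst (scons x γ))) →
      pt (.app f x) ∅ ∈ el B (scons x γ) (scons v ρ)) : pt f ∅ ∈ el (.pi A B) γ ρ := by
  refine mem_el_pi_intro hf (supportedOn_empty _) (fun x v hx => ?_) fun x x' v _ _ => ?_
  · rw [ap_empty]
    refine h x v hx ?_
    rw [← subst_up_inst]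
    exact .app hf (hasTy_of_mem_el hx)
  · rw [ap_empty, ap_empty]

theorem mem_el_sigma {A B γ ρ p z} (h : pt p z ∈ el (.sigma A B) γ ρ) :
    ∃ u w, z = ZFSet.pair u w ∧ pt (fst p) u ∈ el A γ ρ ∧
      pt (snd p) w ∈ el B (scons (fst p) γ) (scons u ρ) :=
  mem_sigmaS.1 (mem_of_mem_cl h)

theorem eq_of_mem_el_eq {A a b γ ρ p z} (h : pt p z ∈ el (.eq A a b) γ ρ) :
    z = ∅ ∧ a.interp γ ρ = b.interp γ ρ := by
  have := mem_ptSep.1 (mem_of_mem_cl h)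
  exact ⟨ZFSet.mem_singleton.1 this.1, this.2⟩

theorem eq_empty_of_mem_el_tm {A γ ρ x v} (h : pt x v ∈ el (.tm A) γ ρ) : v = ∅ :=
  (mem_tmS.1 (mem_of_mem_cl h)).1

theorem eq_empty_of_mem_el_unit {γ ρ x v} (h : pt x v ∈ el .unit γ ρ) : v = ∅ :=
  ZFSet.mem_singleton.1 (mem_ptSep.1 (mem_of_mem_cl h)).1

/-- `γ` and `γ'` are equal closed substitutions for `Γ`, both realized by the values `ρ`. -/
inductive Env : List Exp → (ℕ → Exp) → (ℕ → Exp) → (ℕ → ZFSet.{0}) → Prop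
  | nil (γ γ' ρ) : Env [] γ γ' ρ
  | cons {Γ γ γ' ρ A x x' v} : Env Γ γ γ' ρ → pt x v ∈ el A γ ρ → pt x' v ∈ el A γ' ρ →
      Deriv [] (eqTm x x' (A.subst γ)) → Deriv [] (eqTy (A.subst γ) (A.subst γ')) →
      Env (A :: Γ) (scons x γ) (scons x' γ') (scons v ρ)

namespace Env

variable {Γ : List Exp} {γ γ' : ℕ → Exp} {ρ : ℕ → ZFSet.{0}}

theorem symm (h : Env Γ γ γ' ρ) : Env Γ γ' γ ρ := by
  induction h with
  | nil => exact .nil _ _ _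
  | cons _ hx hx' e eA ih => exact .cons ih hx' hx (.eq_conv (.tm_symm e) eA) (.ty_symm eA)

theorem left (h : Env Γ γ γ' ρ) : Env Γ γ γ ρ := by
  induction h with
  | nil => exact .nil _ _ _
  | cons _ hx _ e eA ih =>
    exact .cons ih hx hx (.tm_trans e (.tm_symm e)) (.ty_trans eA (.ty_symm eA))

theorem right (h : Env Γ γ γ' ρ) : Env Γ γ' γ' ρ := h.symm.left

theorem sub (h : Env Γ γ γ' ρ) : Sub [] γ Γ := by
  induction h with
  | nil => exact fun _ _ h => nomatch h
  | cons _ hx _ _ _ ih => exact ih.scons (hasTy_of_mem_el hx)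

theorem subEq (h : Env Γ γ γ' ρ) : SubEq [] γ γ' Γ := by
  induction h with
  | nil => exact ⟨fun _ _ h => (nomatch h), fun _ _ h => (nomatch h), fun _ _ h => nomatch h⟩
  | cons _ hx hx' e _ ih => exact ih.scons (hasTy_of_mem_el hx) (hasTy_of_mem_el hx') e

theorem subst (h : Env Γ γ γ' ρ) {J} (hJ : Deriv Γ J) : Deriv [] (J.subst γ) :=
  hJ.subst .nil h.sub

theorem eqTy (h : Env Γ γ γ' ρ) {A} (hA : Deriv Γ (isTy A)) :
    Deriv [] (eqTy (A.subst γ) (A.subst γ')) :=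
  hA.substEq .nil h.subEq

theorem eqTm (h : Env Γ γ γ' ρ) {a A} (ha : Deriv Γ (hasTy a A)) :
    Deriv [] (eqTm (a.subst γ) (a.subst γ') (A.subst γ)) :=
  ha.substEq .nil h.subEq

theorem mem_of_hasVar (h : Env Γ γ γ' ρ) {n A} (hn : HasVar Γ n A) : pt (γ n) (ρ n) ∈ el A γ ρ := by
  induction h generalizing n A with
  | nil => cases hn
  | cons _ hx _ _ _ ih =>
    cases hn with
    | zero =>
      rw [el_wk]
      exact hx
    | succ _ hn =>
      rw [el_wk]
      exact ih hn

end Env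

/-- Semantic validity of a type: its interpretation respects equality of substitutions. -/
def SemTy (Γ : List Exp) (A : Exp) : Prop :=
  ∀ ⦃γ γ' ρ⦄, Env Γ γ γ' ρ → A.interp γ ρ = A.interp γ' ρ

/-- Semantic validity of a term: it is realized by its interpretation, which respects equality of
substitutions. -/
def SemTm (Γ : List Exp) (a A : Exp) : Prop :=
  ∀ ⦃γ γ' ρ⦄, Env Γ γ γ' ρ →
    pt (a.subst γ) (a.interp γ ρ) ∈ el A γ ρ ∧ a.interp γ ρ = a.interp γ' ρ

/-- Two expressions have the same interpretation. -/
def SameInterp (Γ : List Exp) (a b : Exp) : Prop :=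
  ∀ ⦃γ ρ⦄, Env Γ γ γ ρ → a.interp γ ρ = b.interp γ ρ

/-- Semantic validity of a judgment. -/
def Jdg.Sem (Γ : List Exp) : Jdg → Prop
  | ctx => True
  | isTy A => SemTy Γ A
  | eqTy A B => SemTy Γ A ∧ SemTy Γ B ∧ SameInterp Γ A B
  | hasTy a A => SemTm Γ a A
  | eqTm a b A => SemTm Γ a A ∧ SemTm Γ b A ∧ SameInterp Γ a b

section

variable {Γ : List Exp} {A A' B a b f p : Exp} {γ γ' : ℕ → Exp} {ρ : ℕ → ZFSet.{0}}

theorem SemTy.el_eq (h : SemTy Γ A) (hA : Deriv Γ (isTy A)) (hγ : Env Γ γ γ' ρ) :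
    el A γ ρ = el A γ' ρ := by
  rw [el, el, h hγ, cl_congr (hγ.eqTy hA)]

theorem SameInterp.el_eq (h : SameInterp Γ A B) (e : Deriv Γ (eqTy A B)) (hγ : Env Γ γ γ ρ) :
    el A γ ρ = el B γ ρ := by
  rw [el, el, h hγ, cl_congr (hγ.subst e)]

theorem SameInterp.symm (h : SameInterp Γ a b) : SameInterp Γ b a := fun _ _ hγ => (h hγ).symm

theorem SameInterp.semTy (h : SameInterp Γ A B) (hA : SemTy Γ A) : SemTy Γ B := fun γ γ' ρ hγ => by
  rw [← h hγ.left, hA hγ, h hγ.right]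

theorem SameInterp.eqTy (h : SameInterp Γ A B) (hA : SemTy Γ A) : (eqTy A B).Sem Γ :=
  ⟨hA, h.semTy hA, h⟩

/-- Realized values are stable under judgmental equality, so each equation needs a direct validity
proof for one side only. -/
theorem SameInterp.semTm (h : SameInterp Γ a b) (ha : SemTm Γ a A) (e : Deriv Γ (eqTm a b A)) :
    SemTm Γ b A := fun γ γ' ρ hγ => by
  rw [← h hγ.left, ← h hγ.right]
  exact ⟨mem_el_of_eqTm (ha hγ).1 (hγ.subst e), (ha hγ).2⟩

theorem SameInterp.eqTm (h : SameInterp Γ a b) (ha : SemTm Γ a A) (e : Deriv Γ (Jdg.eqTm a b A)) :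
    (Jdg.eqTm a b A).Sem Γ :=
  ⟨ha, h.semTm ha e, h⟩

theorem SameInterp.eqTm' (h : SameInterp Γ a b) (hb : SemTm Γ b A) (e : Deriv Γ (Jdg.eqTm a b A)) :
    (Jdg.eqTm a b A).Sem Γ :=
  ⟨h.symm.semTm hb (.tm_symm e), hb, h⟩

theorem Env.ext (hγ : Env Γ γ γ' ρ) (hA : Deriv Γ (isTy A)) (h : SemTy Γ A) {x x' v}
    (hx : pt x v ∈ el A γ ρ) (e : Deriv [] (Jdg.eqTm x x' (A.subst γ))) :
    Env (A :: Γ) (scons x γ) (scons x' γ') (scons v ρ) :=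
  .cons hγ hx (h.el_eq hA hγ ▸ mem_el_of_eqTm hx e) e (hγ.eqTy hA)

theorem Env.ext_self (hγ : Env Γ γ γ' ρ) (hA : Deriv Γ (isTy A)) (h : SemTy Γ A) {x v}
    (hx : pt x v ∈ el A γ ρ) : Env (A :: Γ) (scons x γ) (scons x γ') (scons v ρ) :=
  hγ.ext hA h hx (.tm_refl (hasTy_of_mem_el hx))

/-! ### Semantic validity of the rules -/

theorem SameInterp.pi {B' : Exp} (hA : Deriv Γ (isTy A)) (eA : Deriv Γ (Jdg.eqTy A A'))
    (eB : Deriv (A :: Γ) (Jdg.eqTy B B')) (iA : SemTy Γ A) (iA' : SameInterp Γ A A')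
    (iB : SameInterp (A :: Γ) B B') : SameInterp Γ (.pi A B) (.pi A' B') := fun γ ρ hγ => by
  have h := iA'.el_eq eA hγ
  simp only [el] at h
  simp only [interp]
  rw [← h]
  refine piS_congr (fun x v hx => iB.el_eq eB (hγ.ext_self hA iA hx)) fun x x' => ?_
  exact ⟨fun h => .eq_conv h (hγ.subst eA), fun h => .eq_conv h (hγ.subst (.ty_symm eA))⟩

theorem SameInterp.sigma {B' : Exp} (hA : Deriv Γ (isTy A)) (eA : Deriv Γ (Jdg.eqTy A A'))
    (eB : Deriv (A :: Γ) (Jdg.eqTy B B')) (iA : SemTy Γ A) (iA' : SameInterp Γ A A')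
    (iB : SameInterp (A :: Γ) B B') : SameInterp Γ (.sigma A B) (.sigma A' B') := fun γ ρ hγ => by
  have h := iA'.el_eq eA hγ
  simp only [el] at h
  simp only [interp]
  rw [← h]
  exact sigmaS_congr fun x v hx => iB.el_eq eB (hγ.ext_self hA iA hx)

theorem SemTy.pi (hA : Deriv Γ (isTy A)) (hB : Deriv (A :: Γ) (isTy B)) (iA : SemTy Γ A)
    (iB : SemTy (A :: Γ) B) : SemTy Γ (.pi A B) := fun γ γ' ρ hγ => by
  have h := iA.el_eq hA hγ
  simp only [el] at h
  simp only [interp]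
  rw [← h]
  refine piS_congr (fun x v hx => iB.el_eq hB (hγ.ext_self hA iA hx)) fun x x' => ?_
  exact ⟨fun h => .eq_conv h (hγ.eqTy hA), fun h => .eq_conv h (.ty_symm (hγ.eqTy hA))⟩

theorem SemTy.sigma (hA : Deriv Γ (isTy A)) (hB : Deriv (A :: Γ) (isTy B)) (iA : SemTy Γ A)
    (iB : SemTy (A :: Γ) B) : SemTy Γ (.sigma A B) := fun γ γ' ρ hγ => by
  have h := iA.el_eq hA hγ
  simp only [el] at h
  simp only [interp]
  rw [← h]
  exact sigmaS_congr fun x v hx => iB.el_eq hB (hγ.ext_self hA iA hx)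

theorem SemTm.conv (ha : SemTm Γ a A) (e : Deriv Γ (Jdg.eqTy A B)) (h : SameInterp Γ A B) :
    SemTm Γ a B := fun _ _ _ hγ =>
  ⟨h.el_eq e hγ.left ▸ (ha hγ).1, (ha hγ).2⟩

theorem interp_lam (A b : Exp) (γ : ℕ → Exp) (ρ : ℕ → ZFSet.{0}) :
    (Exp.lam A b).interp γ ρ = lamS (el A γ ρ) fun x v => b.interp (scons x γ) (scons v ρ) := rfl

/-- Judgmental β, read backwards, carries realizability from the instantiated body to the
application. Respect for equal arguments is validity of the body at a pair of environments differing
in the last entry. -/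
theorem SemTm.lam (hA : Deriv Γ (isTy A)) (hb : Deriv (A :: Γ) (hasTy b B)) (iA : SemTy Γ A)
    (ib : SemTm (A :: Γ) b B) : SemTm Γ (.lam A b) (.pi A B) := fun γ γ' ρ hγ => by
  have hA' := hγ.subst hA
  have hb' : Deriv (A.subst γ :: []) ((Jdg.hasTy b B).subst (up γ)) :=
    hb.subst (.cons .nil hA') (hγ.sub.up hA')
  constructor
  · refine mem_el_pi_intro (.lam hA' hb') (supportedOn_lamS _ _) (fun x v hx => ?_)
      fun x x' v hx e => ?_
    · have e := Deriv.pi_beta hA' hb' (hasTy_of_mem_el hx)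
      rw [subst_up_inst, subst_up_inst] at e
      rw [interp_lam, ap_lamS hx]
      exact mem_el_of_eqTm (ib (hγ.left.ext_self hA iA hx)).1 (.tm_symm e)
    · rw [interp_lam, ap_lamS hx, ap_lamS (mem_el_of_eqTm hx e)]
      exact (ib (hγ.left.ext hA iA hx e)).2
  · rw [interp_lam, interp_lam, ← iA.el_eq hA hγ]
    exact lamS_congr fun x v hx => (ib (hγ.ext_self hA iA hx)).2

theorem SemTm.app_mem (iF : SemTm Γ f (.pi A B)) (ia : SemTm Γ a A) (hγ : Env Γ γ γ' ρ) :
    pt ((Exp.app f a).subst γ) ((Exp.app f a).interp γ ρ) ∈ el (B.inst a) γ ρ := by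
  rw [el_inst]
  exact (mem_el_pi (iF hγ).1).2.1 _ _ (ia hγ).1

theorem SemTm.ap_eq (iF : SemTm Γ f (.pi A B)) (ia : SemTm Γ a A) (hγ : Env Γ γ γ' ρ) {x : Exp}
    (e : Deriv [] (eqTm (a.subst γ) x (A.subst γ))) :
    ap (f.interp γ ρ) (a.subst γ) (a.interp γ ρ) = ap (f.interp γ ρ) x (a.interp γ ρ) :=
  (mem_el_pi (iF hγ).1).2.2 _ _ _ (ia hγ).1 e

theorem SemTm.app (ha : Deriv Γ (hasTy a A)) (iF : SemTm Γ f (.pi A B)) (ia : SemTm Γ a A) :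
    SemTm Γ (.app f a) (B.inst a) := fun γ γ' ρ hγ => by
  refine ⟨iF.app_mem ia hγ, ?_⟩
  simp only [interp]
  rw [iF.ap_eq ia hγ (hγ.eqTm ha), (iF hγ).2, (ia hγ).2]

theorem SemTm.pair (hA : Deriv Γ (isTy A)) (hB : Deriv (A :: Γ) (isTy B))
    (ha : Deriv Γ (hasTy a A)) (hb : Deriv Γ (hasTy b (B.inst a))) (iB : SemTy (A :: Γ) B)
    (ia : SemTm Γ a A) (ib : SemTm Γ b (B.inst a)) : SemTm Γ (.pair B a b) (.sigma A B) :=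
    fun γ γ' ρ hγ => by
  constructor
  · have hA' := hγ.subst hA
    have hB' : Deriv (A.subst γ :: []) ((Jdg.isTy B).subst (up γ)) :=
      hB.subst (.cons .nil hA') (hγ.sub.up hA')
    have ha' := hγ.subst ha
    have hb' : Deriv [] (hasTy (b.subst γ) ((B.subst (up γ)).inst (a.subst γ))) := by
      rw [← inst_subst_up]
      exact hγ.subst hb
    have hp := Deriv.pair hA' hB' ha' hb'
    -- Stability asks about every `p'` equal to the pair; its projections equal `a` and `b` by β and
    -- congruence.
    refine mem_cl.2 ⟨hp, fun p' e => mem_sigmaS.2 ⟨_, _, rfl, ?_⟩⟩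
    have e₁ := Deriv.fst_beta hA' hB' ha' hb'
    have e₁' : Deriv [] (eqTm (a.subst γ) (fst p') (A.subst γ)) :=
      .tm_trans (.tm_symm e₁) (.fst_congr e)
    have e₂ : Deriv [] (eqTm (b.subst γ) (snd p') ((B.subst (up γ)).inst (a.subst γ))) :=
      .tm_trans (.tm_symm (.snd_beta hA' hB' ha' hb'))
        (.eq_conv (.snd_congr e) (hB'.inst_congr (.fst hp) ha' e₁))
    rw [subst_up_inst] at e₂
    have hb := (ib hγ).1
    rw [el_inst] at hb
    -- The second component is required over `fst p'` instead of `a`: an equal expression with the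
    -- same value, so validity of `B` identifies the two sets.
    have henv : Env (A :: Γ) (scons (a.subst γ) γ) (scons (fst p') γ) (scons (a.interp γ ρ) ρ) :=
      .cons hγ.left (ia hγ).1 (mem_el_of_eqTm (ia hγ).1 e₁') e₁' (.ty_refl hA')
    refine ⟨mem_el_of_eqTm (ia hγ).1 e₁', ?_⟩
    have h := mem_el_of_eqTm hb e₂
    rw [iB.el_eq hB henv] at h
    exact h
  · simp only [interp]
    rw [(ia hγ).2, (ib hγ).2]

theorem SemTm.fst (ip : SemTm Γ p (.sigma A B)) : SemTm Γ (.fst p) A := fun γ γ' ρ hγ => by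
  obtain ⟨u, w, h, hu, hw⟩ := mem_el_sigma (ip hγ).1
  refine ⟨?_, by simp only [interp]; rw [(ip hγ).2]⟩
  simp only [interp]
  rw [h, pfst_pair]
  exact hu

theorem SemTm.snd (ip : SemTm Γ p (.sigma A B)) : SemTm Γ (.snd p) (B.inst (.fst p)) :=
    fun γ γ' ρ hγ => by
  obtain ⟨u, w, h, hu, hw⟩ := mem_el_sigma (ip hγ).1
  refine ⟨?_, by simp only [interp]; rw [(ip hγ).2]⟩
  rw [el_inst]
  simp only [interp]
  rw [h, pfst_pair, psnd_pair]
  exact hw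

/-- Object-level terms have trivial values, which settles the value side of all equations of the
signature. -/
theorem SemTm.of_tm_empty (h : SemTm Γ a (.tm A)) (hγ : Env Γ γ γ' ρ) : a.interp γ ρ = ∅ :=
  eq_empty_of_mem_el_tm (h hγ).1

end

end LF

/-! ### Realizability of the constants, and the fundamental lemma -/

namespace LF

open Exp Jdg

namespace Deriv

variable {Γ : List Exp} {A A' B B' C a a' b b' e f t : Exp}

theorem ite_congr (hC : Deriv Γ (hasTy C (.pi (tm Exp.bool) tp)))
    (hb : Deriv Γ (eqTm b b' (tm Exp.bool))) (ht : Deriv Γ (hasTy t (tm (.app C tru))))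
    (hf : Deriv Γ (hasTy f (tm (.app C fls)))) :
    Deriv Γ (eqTm (ite C b t f) (ite C b' t f) (tm (.app C b))) := by
  have h₁ := Deriv.app_congr (.tm_refl (.con .ite hC.ctx_of)) (.tm_refl hC)
  have h₂ := Deriv.app_congr h₁ hb
  have h₃ := Deriv.app_congr (A := tm (.app C tru)) (by
    simpa [inst, Exp.subst, up, single, wk_subst_up, wk_subst_single] using h₂) (.tm_refl ht)
  have h₄ := Deriv.app_congr (A := tm (.app C fls)) (by
    simpa [inst, Exp.subst, up, single, wk_subst_up, wk_subst_single] using h₃) (.tm_refl hf)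
  simpa [inst, Exp.subst, up, single, wk_subst_up, wk_subst_single] using h₄

theorem Pi_congr (hA : Deriv Γ (eqTm A A' tp)) (hB : Deriv Γ (eqTm B B' (.pi (tm A) tp))) :
    Deriv Γ (eqTm (Pi A B) (Pi A' B') tp) :=
  .app_congr (A := .pi (tm A) tp) (B := tp) (.app_congr (B := .pi (.pi (tm (.var 0)) tp) tp)
    (.tm_refl (.con .pi hA.ctx_of)) hA) hB

theorem App_congr {e' : Exp} (hA : Deriv Γ (eqTm A A' tp))
    (hB : Deriv Γ (eqTm B B' (.pi (tm A) tp))) (he : Deriv Γ (eqTm e e' (tm (Pi A B)))) :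
    Deriv Γ (eqTm (App A B e) (App A' B' e') (.pi (tm A) (tm (.app B.wk (.var 0))))) := by
  have h₁ := Deriv.app_congr (.tm_refl (.con .app hA.ctx_of)) hA
  have h₂ := Deriv.app_congr (A := .pi (tm A) tp) h₁ hB
  have h₃ := Deriv.app_congr (A := tm (Pi A B)) (by
    simpa [inst, Exp.subst, up, single, wk_subst_up, wk_subst_single] using h₂) he
  simpa [inst, Exp.subst, up, single, wk_subst_up, wk_subst_single] using h₃

end Deriv

theorem el_bool_eq (γ : ℕ → Exp) (ρ : ℕ → ZFSet.{0}) :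
    el (tm Exp.bool) γ ρ = cl (tm Exp.bool) (tmS boolCode) := rfl

theorem bool_mem : pt Exp.bool boolCode ∈ cl tp tpS := by
  refine mem_cl_tpS.2 ⟨.con .bool .nil, ZFSet.sep_subset, fun x hx => ?_, fun x x' hx e => ?_⟩
  · exact (mem_boolCode.1 hx).elim Deriv.left Deriv.left
  · exact mem_boolCode.2 ((mem_boolCode.1 hx).imp (.tm_trans (.tm_symm e)) (.tm_trans (.tm_symm e)))

theorem mem_cl_bool {x v} : pt x v ∈ cl (tm Exp.bool) (tmS boolCode) ↔
    v = ∅ ∧ (Deriv [] (eqTm x tru (tm Exp.bool)) ∨ Deriv [] (eqTm x fls (tm Exp.bool))) := by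
  rw [mem_cl_tmS bool_mem, mem_boolCode]

theorem tru_mem : pt tru ∅ ∈ cl (tm Exp.bool) (tmS boolCode) :=
  mem_cl_bool.2 ⟨rfl, .inl (.tm_refl (.con .tru .nil))⟩

theorem fls_mem : pt fls ∅ ∈ cl (tm Exp.bool) (tmS boolCode) :=
  mem_cl_bool.2 ⟨rfl, .inr (.tm_refl (.con .fls .nil))⟩

theorem mem_fam {A P B Q} (hB : pt B Q ∈ cl (.pi (tm A) tp) (famS A P)) :
    SupportedOn Q (cl (tm A) (tmS P)) ∧
      (∀ x v, pt x v ∈ cl (tm A) (tmS P) → pt (.app B x) (ap Q x v) ∈ cl tp tpS) ∧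
      ∀ x x' v, pt x v ∈ cl (tm A) (tmS P) → Deriv [] (eqTm x x' (tm A)) →
        ap Q x v = ap Q x' v :=
  mem_piS.1 (mem_of_mem_cl hB)

/-- A realized boolean is judgmentally `tru` or `fls`. The family takes the same value there as at
that constructor, and the computation rule makes the elimination equal to the chosen branch, which
is realized by assumption. -/
theorem semTm_con_ite (γ : ℕ → Exp) (ρ : ℕ → ZFSet.{0}) :
    pt (con .ite) ∅ ∈ el (Con.type .ite) γ ρ := by
  have hite : Deriv [] (hasTy (con .ite) (Con.type .ite)) := .con .ite .nil
  refine mem_el_pi_empty hite fun C Q hC h₁ => ?_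
  refine mem_el_pi_empty h₁ fun b v hb h₂ => ?_
  refine mem_el_pi_empty h₂ fun t w ht h₃ => ?_
  refine mem_el_pi_empty h₃ fun f u hf h₄ => ?_
  change pt C Q ∈ cl (.pi (tm Exp.bool) tp) (famS Exp.bool boolCode) at hC
  change pt b v ∈ cl (tm Exp.bool) (tmS boolCode) at hb
  change pt t w ∈ cl (tm (.app C tru)) (tmS (ap Q tru ∅)) at ht
  change pt f u ∈ cl (tm (.app C fls)) (tmS (ap Q fls ∅)) at hf
  change pt (ite C b t f) ∅ ∈ cl (tm (.app C b)) (tmS (ap Q b v))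
  have hC' := hasTy_of_mem_cl hC
  have ht' := hasTy_of_mem_cl ht
  have hf' := hasTy_of_mem_cl hf
  obtain ⟨_, hQ, hQ'⟩ := mem_fam hC
  obtain ⟨rfl, e | e⟩ := mem_cl_bool.1 hb
  · have e' := Deriv.tm_congr (Deriv.fam_app_congr (.tm_refl hC') e)
    rw [hQ' _ _ _ hb e, cl_congr e']
    obtain ⟨rfl, _⟩ := mem_tmS.1 (mem_of_mem_cl ht)
    exact mem_cl_of_eqTm ht (.tm_trans (.tm_symm (.ite_tru hC' ht' hf'))
      (.eq_conv (.tm_symm (.ite_congr hC' e ht' hf')) e'))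
  · have e' := Deriv.tm_congr (Deriv.fam_app_congr (.tm_refl hC') e)
    rw [hQ' _ _ _ hb e, cl_congr e']
    obtain ⟨rfl, _⟩ := mem_tmS.1 (mem_of_mem_cl hf)
    exact mem_cl_of_eqTm hf (.tm_trans (.tm_symm (.ite_fls hC' ht' hf'))
      (.eq_conv (.tm_symm (.ite_congr hC' e ht' hf')) e'))

/-- Applications of `e` formed with equal annotations are equal, and the predicates in the family
`Q` are stable under equality. The reverse inclusion will follow by symmetry. -/
theorem piCode_subset {A P B Q} {A' B' : Exp} (eA : Deriv [] (eqTm A A' tp))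
    (eB : Deriv [] (eqTm B B' (.pi (tm A) tp))) (hA : pt A P ∈ cl tp tpS)
    (hB : pt B Q ∈ cl (.pi (tm A) tp) (famS A P)) : piCode A P B Q ⊆ piCode A' P B' Q := by
  intro z hz
  obtain ⟨_, e, rfl, _⟩ := ZFSet.mem_sep.1 hz
  obtain ⟨he, h⟩ := mem_piCode.1 hz
  refine mem_piCode.2 ⟨.conv he (.tm_congr (.Pi_congr eA eB)), fun x hx => ?_⟩
  have hx' : pt x ∅ ∈ cl (tm A) (tmS P) := (mem_cl_tmS hA).2 ⟨rfl, hx⟩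
  exact (mem_cl_tpS.1 ((mem_fam hB).2.1 x ∅ hx')).2.2.2 _ _ (h x hx)
    (.fun_app_congr (.App_congr eA eB (.tm_refl he)) (.tm_refl (hasTy_of_mem_cl hx')))

theorem famS_congr {A A' P} (e : Deriv [] (eqTm A A' tp)) : famS A P = famS A' P := by
  rw [famS, famS, cl_congr (.tm_congr e)]
  exact piS_congr (fun _ _ _ => rfl) fun x x' =>
    ⟨fun h => .eq_conv h (.tm_congr e), fun h => .eq_conv h (.ty_symm (.tm_congr e))⟩

theorem fam_congr {A A' : Exp} (e : Deriv [] (eqTm A A' tp)) :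
    Deriv [] (eqTy (.pi (tm A) tp) (.pi (tm A') tp)) :=
  .pi_congr (.tm_ty e.left) (.tm_congr e) (.ty_refl (.tp_ty (.cons .nil (.tm_ty e.left))))

theorem piCode_congr {A P B Q} {A' B' : Exp} (eA : Deriv [] (eqTm A A' tp))
    (eB : Deriv [] (eqTm B B' (.pi (tm A) tp))) (hA : pt A P ∈ cl tp tpS)
    (hB : pt B Q ∈ cl (.pi (tm A) tp) (famS A P)) : piCode A P B Q = piCode A' P B' Q := by
  have hB' : pt B' Q ∈ cl (.pi (tm A') tp) (famS A' P) := by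
    rw [← famS_congr eA, ← cl_congr (fam_congr eA)]
    exact mem_cl_of_eqTm hB eB
  have h₁ := piCode_subset eA eB hA hB
  have h₂ := piCode_subset (.tm_symm eA) (.eq_conv (.tm_symm eB) (fam_congr eA))
    (mem_cl_of_eqTm hA eA) hB'
  ext z
  exact ⟨fun h => h₁ h, fun h => h₂ h⟩

theorem piCode_mem {A P B Q} (hA : pt A P ∈ cl tp tpS)
    (hB : pt B Q ∈ cl (.pi (tm A) tp) (famS A P)) : pt (Pi A B) (piCode A P B Q) ∈ cl tp tpS := by
  refine mem_cl_tpS.2 ⟨.Pi_hasTy (hasTy_of_mem_cl hA) (hasTy_of_mem_cl hB), ZFSet.sep_subset,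
    fun x hx => (mem_piCode.1 hx).1, fun e e' he h => mem_piCode.2 ⟨h.right, fun x hx => ?_⟩⟩
  have hx' : pt x ∅ ∈ cl (tm A) (tmS P) := (mem_cl_tmS hA).2 ⟨rfl, hx⟩
  refine (mem_cl_tpS.1 ((mem_fam hB).2.1 x ∅ hx')).2.2.2 _ _ ((mem_piCode.1 he).2 x hx) ?_
  exact .fun_app_congr (.App_congr (.tm_refl (hasTy_of_mem_cl hA))
    (.tm_refl (hasTy_of_mem_cl hB)) h)
    (.tm_refl (hasTy_of_mem_cl hx'))

/-- The curried value must respect judgmental equality in both arguments. Changing `A` also changes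
the domain of the inner function, which `famS_congr` and `fam_congr` identify with the old one. -/
theorem semTm_con_pi (γ : ℕ → Exp) (ρ : ℕ → ZFSet.{0}) :
    pt (con .pi) (Con.interp .pi) ∈ el (Con.type .pi) γ ρ := by
  refine mem_el_pi_intro (.con .pi .nil) (supportedOn_lamS _ _) (fun A P hA => ?_)
    fun A A' P hA e => ?_
  · change pt A P ∈ cl tp tpS at hA
    rw [Con.interp, ap_lamS hA]
    refine mem_el_pi_intro (.app (B := .pi (.pi (tm (var 0)) tp) tp) (.con .pi .nil)
      (hasTy_of_mem_cl hA)) (supportedOn_lamS _ _) (fun B Q hB => ?_) fun B B' Q hB e => ?_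
    · change pt B Q ∈ cl (.pi (tm A) tp) (famS A P) at hB
      rw [ap_lamS hB]
      exact piCode_mem hA hB
    · change pt B Q ∈ cl (.pi (tm A) tp) (famS A P) at hB
      rw [ap_lamS hB, ap_lamS (mem_cl_of_eqTm hB e)]
      exact piCode_congr (.tm_refl (hasTy_of_mem_cl hA)) e hA hB
  · change pt A P ∈ cl tp tpS at hA
    rw [Con.interp, ap_lamS hA, ap_lamS (mem_cl_of_eqTm hA e), famS_congr e,
      cl_congr (fam_congr e)]
    refine lamS_congr fun B Q hB => ?_
    rw [← famS_congr e, ← cl_congr (fam_congr e)] at hB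
    exact piCode_congr e (.tm_refl (hasTy_of_mem_cl hB)) hA hB

/-- The object-level β-equation, read backwards, turns realizability of `f` at each argument into
membership of its abstraction in `piCode`. -/
theorem semTm_con_lam (γ : ℕ → Exp) (ρ : ℕ → ZFSet.{0}) :
    pt (con .lam) ∅ ∈ el (Con.type .lam) γ ρ := by
  have hlam : Deriv [] (hasTy (con .lam) (Con.type .lam)) := .con .lam .nil
  refine mem_el_pi_empty hlam fun A P hA h₁ => ?_
  refine mem_el_pi_empty h₁ fun B Q hB h₂ => ?_
  refine mem_el_pi_empty h₂ fun f g hf h₃ => ?_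
  have hf' : Deriv [] (hasTy f (.pi (tm A) (tm (.app B.wk (var 0))))) := hasTy_of_mem_el hf
  have hf₂ : ∀ x v, pt x v ∈ cl (tm A) (tmS P) →
      pt (.app f x) (ap g x v) ∈ cl (tm (.app B x)) (tmS (ap Q x v)) := (mem_el_pi hf).2.1
  change pt A P ∈ cl tp tpS at hA
  change pt B Q ∈ cl (.pi (tm A) tp) (famS A P) at hB
  have hA' := hasTy_of_mem_cl hA
  have hB' := hasTy_of_mem_cl hB
  change pt (Lam A B f) ∅ ∈ cl (tm (Pi A B)) (tmS (ap (ap (Con.interp .pi) A P) B Q))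
  rw [Con.interp, ap_lamS hA, ap_lamS hB, mem_cl_tmS (piCode_mem hA hB), mem_piCode]
  refine ⟨rfl, .Lam_hasTy hA' hB' hf', fun x hx => ?_⟩
  have hx' : pt x ∅ ∈ cl (tm A) (tmS P) := (mem_cl_tmS hA).2 ⟨rfl, hx⟩
  obtain ⟨_, _, _, h⟩ := mem_cl_tpS.1 ((mem_fam hB).2.1 x ∅ hx')
  exact h _ _ (mem_tmS.1 (mem_of_mem_cl (hf₂ x ∅ hx'))).2
    (.tm_symm (.app_lam hA' hB' hf' (hasTy_of_mem_cl hx')))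

/-- Membership in `piCode` was defined by applications, so it unfolds to the claim. -/
theorem semTm_con_app (γ : ℕ → Exp) (ρ : ℕ → ZFSet.{0}) :
    pt (con .app) ∅ ∈ el (Con.type .app) γ ρ := by
  have happ : Deriv [] (hasTy (con .app) (Con.type .app)) := .con .app .nil
  refine mem_el_pi_empty happ fun A P hA h₁ => ?_
  refine mem_el_pi_empty h₁ fun B Q hB h₂ => ?_
  refine mem_el_pi_empty h₂ fun e u he h₃ => ?_
  refine mem_el_pi_empty h₃ fun x v hx _ => ?_
  change pt A P ∈ cl tp tpS at hA
  change pt B Q ∈ cl (.pi (tm A) tp) (famS A P) at hB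
  change pt e u ∈ cl (tm (Pi A B)) (tmS (ap (ap (Con.interp .pi) A P) B Q)) at he
  change pt x v ∈ cl (tm A) (tmS P) at hx
  change pt (.app (App A B e) x) ∅ ∈ cl (tm (.app B x)) (tmS (ap Q x v))
  rw [Con.interp, ap_lamS hA, ap_lamS hB, mem_cl_tmS (piCode_mem hA hB), mem_piCode] at he
  rw [mem_cl_tmS ((mem_fam hB).2.1 x v hx)]
  obtain ⟨rfl, hP⟩ := (mem_cl_tmS hA).1 hx
  exact ⟨rfl, he.2.2 x hP⟩

theorem semTm_con (Γ : List Exp) (c : Con) : SemTm Γ (con c) c.type := fun γ _ ρ _ => by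
  refine ⟨?_, rfl⟩
  cases c with
  | bool => exact bool_mem
  | tru => exact tru_mem
  | fls => exact fls_mem
  | ite => exact semTm_con_ite γ ρ
  | pi => exact semTm_con_pi γ ρ
  | lam => exact semTm_con_lam γ ρ
  | app => exact semTm_con_app γ ρ

/-- For an equation it mostly suffices to compare values and validate one side. The β-rules come
from `ap_lamS`, `pfst_pair` and `psnd_pair`; η for functions comes from support, and η for pairs
from the form of their values; reflection comes from the meaning of `eq`. -/
theorem Deriv.sem {Γ J} (h : Deriv Γ J) : J.Sem Γ := by
  induction h with
  | nil => trivial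
  | cons => trivial
  | unit_ty => exact fun _ _ _ _ => rfl
  | pi_ty hA hB iA iB => exact SemTy.pi hA hB iA iB
  | sigma_ty hA hB iA iB => exact SemTy.sigma hA hB iA iB
  | eq_ty _ _ _ _ ia ib =>
    intro γ γ' ρ hγ
    simp only [interp]
    rw [(ia hγ).2, (ib hγ).2]
  | tp_ty => exact fun _ _ _ _ => rfl
  | tm_ty _ iA =>
    intro γ γ' ρ hγ
    simp only [interp]
    rw [(iA hγ).2]
  | ty_refl _ i => exact ⟨i, i, fun _ _ _ => rfl⟩
  | ty_symm _ i => exact ⟨i.2.1, i.1, i.2.2.symm⟩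
  | ty_trans _ _ i i' => exact ⟨i.1, i'.2.1, fun _ _ hγ => (i.2.2 hγ).trans (i'.2.2 hγ)⟩
  | pi_congr hA eA eB iA iA' iB =>
    exact (SameInterp.pi hA eA eB iA iA'.2.2 iB.2.2).eqTy (SemTy.pi hA eB.presup.1 iA iB.1)
  | sigma_congr hA eA eB iA iA' iB =>
    exact (SameInterp.sigma hA eA eB iA iA'.2.2 iB.2.2).eqTy (SemTy.sigma hA eB.presup.1 iA iB.1)
  | eq_congr _ _ _ _ ia ib =>
    refine SameInterp.eqTy (fun γ ρ hγ => ?_) fun γ γ' ρ hγ => ?_ <;> simp only [interp]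
    · rw [ia.2.2 hγ, ib.2.2 hγ]
    · rw [(ia.1 hγ).2, (ib.1 hγ).2]
  | tm_congr _ i =>
    refine SameInterp.eqTy (fun γ ρ hγ => ?_) fun γ γ' ρ hγ => ?_ <;> simp only [interp]
    · rw [i.2.2 hγ]
    · rw [(i.1 hγ).2]
  | var _ hn => exact fun γ γ' ρ hγ => ⟨hγ.mem_of_hasVar hn, rfl⟩
  | conv _ e i i' => exact SemTm.conv i e i'.2.2
  | star =>
    exact fun γ γ' ρ hγ =>
      ⟨mem_cl.2 ⟨.star .nil, fun _ _ => mem_ptSep.2 ⟨by simp [interp], trivial⟩⟩,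
      rfl⟩
  | lam hA hb iA ib => exact SemTm.lam hA hb iA ib
  | app _ ha iF ia => exact SemTm.app ha iF ia
  | pair hA hB ha hb _ iB ia ib => exact SemTm.pair hA hB ha hb iB ia ib
  | fst _ i => exact SemTm.fst i
  | snd _ i => exact SemTm.snd i
  | refl hA ha =>
    exact fun γ γ' ρ hγ => ⟨mem_cl.2 ⟨hγ.subst (.refl hA ha), fun _ _ => mem_ptSep.2
      ⟨by simp [interp], rfl⟩⟩, rfl⟩
  | con c => exact semTm_con _ c
  | tm_refl _ i => exact ⟨i, i, fun _ _ _ => rfl⟩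
  | tm_symm _ i => exact ⟨i.2.1, i.1, i.2.2.symm⟩
  | tm_trans _ _ i i' => exact ⟨i.1, i'.2.1, fun _ _ hγ => (i.2.2 hγ).trans (i'.2.2 hγ)⟩
  | eq_conv _ e i i' => exact ⟨i.1.conv e i'.2.2, i.2.1.conv e i'.2.2, i.2.2⟩
  | lam_congr hA eA eb iA iA' ib =>
    refine SameInterp.eqTm (fun γ ρ hγ => ?_) (SemTm.lam hA eb.left iA ib.1)
      (.lam_congr hA eA eb)
    rw [interp_lam, interp_lam, ← iA'.2.2.el_eq eA hγ]
    exact lamS_congr fun x v hx => ib.2.2 (hγ.ext_self hA iA hx)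
  | app_congr ef ea iF ia =>
    refine SameInterp.eqTm (fun γ ρ hγ => ?_) (SemTm.app ea.left iF.1 ia.1) (.app_congr ef ea)
    simp only [interp]
    rw [iF.1.ap_eq ia.1 hγ (hγ.subst ea), iF.2.2 hγ, ia.2.2 hγ]
  | pair_congr hA eB ea eb iA iB ia ib =>
    refine SameInterp.eqTm (fun γ ρ hγ => ?_)
      (SemTm.pair hA eB.presup.1 ea.left eb.left iB.1 ia.1 ib.1) (.pair_congr hA eB ea eb)
    simp only [interp]
    rw [ia.2.2 hγ, ib.2.2 hγ]
  | fst_congr e i =>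
    refine SameInterp.eqTm (fun γ ρ hγ => ?_) (SemTm.fst i.1) (.fst_congr e)
    simp only [interp]
    rw [i.2.2 hγ]
  | snd_congr e i =>
    refine SameInterp.eqTm (fun γ ρ hγ => ?_) (SemTm.snd i.1) (.snd_congr e)
    simp only [interp]
    rw [i.2.2 hγ]
  | unit_eta ha i =>
    exact SameInterp.eqTm (fun γ ρ hγ => eq_empty_of_mem_el_unit (i hγ).1) i (.unit_eta ha)
  | pi_beta hA hb ha iA ib ia =>
    refine SameInterp.eqTm (fun γ ρ hγ => ?_) (SemTm.app ha (SemTm.lam hA hb iA ib) ia)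
      (.pi_beta hA hb ha)
    rw [interp_inst, interp, interp_lam, ap_lamS (ia hγ).1]
  | pi_eta hf i =>
    refine SameInterp.eqTm (fun γ ρ hγ => ?_) i (.pi_eta hf)
    rw [interp_lam]
    simp only [interp, interp_wk]
    exact (lamS_ap (mem_el_pi (i hγ).1).1).symm
  | fst_beta hA hB ha hb _ _ ia _ =>
    refine SameInterp.eqTm' (fun γ ρ hγ => ?_) ia (.fst_beta hA hB ha hb)
    simp only [interp, pfst_pair]
  | snd_beta hA hB ha hb _ _ _ ib =>
    refine SameInterp.eqTm' (fun γ ρ hγ => ?_) ib (.snd_beta hA hB ha hb)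
    simp only [interp, psnd_pair]
  | sigma_eta hp i =>
    refine SameInterp.eqTm (fun γ ρ hγ => ?_) i (.sigma_eta hp)
    obtain ⟨u, w, h, _⟩ := mem_el_sigma (i hγ).1
    simp only [interp]
    rw [h, pfst_pair, psnd_pair]
  | reflection ha hb hp ia ib ip =>
    exact ⟨ia, ib, fun γ ρ hγ => (eq_of_mem_el_eq (ip hγ).1).2⟩
  | eq_eta hp i =>
    exact SameInterp.eqTm (fun γ ρ hγ => (eq_of_mem_el_eq (i hγ).1).1) i (.eq_eta hp)
  | ite_tru hC ht hf _ it _ =>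
    refine SameInterp.eqTm' (fun γ ρ hγ => ?_) it (.ite_tru hC ht hf)
    rw [it.of_tm_empty hγ]
    simp only [interp, Con.interp, ap_empty]
  | ite_fls hC ht hf _ _ it =>
    refine SameInterp.eqTm' (fun γ ρ hγ => ?_) it (.ite_fls hC ht hf)
    rw [it.of_tm_empty hγ]
    simp only [interp, Con.interp, ap_empty]
  | @app_lam Γ A B f a hA hB hf ha _ _ iF ia =>
    have i : SemTm Γ (.app f a) (tm (.app B a)) := by
      have := SemTm.app ha iF ia
      simpa [inst, Exp.subst, single, wk_subst_single] using this
    refine SameInterp.eqTm' (fun γ ρ hγ => ?_) i (.app_lam hA hB hf ha)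
    rw [i.of_tm_empty hγ]
    simp only [interp, Con.interp, ap_empty]
  | lam_app hA hB he _ _ i =>
    refine SameInterp.eqTm' (fun γ ρ hγ => ?_) i (.lam_app hA hB he)
    rw [i.of_tm_empty hγ]
    simp only [interp, Con.interp, ap_empty]

/-- Canonicity: closed booleans are judgmentally equal to `tru` or to `fls`. -/
theorem canonicity {b : Exp} (h : Derivable [] (hasTy b (tm Exp.bool))) :
    Derivable [] (eqTm b tru (tm Exp.bool)) ∨ Derivable [] (eqTm b fls (tm Exp.bool)) := by
  -- Any environment realizes the empty context; the identity substitution is chosen so that `b`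
  -- itself remains.
  have hb := (h.deriv.sem (Env.nil Exp.var Exp.var fun _ => ∅)).1
  rw [el_bool_eq, Exp.subst_var, mem_cl_bool] at hb
  exact hb.2.imp Deriv.derivable Deriv.derivable

end LF

theorem mainTheorem1 :
    -- the canonicity gluing model over an arbitrary model `M` of the signature
    (∀ (C : Type v) [SmallCategory C] (t : C) (_ : Limits.IsTerminal t) (M : STC.Model C),
      ∃ N : STC.Model (WithTerminal C), N.syn = M ∧ N.IsCanonicityModel t) ∧
    -- canonicity of the syntax
    (∀ b : LF.Exp, LF.Derivable [] (.hasTy b (.tm .bool)) →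
      LF.Derivable [] (.eqTm b .tru (.tm .bool)) ∨ LF.Derivable [] (.eqTm b .fls (.tm .bool))) := by
  refine ⟨fun C _ t ht M => ⟨M.gluing ht, M.gluing_syn ht, M.gluing_isCanonicityModel ht⟩,
    fun b h => LF.canonicity h⟩
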